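/- An instance of the list coloring reconfiguration problem consists of a finite simple graph $G=(V,E)$, a number $k$ of colors, a list $L(v)\subseteq C=\{1,\dots,k\}$ for every vertex $v$, and two $k$-list colorings $f_0,f_r$ of $G$, where a $k$-list coloring is a map $f:V\to C$ with $f(v)\in L(v)$ for all $v\in V$ and $f(v)\neq f(w)$ for every edge $vw\in E$. The reconfiguration graph of $(G,L)$ has the $k$-list colorings of $G$ as its nodes, two of them being adjacent if they differ at exactly one vertex; the problem asks whether it contains a path from $f_0$ to $f_r$. A path-decomposition of $G$ is a finite sequence of subsets $X_1,\dots,X_m\subseteq V$ that cover $V$, such that every edge has both ends in some $X_i$, and $X_p\cap X_r\subseteq X_q$ whenever $p\le q\le r$; its width is $\max_i|X_i|-1$, and the pathwidth of $G$ is the minimum width of a path-decomposition of $G$. **Theorem.** The $k$-list coloring reconfiguration problem can be solved in polynomial time on graphs of pathwidth one, and more generally of pathwidth at most one (the connected ones among these are the caterpillars). That is, there are a Turing machine and a polynomial $p$ such that, for every instance $(G,k,L,f_0,f_r)$ in which $G$ has pathwidth at most one, the machine, given the instance as a string of some length $N$, halts after at most $p(N)$ steps and correctly answers whether there is a path from $f_0$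 to $f_r$ in the reconfiguration graph. Here $k$ is part of the input, $G$ is given by its adjacency matrix, the lists are given explicitly, and $k$ and all colors are written in binary. -/

import Mathlib

namespace ListRecoloring

/-- A path-decomposition of a graph: a finite sequence of vertex subsets (bags). -/
structure PathDecomposition {V : Type*} (G : SimpleGraph V) where
  /-- the number of bags -/
  length : ℕ
  /-- the bags -/
  bag : Fin length → Finset V
  cover : ∀ v, ∃ i, v ∈ bag i
  edge : ∀ v w, G.Adj v w → ∃ i, v ∈ bag i ∧ w ∈ bag i
  interpolate : ∀ p q r, p ≤ q → q ≤ r → ∀ v, v ∈ bag p → v ∈ bag r → v ∈ bag q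

/-- The width: the maximal size of a bag, minus one. (The width of a decomposition without
a nonempty bag, possible only for the graph without vertices, is `0` here.) -/
def PathDecomposition.width {V : Type*} {G : SimpleGraph V} (P : PathDecomposition G) : ℕ :=
  (Finset.univ.sup fun i => (P.bag i).card) - 1

/-- The pathwidth of a (finite) graph: the minimal width of a path-decomposition. -/
noncomputable def pathwidth {V : Type*} (G : SimpleGraph V) : ℕ :=
  sInf {t | ∃ P : PathDecomposition G, P.width = t}

/-- The list colorings of `G` with lists `L`: proper colorings `f` with `f v ∈ L v` for all `v`. -/
abbrev ListColoring {V C : Type*} (G : SimpleGraph V) (L : V → Finset C) :=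
  {f : G.Coloring C // ∀ v, f v ∈ L v}

/-- The reconfiguration graph: its nodes are the list colorings, and two of them are adjacent
if they differ at exactly one vertex. -/
def reconfigurationGraph {V C : Type*} (G : SimpleGraph V) (L : V → Finset C) :
    SimpleGraph (ListColoring G L) where
  Adj f g := {v | f.1 v ≠ g.1 v}.ncard = 1
  symm := ⟨fun f g h => by simpa only [ne_comm] using h⟩
  loopless := ⟨fun f h => by simp at h⟩

/-- An instance of list coloring reconfiguration. The vertices are `0, …, n - 1` and the colors
are `0, …, k - 1`; the number `k` of colors is part of the instance. -/
structure Instance where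
  n : ℕ
  graph : SimpleGraph (Fin n)
  k : ℕ
  list : Fin n → Finset (Fin k)
  start : ListColoring graph list
  target : ListColoring graph list

/-- The yes-instances: the reconfiguration graph has a path from `start` to `target`. -/
def Instance.IsYes (I : Instance) : Prop :=
  (reconfigurationGraph I.graph I.list).Reachable I.start I.target

/-- The input alphabet: the two bits, a mark that ends a word, and a mark that ends a block. -/
inductive Symbol where
  | bit (b : Bool)
  | endWord
  | endBlock
  deriving DecidableEq, Fintype

/-- The string for a sequence of blocks, each of which is a sequence of binary words. -/
def encodeBlocks (T : List (List (List Bool))) : List Symbol :=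
  T.flatMap fun B => (B.flatMap fun w => w.map Symbol.bit ++ [Symbol.endWord]) ++ [Symbol.endBlock]

open Classical in
/-- The block of a vertex `v`: the row of `v` in the adjacency matrix, the initial and the target
color of `v`, and the elements of the list of `v` in increasing order, all colors in binary. -/
noncomputable def Instance.vertexBlock (I : Instance) (v : Fin I.n) : List (List Bool) :=
  ((List.finRange I.n).map fun w => decide (I.graph.Adj v w)) ::
    Computability.encodeNat (I.start.1 v) ::
    Computability.encodeNat (I.target.1 v) ::
    (I.list v).sort.map fun c : Fin I.k => Computability.encodeNat c

/-- An instance as a string: a block with `k` in binary, then the blocks of the vertices. -/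
noncomputable def Instance.encode (I : Instance) : List Symbol :=
  encodeBlocks ([Computability.encodeNat I.k] :: (List.finRange I.n).map I.vertexBlock)

open Classical in
/-- List coloring reconfiguration, restricted to the instances whose graph lies in the class `𝒢`,
is solvable in polynomial time: some Turing machine, given the string of such an instance, halts
with the correct answer (one bit) after a number of steps that is bounded by a fixed polynomial
in the length of the string. -/
def SolvableInPolyTimeOn (𝒢 : ∀ n : ℕ, SimpleGraph (Fin n) → Prop) : Prop :=
  Nonempty (Turing.TM2ComputableInPolyTime
    (fun I : {I : Instance // 𝒢 I.n I.graph} => I.1.encode)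
    Computability.encodeBool
    (fun I => decide I.1.IsYes))

end ListRecoloring

/-! The algorithm removes the vertices one by one, each time a vertex `w` with at most one remaining
neighbor `v`. Every vertex carries a local state graph: a connected graph of states would do, each
state having a color, and the component of the initial state is what counts. At first the states of
a vertex are the colors of its list, any two of them adjacent. The only obstacle for `w` is the
color of `v`. While `v` stays in a state `x`, `w` can move freely within a component of its own
state graph minus the color of `x`. So `w` is forgotten except for this component: the new states of
`v` are the pairs of a state `x` and such a component. Two pairs are adjacent if `v` may move from
the one state to the other and the two components share a state of `w` in which `w` can wait during
that move. If the target state of `w` is not reachable from its initial state, the answer is no;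
otherwise the elimination preserves the answer (`yes_iff_eliminated`).

This works on every forest, but the state graphs may become too large. The point is that numbers of
states merely add up when `w` is absorbed into a vertex `v` whose states have pairwise different
colors (`length_absorb_of_colorInj`). Choose a state `y` of the component nearest to the initial
state of `w`. If `y` is not the initial state, then its predecessor on a shortest path has the
avoided color, so that `y` determines `x` and the component; if `y` is the initial state, then `x`
determines the component.

On caterpillars the order of elimination can be chosen so that this always applies. Leaves that have
absorbed nothing go first. Their state graphs are complete, hence stay connected when a color is
removed, and the colors of `v` stay distinct (`colorInj_absorb`). When no such leaf is left, an end
`w` of the remaining spine is absorbed. This may repeat colors at its neighbor `v`, but `v` then has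
at most one neighbor left and is eliminated next, so nothing is absorbed into it any more
(`Inv.phase_eliminated`). Thus the total number of states never grows, and neither does the total
size of their names. The two facts on pathwidth one that are used are the existence of leaves in all
induced subgraphs and that of any three neighbors of a vertex one is pendant
(`caterpillar_of_pathwidth_le_one`).

For the Turing machine, structured programs on stacks are compiled to machine code. Data are binary
trees in prefix code on one stack, and functions on them are assembled from combinators that
preserve polynomial time. A fold is admitted if its intermediate results have polynomial size
(`PT.foldl`), which for the main loop is the count above. -/

namespace ListRecoloring

open Turing

/-! ### Structured programs over finitely many stacks -/

section Programs

variable {K : Type} [DecidableEq K] {Γ : K → Type} {σ : Type}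

/-- Structured programs that act on a finite register of type `σ` and on stacks. -/
inductive Prog (Γ : K → Type) (σ : Type) : Type
  | push (k : K) (f : σ → Γ k) : Prog Γ σ
  | pop (k : K) (f : σ → Option (Γ k) → σ) : Prog Γ σ
  | seq (p q : Prog Γ σ) : Prog Γ σ
  | ite (b : σ → Bool) (p q : Prog Γ σ) : Prog Γ σ
  | loop (b : σ → Bool) (p : Prog Γ σ) : Prog Γ σ

/-- `Run p v S v' S' t`: started with register `v` and stacks `S`, the program `p` ends with
register `v'` and stacks `S'` after `t` steps. -/
inductive Run : Prog Γ σ → σ → (∀ k, List (Γ k)) → σ → (∀ k, List (Γ k)) → ℕ → Prop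
  | push {k f v S} : Run (.push k f) v S v (Function.update S k (f v :: S k)) 1
  | pop {k f v S} : Run (.pop k f) v S (f v (S k).head?) (Function.update S k (S k).tail) 1
  | seq {p q v S v' S' v'' S'' t t'} : Run p v S v' S' t → Run q v' S' v'' S'' t' →
      Run (.seq p q) v S v'' S'' (t + t')
  | ite_true {b p q v S v' S' t} : b v = true → Run p v S v' S' t →
      Run (.ite b p q) v S v' S' (t + 1)
  | ite_false {b p q v S v' S' t} : b v = false → Run q v S v' S' t →
      Run (.ite b p q) v S v' S' (t + 1)
  | loop_true {b p v S v' S' v'' S'' t t'} : b v = true → Run p v S v' S' t →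
      Run (.loop b p) v' S' v'' S'' t' → Run (.loop b p) v S v'' S'' (t + t' + 1)
  | loop_false {b p v S} : b v = false → Run (.loop b p) v S v S 1

/-- Every step pushes at most one symbol onto a given stack. -/
theorem Run.length_le {p : Prog Γ σ} {v v' : σ} {S S' : ∀ k, List (Γ k)} {t : ℕ}
    (h : Run p v S v' S' t) (k : K) : (S' k).length ≤ (S k).length + t := by
  induction h with
  | @push k' f v S =>
    by_cases hk : k = k'
    · subst hk; simp
    · simp [Function.update_of_ne hk]
  | @pop k' f v S =>
    by_cases hk : k = k'
    · subst hk; simp; omega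
    · simp [Function.update_of_ne hk]
  | seq _ _ h₁ h₂ => omega
  | ite_true _ _ h => omega
  | ite_false _ _ h => omega
  | loop_true _ _ _ h₁ h₂ => omega
  | loop_false _ => omega

/-- The program points of a program. -/
def Prog.Point : Prog Γ σ → Type
  | .push _ _ => Unit
  | .pop _ _ => Unit
  | .seq p q => p.Point ⊕ q.Point
  | .ite _ p q => Option (p.Point ⊕ q.Point)
  | .loop _ p => Option p.Point

/-- There are finitely many program points. -/
noncomputable instance Prog.fintypePoint : (p : Prog Γ σ) → Fintype p.Point
  | .push _ _ => inferInstanceAs (Fintype Unit)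
  | .pop _ _ => inferInstanceAs (Fintype Unit)
  | .seq p q =>
    letI := p.fintypePoint; letI := q.fintypePoint
    inferInstanceAs (Fintype (p.Point ⊕ q.Point))
  | .ite _ p q =>
    letI := p.fintypePoint; letI := q.fintypePoint
    inferInstanceAs (Fintype (Option (p.Point ⊕ q.Point)))
  | .loop _ p =>
    letI := p.fintypePoint
    inferInstanceAs (Fintype (Option p.Point))

/-- The point at which the execution of a program starts. -/
def Prog.entry : (p : Prog Γ σ) → p.Point
  | .push _ _ => ()
  | .pop _ _ => ()
  | .seq p _ => Sum.inl p.entry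
  | .ite _ _ _ => (none : Option _)
  | .loop _ _ => (none : Option _)

/-- The machine code of a program whose points have the labels `emb` and that continues
at the label `next`. -/
def Prog.code {Λ : Type} : (p : Prog Γ σ) → (p.Point → Λ) → Λ → p.Point → TM2.Stmt Γ Λ σ
  | .push k f, _, next, _ => .push k f (.goto fun _ => next)
  | .pop k f, _, next, _ => .pop k f (.goto fun _ => next)
  | .seq p q, emb, next, l =>
    match l with
    | Sum.inl l => p.code (fun x => emb (Sum.inl x)) (emb (Sum.inr q.entry)) l
    | Sum.inr l => q.code (fun x => emb (Sum.inr x)) next l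
  | .ite b p q, emb, next, l =>
    match l with
    | none => .branch b (.goto fun _ => emb (some (Sum.inl p.entry)))
        (.goto fun _ => emb (some (Sum.inr q.entry)))
    | some (Sum.inl l) => p.code (fun x => emb (some (Sum.inl x))) next l
    | some (Sum.inr l) => q.code (fun x => emb (some (Sum.inr x))) next l
  | .loop b p, emb, next, l =>
    match l with
    | none => .branch b (.goto fun _ => emb (some p.entry)) (.goto fun _ => next)
    | some l => p.code (fun x => emb (some x)) (emb none) l

/-- `Steps M c c' t`: the machine `M` gets from `c` to `c'` in exactly `t` steps. -/
inductive Steps {Λ : Type} (M : Λ → TM2.Stmt Γ Λ σ) :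
    TM2.Cfg Γ Λ σ → TM2.Cfg Γ Λ σ → ℕ → Prop
  | refl (c) : Steps M c c 0
  | head {c c' c'' t} : TM2.step M c = some c' → Steps M c' c'' t → Steps M c c'' (t + 1)

theorem Steps.trans {Λ : Type} {M : Λ → TM2.Stmt Γ Λ σ} {c c' c'' : TM2.Cfg Γ Λ σ} {t t' : ℕ}
    (h : Steps M c c' t) (h' : Steps M c' c'' t') : Steps M c c'' (t + t') := by
  induction h with
  | refl => simpa using h'
  | head hs _ ih => rw [add_right_comm]; exact .head hs (ih h')

theorem Steps.iterate {Λ : Type} {M : Λ → TM2.Stmt Γ Λ σ} {c c' : TM2.Cfg Γ Λ σ} {t : ℕ}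
    (h : Steps M c c' t) : (flip bind (TM2.step M))^[t] (some c) = some c' := by
  induction h with
  | refl => rfl
  | head hs _ ih => rw [Function.iterate_succ_apply]; simpa [flip, hs] using ih

/-- The machine code of a program simulates the program. -/
theorem Run.steps {Λ : Type} (M : Λ → TM2.Stmt Γ Λ σ) {p : Prog Γ σ} {v v' : σ}
    {S S' : ∀ k, List (Γ k)} {t : ℕ} (h : Run p v S v' S' t) :
    ∀ (emb : p.Point → Λ) (next : Λ), (∀ l, M (emb l) = p.code emb next l) →
      Steps M ⟨some (emb p.entry), v, S⟩ ⟨some next, v', S'⟩ t := by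
  induction h with
  | push =>
    intro emb next hM
    refine .head ?_ (.refl _)
    simp only [TM2.step, hM, Prog.code, TM2.stepAux]
  | pop =>
    intro emb next hM
    refine .head ?_ (.refl _)
    simp only [TM2.step, hM, Prog.code, TM2.stepAux]
  | seq _ _ ih₁ ih₂ =>
    intro emb next hM
    exact (ih₁ (fun x => emb (Sum.inl x)) _ fun l => hM (Sum.inl l)).trans
      (ih₂ (fun x => emb (Sum.inr x)) next fun l => hM (Sum.inr l))
  | ite_true hb _ ih =>
    intro emb next hM
    refine .head ?_ (ih (fun x => emb (some (Sum.inl x))) next fun l => hM (some (Sum.inl l)))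
    have := hM none
    simp only [Prog.code] at this
    simp only [TM2.step, Prog.entry, this, TM2.stepAux, hb, cond_true]
  | ite_false hb _ ih =>
    intro emb next hM
    refine .head ?_ (ih (fun x => emb (some (Sum.inr x))) next fun l => hM (some (Sum.inr l)))
    have := hM none
    simp only [Prog.code] at this
    simp only [TM2.step, Prog.entry, this, TM2.stepAux, hb, cond_false]
  | loop_true hb _ _ ih₁ ih₂ =>
    intro emb next hM
    refine .head ?_ ((ih₁ (fun x => emb (some x)) (emb none) fun l => hM (some l)).trans
      (ih₂ emb next hM))
    have := hM none
    simp only [Prog.code] at this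
    simp only [TM2.step, Prog.entry, this, TM2.stepAux, hb, cond_true]
  | loop_false hb =>
    intro emb next hM
    refine .head ?_ (.refl _)
    have := hM none
    simp only [Prog.code] at this
    simp only [TM2.step, Prog.entry, this, TM2.stepAux, hb, cond_false]

/-- The Turing machine that runs a program and then halts. -/
noncomputable def Prog.machine [Fintype K] [Fintype σ] (p : Prog Γ σ) (k₀ k₁ : K)
    [Fintype (Γ k₀)] (v₀ : σ) : FinTM2 where
  K := K
  k₀ := k₀
  k₁ := k₁
  Γ := Γ
  Λ := Option p.Point
  main := some p.entry
  σ := σ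
  initialState := v₀
  m
    | none => .halt
    | some l => p.code some none l

/-- A run of a program that ends with the initial register gives a halting run of its machine. -/
theorem Run.evals [Fintype K] [Fintype σ] {p : Prog Γ σ} (k₀ k₁ : K) [Fintype (Γ k₀)] {v₀ : σ}
    {S S' : ∀ k, List (Γ k)} {t : ℕ} (h : Run p v₀ S v₀ S' t) :
    (flip bind (p.machine k₀ k₁ v₀).step)^[t + 1]
      (some (⟨some (some p.entry), v₀, S⟩ : TM2.Cfg Γ (Option p.Point) σ)) =
      some (⟨none, v₀, S'⟩ : TM2.Cfg Γ (Option p.Point) σ) := by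
  have h₁ := h.steps (p.machine k₀ k₁ v₀).m some none fun l => rfl
  -- The additional step executes `halt` at the label `none`.
  exact (h₁.trans (.head (c' := ⟨none, v₀, S'⟩) rfl (.refl _))).iterate

end Programs

/-! ### Binary trees on a stack -/

/-- Binary trees, the data on which the programs below operate. -/
inductive Tm where
  | nil
  | cons (a b : Tm)
  deriving DecidableEq

namespace Tm

/-- The prefix code of a tree. -/
def code : Tm → List Bool
  | nil => [false]
  | cons a b => true :: (code a ++ code b)

/-- The length of the code of a tree. -/
def size (x : Tm) : ℕ := x.code.length

@[simp] theorem size_nil : size nil = 1 := rfl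

@[simp] theorem size_cons (a b : Tm) : size (cons a b) = size a + size b + 1 := by
  simp [size, code]

theorem size_pos (x : Tm) : 0 < x.size := by
  cases x <;> simp

/-- The code is prefix-free, so trees can lie on a stack without separators. -/
theorem code_append_inj : ∀ {x y : Tm} {r s : List Bool},
    x.code ++ r = y.code ++ s → x = y ∧ r = s
  | nil, nil, _, _, h => by simpa [code] using h
  | nil, cons _ _, _, _, h => by simp [code] at h
  | cons _ _, nil, _, _, h => by simp [code] at h
  | cons a b, cons c d, r, s, h => by
    simp only [code, List.cons_append, List.cons.injEq, true_and, List.append_assoc] at h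
    obtain ⟨h₁, h₂⟩ := code_append_inj h
    obtain ⟨h₃, h₄⟩ := code_append_inj h₂
    exact ⟨by rw [h₁, h₃], h₄⟩

theorem code_injective : Function.Injective code := fun x y h =>
  (code_append_inj (r := []) (s := []) (by simpa using h)).1

/-- The left subtree. -/
def hd : Tm → Tm
  | nil => nil
  | cons a _ => a

/-- The right subtree. -/
def tl : Tm → Tm
  | nil => nil
  | cons _ b => b

end Tm

/-- The working stacks: the main stack, two buffers and a counter. -/
inductive Work where
  | main | tmp | aux | cnt
  deriving DecidableEq

instance : Fintype Work := ⟨{.main, .tmp, .aux, .cnt}, fun w => by cases w <;> decide⟩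

/-- The stacks of the machine. -/
inductive Stk where
  | inp | out | work (w : Work)
  deriving DecidableEq, Fintype

/-- The alphabets of the stacks. -/
abbrev Alph : Stk → Type
  | .inp => Symbol
  | .out => Bool
  | .work _ => Bool

instance : Fintype (Alph .inp) := inferInstanceAs (Fintype Symbol)

/-- Programs on the stacks `Stk`; the register holds the symbol that was read last. -/
abbrev SProg := Prog Alph (Option Symbol)

/-- The contents of all stacks. -/
def stks (i : List Symbol) (o : List Bool) (W : Work → List Bool) : ∀ k, List (Alph k)
  | .inp => i
  | .out => o
  | .work w => W w

/-- The contents of the working stacks. -/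
def works (a b c d : List Bool) : Work → List Bool
  | .main => a
  | .tmp => b
  | .aux => c
  | .cnt => d

theorem update_stks_work (i o W w) (x : List Bool) :
    Function.update (stks i o W) (.work w) x = stks i o (Function.update W w x) := by
  funext k
  rcases k with _ | _ | k
  · rfl
  · rfl
  · by_cases h : k = w
    · subst h
      rw [Function.update_self]
      exact (Function.update_self (f := W) k x).symm
    · rw [Function.update_of_ne (by simpa using h)]
      exact (Function.update_of_ne (f := W) h x).symm

theorem update_stks_inp (i o W x) : Function.update (stks i o W) .inp x = stks x o W := by
  funext k; rcases k with _ | _ | k <;> rfl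

theorem update_stks_out (i o W x) : Function.update (stks i o W) .out x = stks i x W := by
  funext k; rcases k with _ | _ | k <;> rfl

@[simp] theorem update_works_main (a b c d x) :
    Function.update (works a b c d) .main x = works x b c d := by
  funext w; cases w <;> rfl

@[simp] theorem update_works_tmp (a b c d x) :
    Function.update (works a b c d) .tmp x = works a x c d := by
  funext w; cases w <;> rfl

@[simp] theorem update_works_aux (a b c d x) :
    Function.update (works a b c d) .aux x = works a b x d := by
  funext w; cases w <;> rfl

@[simp] theorem update_works_cnt (a b c d x) :
    Function.update (works a b c d) .cnt x = works a b c x := by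
  funext w; cases w <;> rfl

/-- A run that leaves input and output alone. -/
def WRun (p : SProg) (v : Option Symbol) (W : Work → List Bool) (v₁ : Option Symbol)
    (W₁ : Work → List Bool) (t : ℕ) : Prop :=
  ∀ i o, Run p v (stks i o W) v₁ (stks i o W₁) t

/-- The register contents that stand for a bit. -/
def reg (o : Option Bool) : Option Symbol := o.map Symbol.bit

@[simp] theorem reg_none : reg none = none := rfl

@[simp] theorem reg_some (b : Bool) : reg (some b) = some (.bit b) := rfl

/-- Whether the register holds the bit `true`. -/
def isOne (v : Option Symbol) : Bool := v == some (.bit true)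

/-- Push a constant. -/
def pushC (w : Work) (b : Bool) : SProg := .push (.work w) fun _ => b

/-- Push the bit in the register. -/
def pushR (w : Work) : SProg := .push (.work w) isOne

/-- Pop a bit into the register. -/
def popR (w : Work) : SProg := .pop (.work w) fun _ o => reg o

theorem wrun_pushC {w : Work} {b : Bool} {v W} :
    WRun (pushC w b) v W v (Function.update W w (b :: W w)) 1 := fun i o => by
  rw [← update_stks_work]; exact .push

theorem wrun_pushR {w : Work} {b : Bool} {W} :
    WRun (pushR w) (some (.bit b)) W (some (.bit b)) (Function.update W w (b :: W w)) 1 :=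
  fun i o => by
  have := Run.push (k := Stk.work w) (f := isOne) (v := some (.bit b)) (S := stks i o W)
  rw [update_stks_work] at this
  cases b <;> exact this

theorem wrun_popR {w : Work} {v W} :
    WRun (popR w) v W (reg (W w).head?) (Function.update W w (W w).tail) 1 := fun i o => by
  rw [← update_stks_work]; exact .pop

theorem WRun.seq {p q v W v' W' v'' W'' t t'} (h : WRun p v W v' W' t)
    (h' : WRun q v' W' v'' W'' t') : WRun (.seq p q) v W v'' W'' (t + t') :=
  fun i o => .seq (h i o) (h' i o)

theorem WRun.ite_true {b p q v W v' W' t} (hb : b v = true) (h : WRun p v W v' W' t) :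
    WRun (.ite b p q) v W v' W' (t + 1) := fun i o => .ite_true hb (h i o)

theorem WRun.ite_false {b p q v W v' W' t} (hb : b v = false) (h : WRun q v W v' W' t) :
    WRun (.ite b p q) v W v' W' (t + 1) := fun i o => .ite_false hb (h i o)

theorem WRun.loop_true {b p v W v' W' v'' W'' t t'} (hb : b v = true) (h : WRun p v W v' W' t)
    (h' : WRun (.loop b p) v' W' v'' W'' t') : WRun (.loop b p) v W v'' W'' (t + t' + 1) :=
  fun i o => .loop_true hb (h i o) (h' i o)

theorem WRun.loop_false {b p v W} (hb : b v = false) : WRun (.loop b p) v W v W 1 :=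
  fun _ _ => .loop_false hb

theorem WRun.length_le {p v W v' W' t} (h : WRun p v W v' W' t) (w : Work) :
    (W' w).length ≤ (W w).length + t := (h [] []).length_le (.work w)

/-- Move the topmost tree from the main stack to the stack `w`, in reversed order. -/
def take (w : Work) : SProg :=
  .seq (pushC .cnt true) <| .seq (popR .cnt) <| .loop Option.isSome <|
    .seq (popR .main) <| .seq (pushR w) <| .ite isOne (pushC .cnt true) (popR .cnt)

/-- The counter holds in unary how many further trees must be read: a `cons` replaces one pending
tree by two, a `nil` completes one, and popping the empty counter ends the loop. The rest of the run
is a hypothesis, so that for `cons a b` the pass over `a` can be continued by the pass over `b`.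
Each bit costs five steps. -/
theorem take_loop {w : Work} (hm : w ≠ .main) (hc : w ≠ .cnt) (x : Tm) :
    ∀ {s : Symbol} {W : Work → List Bool} {r : List Bool}, W .main = x.code ++ r →
    ∀ {v' W' t}, WRun (.loop Option.isSome <|
        .seq (popR .main) <| .seq (pushR w) <| .ite isOne (pushC .cnt true) (popR .cnt))
      (reg (W .cnt).head?) (Function.update (Function.update (Function.update W .main r)
        w (x.code.reverse ++ W w)) .cnt (W .cnt).tail) v' W' t →
    WRun (.loop Option.isSome <|
        .seq (popR .main) <| .seq (pushR w) <| .ite isOne (pushC .cnt true) (popR .cnt))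
      (some s) W v' W' (t + 5 * x.size) := by
  induction x with
  | nil =>
    intro s W r hW v' W' t h
    have h₁ := wrun_popR (w := .main) (v := some s) (W := W)
    rw [hW] at h₁
    have := WRun.loop_true (b := Option.isSome) rfl
      (h₁.seq ((wrun_pushR (w := w) (b := false)).seq (WRun.ite_false rfl wrun_popR))) (t' := t)
      (v'' := v') (W'' := W') (by
        convert h using 1
        · simp [Function.update_apply, hc.symm]
        · funext k
          cases k <;> simp_all [Function.update_apply, Tm.code, eq_comm])
    convert this using 1
    simp; ring
  | cons a b iha ihb =>
    intro s W r hW v' W' t h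
    have h₁ := wrun_popR (w := .main) (v := some s) (W := W)
    rw [hW] at h₁
    have := WRun.loop_true (b := Option.isSome) rfl
      (h₁.seq ((wrun_pushR (w := w) (b := true)).seq
        (WRun.ite_true (q := popR .cnt) rfl (wrun_pushC (w := .cnt) (b := true)))))
      (t' := t + 5 * b.size + 5 * a.size) (v'' := v') (W'' := W') (by
        refine iha (r := b.code ++ r) ?_ ?_
        · simp [Function.update_apply, Tm.code, hm.symm]
        · refine ihb (r := r) ?_ ?_
          · simp [Function.update_apply, hm.symm]
          · convert h using 1
            · simp [Function.update_apply, hc.symm]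
            · funext k
              cases k <;> simp_all [Function.update_apply, Tm.code, eq_comm])
    convert this using 1
    simp; ring

/-- `Comp p W W' T`: the program `p` turns the working stacks `W` into `W'` in at most `T` steps,
whatever the register holds. -/
def Comp (p : SProg) (W W' : Work → List Bool) (T : ℕ) : Prop :=
  ∀ v, ∃ v', ∃ t ≤ T, WRun p v W v' W' t

theorem Comp.seq {p q W W' W'' T T'} (h : Comp p W W' T) (h' : Comp q W' W'' T') :
    Comp (.seq p q) W W'' (T + T') := fun v => by
  obtain ⟨v', t, ht, h⟩ := h v
  obtain ⟨v'', t', ht', h'⟩ := h' v'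
  exact ⟨v'', t + t', by omega, h.seq h'⟩

theorem Comp.mono {p W W' T T'} (h : Comp p W W' T) (hT : T ≤ T') : Comp p W W' T' := fun v => by
  obtain ⟨v', t, ht, h⟩ := h v
  exact ⟨v', t, ht.trans hT, h⟩

theorem comp_pushC (w : Work) (b : Bool) (W) :
    Comp (pushC w b) W (Function.update W w (b :: W w)) 1 :=
  fun v => ⟨v, 1, le_rfl, wrun_pushC⟩

theorem comp_popR (w : Work) (W) : Comp (popR w) W (Function.update W w (W w).tail) 1 :=
  fun _ => ⟨_, 1, le_rfl, wrun_popR⟩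

theorem comp_take_tmp (x : Tm) (r b c : List Bool) :
    Comp (take .tmp) (works (x.code ++ r) b c []) (works r (x.code.reverse ++ b) c [])
      (5 * x.size + 3) := fun v => by
  have h := take_loop (w := .tmp) (by decide) (by decide) x (s := .bit true)
    (W := works (x.code ++ r) b c []) (r := r) rfl (.loop_false rfl)
  simp only [works, update_works_main, update_works_tmp, update_works_cnt, List.head?_nil,
    List.tail_nil, reg_none] at h
  have h₁ := wrun_pushC (w := .cnt) (b := true) (v := v) (W := works (x.code ++ r) b c [])
  have h₂ := wrun_popR (w := .cnt) (v := v) (W := works (x.code ++ r) b c [true])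
  simp only [works, update_works_cnt, List.head?_cons, List.tail_cons, reg_some] at h₁ h₂
  exact ⟨none, _, by omega, h₁.seq (h₂.seq h)⟩

theorem comp_take_aux (x : Tm) (r b c : List Bool) :
    Comp (take .aux) (works (x.code ++ r) b c []) (works r b (x.code.reverse ++ c) [])
      (5 * x.size + 3) := fun v => by
  have h := take_loop (w := .aux) (by decide) (by decide) x (s := .bit true)
    (W := works (x.code ++ r) b c []) (r := r) rfl (.loop_false rfl)
  simp only [works, update_works_main, update_works_aux, update_works_cnt, List.head?_nil,
    List.tail_nil, reg_none] at h
  have h₁ := wrun_pushC (w := .cnt) (b := true) (v := v) (W := works (x.code ++ r) b c [])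
  have h₂ := wrun_popR (w := .cnt) (v := v) (W := works (x.code ++ r) b c [true])
  simp only [works, update_works_cnt, List.head?_cons, List.tail_cons, reg_some] at h₁ h₂
  exact ⟨none, _, by omega, h₁.seq (h₂.seq h)⟩

/-- Empty the stack `w`, executing `q` for every bit. -/
def drain (w : Work) (q : SProg) : SProg :=
  .seq (popR w) <| .loop Option.isSome <| .seq q (popR w)

/-- Here `fam l a` stands for the stacks with `l` on `w` and data `a` elsewhere, on which `q` acts
by `g`. Each bit costs `N` steps, a pop and a test; the first pop and the last test give the final
2. -/
theorem comp_drain {w : Work} {q : SProg} {α : Type} (fam : List Bool → α → Work → List Bool)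
    (hw : ∀ l a, fam l a w = l) (hu : ∀ l l' a, Function.update (fam l a) w l' = fam l' a)
    (g : α → Bool → α) (N : ℕ)
    (hq : ∀ b l a, ∃ v', ∃ t ≤ N, WRun q (some (.bit b)) (fam l a) v' (fam l (g a b)) t)
    (l : List Bool) (a : α) :
    Comp (drain w q) (fam l a) (fam [] (l.foldl g a)) ((N + 2) * l.length + 2) := by
  have key : ∀ (l : List Bool) (a : α), ∃ t ≤ (N + 2) * l.length + 1,
      WRun (.loop Option.isSome <| .seq q (popR w)) (reg l.head?) (fam l.tail a) none
        (fam [] (l.foldl g a)) t := by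
    intro l
    induction l with
    | nil => exact fun a => ⟨1, by simp, .loop_false rfl⟩
    | cons b l ih =>
      intro a
      obtain ⟨v', t, ht, h⟩ := hq b l a
      obtain ⟨t', ht', h'⟩ := ih (g a b)
      have h₂ := wrun_popR (w := w) (v := v') (W := fam l (g a b))
      rw [hw, hu] at h₂
      refine ⟨t + 1 + t' + 1, ?_, .loop_true rfl (h.seq h₂) h'⟩
      simp only [List.length_cons, Nat.mul_add]
      omega
  intro v
  obtain ⟨t, ht, h⟩ := key l a
  have h₂ := wrun_popR (w := w) (v := v) (W := fam l a)
  rw [hw, hu] at h₂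
  exact ⟨none, 1 + t, by omega, h₂.seq h⟩

theorem foldl_cons_eq {α : Type} (l r : List α) :
    l.foldl (fun a b => b :: a) r = l.reverse ++ r := by
  induction l generalizing r with
  | nil => rfl
  | cons b l ih => simp [ih]

theorem comp_pour_tmp (a b c : List Bool) :
    Comp (drain .tmp (pushR .main)) (works a b c []) (works (b.reverse ++ a) [] c [])
      (3 * b.length + 2) := by
  have := comp_drain (w := .tmp) (q := pushR .main) (fun l a => works a l c []) (fun _ _ => rfl)
    (fun _ _ _ => by simp) (fun a b => b :: a) 1
    (fun b l a => ⟨_, 1, le_rfl, by simpa [works] using wrun_pushR (W := works a l c []) (w := .main) (b := b)⟩) b a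
  simpa only [foldl_cons_eq] using this

theorem comp_pour_aux (a b c : List Bool) :
    Comp (drain .aux (pushR .main)) (works a b c []) (works (c.reverse ++ a) b [] [])
      (3 * c.length + 2) := by
  have := comp_drain (w := .aux) (q := pushR .main) (fun l a => works a b l []) (fun _ _ => rfl)
    (fun _ _ _ => by simp) (fun a b => b :: a) 1
    (fun b' l a => ⟨_, 1, le_rfl, by simpa [works] using wrun_pushR (W := works a b l []) (w := .main) (b := b')⟩) c a
  simpa only [foldl_cons_eq] using this

theorem comp_pour_tmp_aux (a b : List Bool) :
    Comp (drain .tmp (.seq (pushR .main) (pushR .aux))) (works a b [] [])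
      (works (b.reverse ++ a) [] b.reverse []) (4 * b.length + 2) := by
  have := comp_drain (w := .tmp) (q := .seq (pushR .main) (pushR .aux))
    (fun l (ac : List Bool × List Bool) => works ac.1 l ac.2 []) (fun _ _ => rfl)
    (fun _ _ _ => by simp) (fun ac b => (b :: ac.1, b :: ac.2)) 2
    (fun b l ac => ⟨_, 2, le_rfl,
      (wrun_pushR (W := works ac.1 l ac.2 []) (w := .main) (b := b)).seq (by
        simpa [works] using wrun_pushR (W := works (b :: ac.1) l ac.2 []) (w := .aux) (b := b))⟩)
    b (a, [])
  have h : ∀ (l a c : List Bool), l.foldl (fun (ac : List Bool × List Bool) b =>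
      (b :: ac.1, b :: ac.2)) (a, c) = (l.reverse ++ a, l.reverse ++ c) := by
    intro l
    induction l with
    | nil => intros; rfl
    | cons b l ih => intros; simp [ih]
  simpa [h] using this

theorem comp_pour_aux_tmp (a c : List Bool) :
    Comp (drain .aux (pushR .tmp)) (works a [] c []) (works a c.reverse [] [])
      (3 * c.length + 2) := by
  have := comp_drain (w := .aux) (q := pushR .tmp) (fun l b => works a b l []) (fun _ _ => rfl)
    (fun _ _ _ => by simp) (fun a b => b :: a) 1
    (fun b l b' => ⟨_, 1, le_rfl, by simpa [works] using wrun_pushR (W := works a b' l []) (w := .tmp) (b := b)⟩) c []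
  simpa only [foldl_cons_eq, List.append_nil] using this

/-- Working stacks of which only the main one is in use. -/
abbrev onMain (a : List Bool) : Work → List Bool := works a [] [] []

/-- Duplicate the topmost tree. -/
def dup : SProg :=
  .seq (take .tmp) <| .seq (drain .tmp (.seq (pushR .main) (pushR .aux))) <|
    .seq (drain .aux (pushR .tmp)) (drain .tmp (pushR .main))

/-- Every transfer between stacks reverses the word. The copy on the second buffer therefore passes
through the first buffer before it returns to the main stack. -/
theorem comp_dup (x : Tm) (r : List Bool) :
    Comp dup (onMain (x.code ++ r)) (onMain (x.code ++ (x.code ++ r))) (15 * x.size + 9) := by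
  have h := (comp_take_tmp x r [] []).seq ((comp_pour_tmp_aux _ _).seq
    ((comp_pour_aux_tmp _ _).seq (comp_pour_tmp _ _ _)))
  simp only [List.append_nil, List.reverse_reverse, List.length_reverse] at h
  exact h.mono (by simp only [Tm.size]; omega)

/-- Swap the two topmost trees. -/
def swap : SProg :=
  .seq (take .tmp) <| .seq (take .aux) <| .seq (drain .tmp (pushR .main))
    (drain .aux (pushR .main))

theorem comp_swap (x y : Tm) (r : List Bool) :
    Comp swap (onMain (x.code ++ (y.code ++ r))) (onMain (y.code ++ (x.code ++ r)))
      (8 * (x.size + y.size) + 10) := by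
  have h := (comp_take_tmp x (y.code ++ r) [] []).seq ((comp_take_aux y r _ _).seq
    ((comp_pour_tmp _ _ _).seq (comp_pour_aux _ _ _)))
  simp only [List.append_nil, List.reverse_reverse, List.length_reverse] at h
  exact h.mono (by simp only [Tm.size]; omega)

/-- Remove the topmost tree. -/
def drop : SProg := .seq (take .tmp) (drain .tmp (.seq (pushC .tmp true) (popR .tmp)))

theorem comp_drop (x : Tm) (r : List Bool) :
    Comp drop (onMain (x.code ++ r)) (onMain r) (9 * x.size + 5) := by
  -- Pushing a bit and popping it again serves as the empty program.
  have h := comp_drain (w := .tmp) (q := .seq (pushC .tmp true) (popR .tmp))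
    (fun l (_ : Unit) => works r l [] []) (fun _ _ => rfl) (fun _ _ _ => by simp)
    (fun _ _ => ()) 2 (fun b l ac => ⟨_, 2, le_rfl,
      (wrun_pushC (v := some (.bit b)) (W := works r l [] []) (w := .tmp) (b := true)).seq (by
      simpa [works] using wrun_popR (W := works r (true :: l) [] []) (w := .tmp))⟩)
    (x.code.reverse ++ []) ()
  exact ((comp_take_tmp x r [] []).seq h).mono (by
    simp only [List.append_nil, List.length_reverse, Tm.size]; omega)

/-! ### Polynomial-time maps between trees -/

/-- The program `p` turns the tree `x` on top of the main stack into `y`, in at most `T` steps. -/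
def Maps (p : SProg) (x y : Tm) (T : ℕ) : Prop :=
  ∀ r, Comp p (onMain (x.code ++ r)) (onMain (y.code ++ r)) T

theorem Maps.size_le {p x y T} (h : Maps p x y T) : y.size ≤ x.size + T := by
  obtain ⟨v', t, ht, h⟩ := h [] none
  have := h.length_le .main
  simp only [onMain, works, List.append_nil] at this
  exact this.trans (by unfold Tm.size; omega)

/-- `PolyMap e f`: some program computes the tree `f i` from the tree `e i` in a time that is
polynomial in the size of `e i`. -/
def PolyMap {ι : Type} (e f : ι → Tm) : Prop :=
  ∃ p : SProg, ∃ P : Polynomial ℕ, ∀ i, Maps p (e i) (f i) (P.eval (e i).size)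

theorem eval_mono (P : Polynomial ℕ) {m n : ℕ} (h : m ≤ n) : P.eval m ≤ P.eval n := by
  rw [Polynomial.eval_eq_sum, Polynomial.eval_eq_sum]
  exact Finset.sum_le_sum fun i _ => Nat.mul_le_mul_left _ (Nat.pow_le_pow_left h i)

section PolyMap

variable {ι : Type} {e f g : ι → Tm}

theorem PolyMap.size_le (h : PolyMap e f) :
    ∃ P : Polynomial ℕ, ∀ i, (f i).size ≤ P.eval (e i).size := by
  obtain ⟨p, P, h⟩ := h
  exact ⟨Polynomial.X + P, fun i => by simpa using (h i).size_le⟩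

theorem PolyMap.restrict {κ : Type} (h : PolyMap e f) (s : κ → ι) :
    PolyMap (fun j => e (s j)) (fun j => f (s j)) := by
  obtain ⟨p, P, h⟩ := h
  exact ⟨p, P, fun j => h (s j)⟩

theorem PolyMap.id : PolyMap e e :=
  ⟨.seq (pushC .main true) (popR .main), 2, fun i r => by
    have h := (comp_pushC .main true (onMain ((e i).code ++ r))).seq (comp_popR .main _)
    simp only [update_works_main, works, List.tail_cons] at h
    exact h.mono (by simp)⟩

theorem PolyMap.comp (h : PolyMap e f) (h' : PolyMap f g) : PolyMap e g := by
  obtain ⟨Q, hQ⟩ := h.size_le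
  obtain ⟨p, P, h⟩ := h
  obtain ⟨p', P', h'⟩ := h'
  refine ⟨.seq p p', P + P'.comp Q, fun i r => ((h i r).seq (h' i r)).mono ?_⟩
  simp only [Polynomial.eval_add, Polynomial.eval_comp]
  exact Nat.add_le_add_left (eval_mono _ (hQ i)) _

theorem PolyMap.nil : PolyMap e fun _ => .nil :=
  ⟨.seq drop (pushC .main false), 9 * Polynomial.X + 6, fun i r => by
    have h := (comp_drop (e i) r).seq (comp_pushC .main false _)
    simp only [update_works_main, works] at h
    exact h.mono (by simp)⟩

/-- One copy of the input is turned into `f i`, then the other one is swapped to the top and turned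
into `g i`. After another swap a single bit on top completes the code of the pair. -/
theorem PolyMap.cons (h : PolyMap e f) (h' : PolyMap e g) :
    PolyMap e fun i => .cons (f i) (g i) := by
  obtain ⟨Q, hQ⟩ := h.size_le
  obtain ⟨Q', hQ'⟩ := h'.size_le
  obtain ⟨p, P, h⟩ := h
  obtain ⟨p', P', h'⟩ := h'
  refine ⟨.seq dup <| .seq p <| .seq swap <| .seq p' <| .seq swap (pushC .main true),
    (15 * Polynomial.X + 9) + (P + ((8 * (Q + Polynomial.X) + 10) + (P' + ((8 * (Q' + Q) + 10)
      + 1)))), fun i r => ?_⟩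
  have := (comp_dup (e i) r).seq <| (h i _).seq <| (comp_swap (f i) (e i) r).seq <|
    (h' i _).seq <| (comp_swap (g i) (f i) r).seq <| comp_pushC .main true _
  simp only [update_works_main, works] at this
  simp only [Tm.code, List.cons_append, List.append_assoc]
  refine this.mono ?_
  simp only [Polynomial.eval_add, Polynomial.eval_mul, Polynomial.eval_X, Polynomial.eval_ofNat,
    Polynomial.eval_one]
  have := hQ i
  have := hQ' i
  omega

theorem PolyMap.fst : PolyMap (fun i => .cons (f i) (g i)) f :=
  ⟨.seq (popR .main) (.seq swap drop), 17 * Polynomial.X + 16, fun i r => by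
    refine (Comp.seq (W' := onMain ((f i).code ++ ((g i).code ++ r))) ?_
      ((comp_swap (f i) (g i) r).seq (comp_drop (g i) _))).mono
      (T := 1 + (8 * ((f i).size + (g i).size) + 10 + (9 * (g i).size + 5))) ?_
    · have h := comp_popR .main (onMain ((Tm.cons (f i) (g i)).code ++ r))
      simpa [works, Tm.code] using h
    · simp; omega⟩

theorem PolyMap.snd : PolyMap (fun i => .cons (f i) (g i)) g :=
  ⟨.seq (popR .main) drop, 9 * Polynomial.X + 6, fun i r => by
    refine (Comp.seq (W' := onMain ((f i).code ++ ((g i).code ++ r))) ?_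
      (comp_drop (f i) _)).mono (T := 1 + (9 * (f i).size + 5)) ?_
    · have h := comp_popR .main (onMain ((Tm.cons (f i) (g i)).code ++ r))
      simpa [works, Tm.code] using h
    · simp; omega⟩

end PolyMap

theorem comp_pop_ite_true {A B : SProg} {a W' T} (h : Comp A (onMain a) W' T) :
    Comp (.seq (popR .main) (.ite isOne A B)) (onMain (true :: a)) W' (T + 2) := fun v => by
  have h₁ := wrun_popR (w := .main) (v := v) (W := onMain (true :: a))
  simp only [works, update_works_main, List.head?_cons, List.tail_cons, reg_some] at h₁
  obtain ⟨v', t, ht, h⟩ := h (some (.bit true))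
  exact ⟨v', _, by omega, h₁.seq (h.ite_true rfl)⟩

theorem comp_pop_ite_false {A B : SProg} {a W' T} (h : Comp B (onMain a) W' T) :
    Comp (.seq (popR .main) (.ite isOne A B)) (onMain (false :: a)) W' (T + 2) := fun v => by
  have h₁ := wrun_popR (w := .main) (v := v) (W := onMain (false :: a))
  simp only [works, update_works_main, List.head?_cons, List.tail_cons, reg_some] at h₁
  obtain ⟨v', t, ht, h⟩ := h (some (.bit false))
  exact ⟨v', _, by omega, h₁.seq (h.ite_false rfl)⟩

section PolyMap

variable {ι : Type} {e f r : ι → Tm}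

/-- Case distinction on whether a tree is `nil`. -/
theorem PolyMap.cases (hf : PolyMap e f)
    (h₀ : PolyMap (fun i : {i // f i = .nil} => e i) (fun i => r i))
    (h₁ : PolyMap (fun i : {i // f i ≠ .nil} => e i) (fun i => r i)) : PolyMap e r := by
  obtain ⟨Q, hQ⟩ := hf.size_le
  obtain ⟨p, P, hp⟩ := hf
  obtain ⟨p₀, P₀, hp₀⟩ := h₀
  obtain ⟨p₁, P₁, hp₁⟩ := h₁
  -- The first bit of `f i` decides. For `nil` it is the whole code; otherwise the two subtrees are
  -- still on the stack and have to be dropped.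
  refine ⟨.seq dup <| .seq p <| .seq (popR .main) <| .ite isOne (.seq drop <| .seq drop p₁) p₀,
    (15 * Polynomial.X + 9) + (P + (9 * Q + 10 + P₁ + P₀ + 2)), fun i s => ?_⟩
  refine ((comp_dup (e i) s).seq <| (hp i _).seq
    (W'' := onMain ((r i).code ++ s)) (T' := 9 * (f i).size + 10 + P₁.eval (e i).size +
      P₀.eval (e i).size + 2) ?_).mono ?_
  · cases hfi : f i with
    | nil =>
      exact (comp_pop_ite_false (hp₀ ⟨i, hfi⟩ s)).mono (by simp only; omega)
    | cons a b =>
      simp only [Tm.code, List.cons_append, List.append_assoc]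
      refine (comp_pop_ite_true ((comp_drop a _).seq ((comp_drop b _).seq
        (hp₁ ⟨i, by simp [hfi]⟩ s)))).mono ?_
      simp only [Tm.size_cons]
      omega
  · have := hQ i
    simp
    omega

/-- Bring the first symbol of the left subtree into the register. -/
def peekLeft : SProg :=
  .seq (popR .main) <| .seq (popR .main) <| .seq (pushR .main) (pushC .main true)

theorem wrun_peekLeft (x y : Tm) (s : List Bool) (v) :
    WRun peekLeft v (onMain ((Tm.cons x y).code ++ s)) (some (.bit (decide (x ≠ .nil))))
      (onMain ((Tm.cons x y).code ++ s)) 4 := by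
  obtain ⟨u, hu⟩ : ∃ u, x.code = decide (x ≠ .nil) :: u := by
    cases x <;> simp [Tm.code]
  simp only [Tm.code, List.cons_append, List.append_assoc, hu]
  have h₁ := wrun_popR (w := .main) (v := v)
    (W := onMain (true :: decide (x ≠ .nil) :: (u ++ (y.code ++ s))))
  have h₂ := wrun_popR (w := .main) (v := some (.bit true))
    (W := onMain (decide (x ≠ .nil) :: (u ++ (y.code ++ s))))
  have h₃ := wrun_pushR (w := .main) (b := decide (x ≠ .nil)) (W := onMain (u ++ (y.code ++ s)))
  have h₄ := wrun_pushC (w := .main) (b := true) (v := some (.bit (decide (x ≠ .nil))))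
    (W := onMain (decide (x ≠ .nil) :: (u ++ (y.code ++ s))))
  simp only [works, update_works_main, List.head?_cons, List.tail_cons, reg_some] at h₁ h₂ h₃ h₄
  exact h₁.seq (h₂.seq (h₃.seq h₄))

/-- Execute `p` as long as the left subtree is not `nil`. -/
def whileLeft (p : SProg) : SProg :=
  .seq peekLeft <| .loop isOne <| .seq p peekLeft

/-- A loop can test only the register, so `peekLeft` refreshes it after each pass, in four steps;
the test is the fifth. The sequences `x` and `y` record the state after each pass. -/
theorem maps_whileLeft {p : SProg} {T n : ℕ} {x y : ℕ → Tm}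
    (hx : ∀ j < n, x j ≠ .nil) (hn : x n = .nil)
    (hp : ∀ j < n, Maps p (.cons (x j) (y j)) (.cons (x (j + 1)) (y (j + 1))) T) :
    Maps (whileLeft p) (.cons (x 0) (y 0)) (.cons (x n) (y n)) ((T + 5) * n + 5) := by
  intro s
  have key : ∀ m j, j + m = n → ∃ t ≤ (T + 5) * m + 1, ∃ v',
      WRun (.loop isOne (.seq p peekLeft)) (some (.bit (decide (x j ≠ .nil))))
        (onMain ((Tm.cons (x j) (y j)).code ++ s)) v' (onMain ((Tm.cons (x n) (y n)).code ++ s))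
        t := by
    intro m
    induction m with
    | zero =>
      intro j hj
      obtain rfl : j = n := by omega
      exact ⟨1, by simp, _, .loop_false (by rw [hn]; rfl)⟩
    | succ m ih =>
      intro j hj
      obtain ⟨t, ht, v', h⟩ := ih (j + 1) (by omega)
      obtain ⟨v'', t', ht', h'⟩ := hp j (by omega) s (some (.bit (decide (x j ≠ .nil))))
      refine ⟨_, ?_, v', .loop_true (by simp [hx j (by omega), isOne])
        (h'.seq (wrun_peekLeft _ _ _ _)) h⟩
      rw [Nat.mul_succ]
      omega
  intro v
  obtain ⟨t, ht, v', h⟩ := key n 0 (by omega)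
  exact ⟨v', _, by omega, (wrun_peekLeft _ _ _ v).seq h⟩

end PolyMap

/-! ### Typed data -/

/-- Types whose elements are represented by trees. -/
class Enc (α : Type) where
  enc : α → Tm
  enc_injective : Function.Injective enc

open Enc

instance : Enc Tm := ⟨id, Function.injective_id⟩

instance : Enc Unit := ⟨fun _ => .nil, fun _ _ _ => rfl⟩

instance : Enc Bool := ⟨fun b => if b then .cons .nil .nil else .nil, by decide⟩

instance {α β : Type} [Enc α] [Enc β] : Enc (α × β) :=
  ⟨fun p => .cons (enc p.1) (enc p.2), fun p q h => by
    injection h with h₁ h₂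
    exact Prod.ext (enc_injective h₁) (enc_injective h₂)⟩

/-- The tree of a list. -/
def encList {α : Type} [Enc α] : List α → Tm
  | [] => .nil
  | a :: l => .cons (enc a) (encList l)

theorem encList_injective {α : Type} [Enc α] : Function.Injective (encList (α := α)) := by
  intro l
  induction l with
  | nil => intro l' h; cases l' with
    | nil => rfl
    | cons => simp [encList] at h
  | cons a l ih => intro l' h; cases l' with
    | nil => simp [encList] at h
    | cons b l' =>
      simp only [encList, Tm.cons.injEq] at h
      rw [enc_injective h.1, ih h.2]

instance {α : Type} [Enc α] : Enc (List α) := ⟨encList, encList_injective⟩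

/-- The unary representation is affordable because only vertex indices are represented as numbers,
and these are smaller than the number of blocks of the input. Colors remain binary words. -/
instance : Enc ℕ := ⟨fun n => enc (List.replicate n ()), fun m n h => by
  simpa using congrArg List.length (enc_injective h)⟩

/-- The size of the tree that represents `a`. -/
def sz {α : Type} [Enc α] (a : α) : ℕ := (enc a).size

section Size

variable {α β : Type} [Enc α] [Enc β]

@[simp] theorem enc_nil : enc ([] : List α) = .nil := rfl

@[simp] theorem enc_cons (a : α) (l : List α) : enc (a :: l) = .cons (enc a) (enc l) := rfl

@[simp] theorem enc_pair (a : α) (b : β) : enc (a, b) = .cons (enc a) (enc b) := rfl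

@[simp] theorem sz_nil : sz ([] : List α) = 1 := rfl

@[simp] theorem sz_cons (a : α) (l : List α) : sz (a :: l) = sz a + sz l + 1 :=
  Tm.size_cons _ _

@[simp] theorem sz_pair (a : α) (b : β) : sz (a, b) = sz a + sz b + 1 := Tm.size_cons _ _

theorem sz_bool_le (b : Bool) : sz b ≤ 3 := by cases b <;> decide

theorem sz_append (l l' : List α) : sz (l ++ l') + 1 = sz l + sz l' := by
  induction l with
  | nil => simp; omega
  | cons a l ih => simp; omega

theorem sz_reverse (l : List α) : sz l.reverse = sz l := by
  induction l with
  | nil => rfl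
  | cons a l ih =>
    have := sz_append l.reverse [a]
    simp at this ⊢
    omega

theorem length_le_sz (l : List α) : l.length + 1 ≤ sz l := by
  induction l with
  | nil => simp
  | cons a l ih => simp; omega

theorem sz_le_of_mem {l : List α} {a : α} (h : a ∈ l) : sz a ≤ sz l := by
  induction l with
  | nil => simp at h
  | cons b l ih =>
    rcases List.mem_cons.1 h with rfl | h
    · simp; omega
    · have := ih h; simp; omega

theorem sz_list_le {l : List α} {B : ℕ} (h : ∀ a ∈ l, sz a ≤ B) : sz l ≤ l.length * (B + 1) + 1 := by
  induction l with
  | nil => simp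
  | cons b l ih =>
    have := ih fun a ha => h a (List.mem_cons_of_mem _ ha)
    have := h b List.mem_cons_self
    simp only [sz_cons, List.length_cons, Nat.add_mul]
    omega

end Size

/-- `PT e f`: the value `f i` is computable from the tree `e i` in polynomial time. -/
def PT {ι β : Type} [Enc β] (e : ι → Tm) (f : ι → β) : Prop := PolyMap e fun i => enc (f i)

/-- The context `e`, extended by a variable of type `γ`. -/
def cx {ι γ : Type} [Enc γ] (e : ι → Tm) (p : ι × γ) : Tm := .cons (e p.1) (enc p.2)

/-! ### Closure properties of the polynomial-time functions -/

namespace PT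

variable {ι α β γ δ : Type} [Enc α] [Enc β] [Enc γ] [Enc δ] {e : ι → Tm}

theorem sz_le {f : ι → β} (h : PT e f) : ∃ P : Polynomial ℕ, ∀ i, sz (f i) ≤ P.eval (e i).size :=
  PolyMap.size_le h

theorem restrict {κ : Type} {f : ι → β} (h : PT e f) (s : κ → ι) :
    PT (fun j => e (s j)) (fun j => f (s j)) := PolyMap.restrict h s

/-- Contexts are used in the manner of de Bruijn: `var` is the innermost variable, and each `weaken`
skips one. -/
theorem var : PT (cx e) (fun p : ι × γ => p.2) :=
  PolyMap.snd (f := fun p : ι × γ => e p.1) (g := fun p => enc p.2)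

theorem weaken {f : ι → β} (h : PT e f) : PT (cx e) (fun p : ι × γ => f p.1) :=
  (PolyMap.fst (f := fun p : ι × γ => e p.1) (g := fun p => enc p.2)).comp
    (PolyMap.restrict h Prod.fst)

theorem pair {f : ι → α} {g : ι → β} (hf : PT e f) (hg : PT e g) : PT e fun i => (f i, g i) :=
  PolyMap.cons hf hg

theorem fst {f : ι → α × β} (hf : PT e f) : PT e fun i => (f i).1 :=
  PolyMap.comp hf (PolyMap.fst (f := fun i => enc (f i).1) (g := fun i => enc (f i).2))

theorem snd {f : ι → α × β} (hf : PT e f) : PT e fun i => (f i).2 :=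
  PolyMap.comp hf (PolyMap.snd (f := fun i => enc (f i).1) (g := fun i => enc (f i).2))

theorem cons {f : ι → α} {l : ι → List α} (hf : PT e f) (hl : PT e l) : PT e fun i => f i :: l i :=
  PolyMap.cons hf hl

theorem nil : PT e fun _ => ([] : List α) := PolyMap.nil

theorem unit : PT e fun _ => () := PolyMap.nil

theorem true : PT e fun _ => Bool.true := PolyMap.cons PolyMap.nil PolyMap.nil

theorem false : PT e fun _ => Bool.false := PolyMap.nil

theorem tmNil : PT e fun _ => Tm.nil := PolyMap.nil

theorem tmCons {f g : ι → Tm} (hf : PT e f) (hg : PT e g) : PT e fun i => Tm.cons (f i) (g i) :=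
  PolyMap.cons hf hg

theorem ite {b : ι → Bool} {f g : ι → β} (hb : PT e b) (hf : PT e f) (hg : PT e g) :
    PT e fun i => if b i then f i else g i := by
  refine PolyMap.cases hb ?_ ?_
  · have := PolyMap.restrict hg (Subtype.val : {i // enc (b i) = .nil} → ι)
    convert this using 2 with i
    have : b i.1 = Bool.false := by
      have := i.2
      revert this
      cases b i.1 <;> simp [enc]
    simp [this]
  · have := PolyMap.restrict hf (Subtype.val : {i // enc (b i) ≠ .nil} → ι)
    convert this using 2 with i
    have : b i.1 = Bool.true := by
      have := i.2
      revert this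
      cases b i.1 <;> simp [enc]
    simp [this]

theorem not {b : ι → Bool} (hb : PT e b) : PT e fun i => !b i := by
  convert ite hb false true using 2 with i
  cases b i <;> rfl

theorem and {b c : ι → Bool} (hb : PT e b) (hc : PT e c) : PT e fun i => b i && c i := by
  convert ite hb hc false using 2 with i
  cases b i <;> rfl

theorem tmHd {f : ι → Tm} (hf : PT e f) : PT e fun i => (f i).hd := by
  refine PolyMap.cases hf ?_ ?_
  · convert PolyMap.nil using 2 with i
    have := i.2
    revert this
    cases h : f i.1 <;> simp [enc, h, Tm.hd]
  · have := PolyMap.restrict hf (Subtype.val : {i // enc (f i) ≠ .nil} → ι)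
    refine this.comp ?_
    have h := PolyMap.fst (f := fun i : {i // enc (f i) ≠ .nil} => (f i).hd)
      (g := fun i => (f i).tl)
    convert h using 2 with i
    · have := i.2
      revert this
      cases f i.1 <;> simp [enc, Tm.hd, Tm.tl]
    · rfl

theorem tmTl {f : ι → Tm} (hf : PT e f) : PT e fun i => (f i).tl := by
  refine PolyMap.cases hf ?_ ?_
  · convert PolyMap.nil using 2 with i
    have := i.2
    revert this
    cases h : f i.1 <;> simp [enc, h, Tm.tl]
  · have := PolyMap.restrict hf (Subtype.val : {i // enc (f i) ≠ .nil} → ι)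
    refine this.comp ?_
    have h := PolyMap.snd (f := fun i : {i // enc (f i) ≠ .nil} => (f i).hd)
      (g := fun i => (f i).tl)
    convert h using 2 with i
    · have := i.2
      revert this
      cases f i.1 <;> simp [enc, Tm.hd, Tm.tl]
    · rfl

/-- Case distinction on a list. -/
theorem casesList {l : ι → List γ} {f : ι → β} {g : ι → γ → List γ → β} (hl : PT e l)
    (hf : PT e f) (hg : PT (cx (cx e)) fun p : (ι × γ) × List γ => g p.1.1 p.1.2 p.2) :
    PT e fun i => match l i with
      | [] => f i
      | c :: l' => g i c l' := by
  refine PolyMap.cases hl ?_ ?_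
  · have := PolyMap.restrict hf (Subtype.val : {i // enc (l i) = .nil} → ι)
    convert this using 2 with i
    have := i.2
    revert this
    cases h : l i.1 <;> simp [h]
  · have h : ∀ i : {i // enc (l i) ≠ .nil}, ∃ c l', l i = c :: l' := fun i => by
      have := i.2
      revert this
      cases l i.1 <;> simp
    choose c l' hc using h
    have h₁ : PT (fun i : {i // enc (l i) ≠ .nil} => e i) (fun i => c i :: l' i) := by
      simp only [← hc]
      exact restrict hl Subtype.val
    -- A nonempty list and the pair of its head and its tail are represented by the same tree.
    have h₂ : PT (fun i : {i // enc (l i) ≠ .nil} => e i) (fun i => (c i, l' i)) := h₁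
    have h₃ := (PolyMap.cons (PolyMap.cons PolyMap.id h₂.fst) h₂.snd).comp
      (PolyMap.restrict hg fun i : {i // enc (l i) ≠ .nil} => ((i.1, c i), l' i))
    convert h₃ using 3 with i
    simp only [hc]

theorem tail {l : ι → List γ} (hl : PT e l) : PT e fun i => (l i).tail := by
  convert casesList hl nil (g := fun _ _ l' => l') var using 2 with i
  cases l i <;> rfl

theorem isEmpty {l : ι → List γ} (hl : PT e l) : PT e fun i => (l i).isEmpty := by
  convert casesList hl true (g := fun _ _ _ => Bool.false) false using 2 with i
  cases l i <;> rfl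

theorem headD {l : ι → List γ} {d : ι → γ} (hl : PT e l) (hd : PT e d) :
    PT e fun i => (l i).headD (d i) := by
  convert casesList hl hd (g := fun _ c _ => c) var.weaken using 2 with i
  cases l i <;> rfl

/-- Folds over a list are computable if the intermediate results are of polynomial size. -/
theorem foldl {l : ι → List γ} {s : ι → β} {step : ι → β → γ → β} (hl : PT e l) (hs : PT e s)
    (hstep : PT (cx (cx e)) fun p : (ι × β) × γ => step p.1.1 p.1.2 p.2)
    (P : Polynomial ℕ) (hP : ∀ i l₁ l₂, l i = l₁ ++ l₂ →
      sz (l₁.foldl (step i) (s i)) ≤ P.eval (e i).size) :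
    PT e fun i => (l i).foldl (step i) (s i) := by
  -- The loop works on the rest of the list, the intermediate result and the context, in this order.
  -- The rest is the left subtree, so the loop stops when it is `nil`.
  have hbody : PolyMap
      (fun p : (γ × List γ) × β × ι =>
        Tm.cons (.cons (enc p.1.1) (enc p.1.2)) (.cons (enc p.2.1) (e p.2.2)))
      (fun p => Tm.cons (enc p.1.2) (.cons (enc (step p.2.2 p.2.1 p.1.1)) (e p.2.2))) := by
    have h₁ := PolyMap.fst (f := fun p : (γ × List γ) × β × ι => .cons (enc p.1.1) (enc p.1.2))
      (g := fun p => .cons (enc p.2.1) (e p.2.2))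
    have h₂ := PolyMap.snd (f := fun p : (γ × List γ) × β × ι => .cons (enc p.1.1) (enc p.1.2))
      (g := fun p => .cons (enc p.2.1) (e p.2.2))
    have hc := h₁.comp PolyMap.fst
    have hl' := h₁.comp PolyMap.snd
    have hs' := h₂.comp PolyMap.fst
    have he := h₂.comp PolyMap.snd
    exact hl'.cons (PolyMap.cons (((he.cons hs').cons hc).comp
      (PolyMap.restrict hstep fun p : (γ × List γ) × β × ι => ((p.2.2, p.2.1), p.1.1))) he)
  obtain ⟨L, hL⟩ := hl.sz_le
  obtain ⟨p, Q, hp⟩ := hbody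
  refine PolyMap.comp (f := fun i => Tm.cons (enc (l i)) (.cons (enc (s i)) (e i)))
    (PolyMap.cons hl (PolyMap.cons hs PolyMap.id)) ?_
  refine PolyMap.comp (f := fun i => Tm.cons (enc ([] : List γ))
    (.cons (enc ((l i).foldl (step i) (s i))) (e i))) ?_ (PolyMap.snd.comp PolyMap.fst)
  -- `L` bounds the number of passes, and the argument of `Q` bounds the tree at the start of a
  -- pass: rest, intermediate result, context and two inner nodes.
  refine ⟨whileLeft p, (Q.comp (L + P + Polynomial.X + 2) + 5) * L + 5, fun i => ?_⟩
  have hw := maps_whileLeft (p := p) (n := (l i).length)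
    (T := Q.eval (L.eval (e i).size + P.eval (e i).size + (e i).size + 2))
    (x := fun j => enc ((l i).drop j))
    (y := fun j => .cons (enc (((l i).take j).foldl (step i) (s i))) (e i)) ?_ ?_ ?_
  · simp only [List.drop_zero, List.take_zero, List.foldl_nil, List.drop_length,
      List.take_length] at hw
    intro r
    refine (hw r).mono ?_
    simp only [Polynomial.eval_add, Polynomial.eval_mul, Polynomial.eval_comp, Polynomial.eval_X,
      Polynomial.eval_ofNat, Tm.size_cons]
    have h₁ : (e i).size ≤ (enc (l i)).size + ((enc (s i)).size + (e i).size + 1) + 1 := by omega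
    have h₂ := (length_le_sz (l i)).trans ((hL i).trans (eval_mono L h₁))
    refine Nat.add_le_add_right (Nat.mul_le_mul (Nat.add_le_add_right (eval_mono Q ?_) _)
      (by omega)) _
    have := eval_mono L h₁
    have := eval_mono P h₁
    omega
  · intro j hj h
    have := List.drop_eq_nil_iff.1 (enc_injective (h.trans (enc_nil (α := γ)).symm))
    omega
  · simp
  · intro j hj r
    have h := hp (((l i)[j], (l i).drop (j + 1)), (((l i).take j).foldl (step i) (s i)), i) r
    simp only at h
    rw [← enc_cons, ← List.drop_eq_getElem_cons hj] at h
    simp only [List.take_add_one, List.getElem?_eq_getElem hj, Option.toList_some,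
      List.foldl_append, List.foldl_cons, List.foldl_nil]
    refine h.mono (eval_mono Q ?_)
    have h₁ := hP i _ _ (List.take_append_drop j (l i)).symm
    have h₂ : sz ((l i).drop j) ≤ sz (l i) := by
      have := sz_append ((l i).take j) ((l i).drop j)
      have := Tm.size_pos (enc ((l i).take j))
      rw [List.take_append_drop] at *
      unfold sz at *
      omega
    have h₃ := hL i
    simp only [Tm.size_cons]
    unfold sz at *
    omega

end PT

/-! ### A library of polynomial-time functions -/

/-- Turn the topmost tree into the list of the bits of its code. -/
def spell : SProg :=
  .seq (take .tmp) <| .seq (pushC .main false) <| drain .tmp <|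
    .ite isOne (.seq (pushC .main false) <| .seq (pushC .main false) <|
      .seq (pushC .main true) (pushC .main true)) (.seq (pushC .main false) (pushC .main true))

/-- The buffer holds the code in reversed order, so the last bit comes first and prepending builds
the list in the right order. -/
theorem maps_spell (x : Tm) : Maps spell x (enc x.code) (12 * x.size + 6) := by
  intro r
  have h := comp_drain (w := .tmp) (q := .ite isOne (.seq (pushC .main false) <|
      .seq (pushC .main false) <| .seq (pushC .main true) (pushC .main true))
      (.seq (pushC .main false) (pushC .main true)))
    (fun l a => works a l [] []) (fun _ _ => rfl) (fun _ _ _ => by simp)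
    (fun a b => true :: ((enc b).code ++ a)) 5 (fun b l a => by
      cases b
      · refine ⟨some (.bit false), 3, by omega, .ite_false rfl ?_⟩
        have h₁ := wrun_pushC (w := .main) (b := false) (v := some (.bit false))
          (W := works a l [] [])
        have h₂ := wrun_pushC (w := .main) (b := true) (v := some (.bit false))
          (W := works (false :: a) l [] [])
        simp only [works, update_works_main] at h₁ h₂
        exact h₁.seq h₂
      · refine ⟨some (.bit true), 5, by omega, .ite_true rfl ?_⟩
        have h₁ := wrun_pushC (w := .main) (b := false) (v := some (.bit true))
          (W := works a l [] [])
        have h₂ := wrun_pushC (w := .main) (b := false) (v := some (.bit true))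
          (W := works (false :: a) l [] [])
        have h₃ := wrun_pushC (w := .main) (b := true) (v := some (.bit true))
          (W := works (false :: false :: a) l [] [])
        have h₄ := wrun_pushC (w := .main) (b := true) (v := some (.bit true))
          (W := works (true :: false :: false :: a) l [] [])
        simp only [works, update_works_main] at h₁ h₂ h₃ h₄
        exact h₁.seq (h₂.seq (h₃.seq h₄)))
    (x.code.reverse ++ []) (false :: r)
  have hf : ∀ u : List Bool, u.reverse.foldl (fun a b => true :: ((enc b).code ++ a))
      (false :: r) = (enc u).code ++ r := by
    intro u
    induction u with
    | nil => rfl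
    | cons b u ih => simp [ih, Tm.code]
  rw [List.append_nil, hf] at h
  refine ((comp_take_tmp x r [] []).seq (Comp.seq (W' := works (false :: r) x.code.reverse [] [])
    (T := 1) ?_ h)).mono ?_
  · have := comp_pushC .main false (works r (x.code.reverse ++ []) [] [])
    simpa [works] using this
  · simp only [List.length_reverse]
    unfold Tm.size
    omega

namespace PT

variable {ι α β γ δ : Type} [Enc α] [Enc β] [Enc γ] [Enc δ] {e : ι → Tm}

theorem code {f : ι → Tm} (hf : PT e f) : PT e fun i => (f i).code :=
  PolyMap.comp hf ⟨spell, 12 * Polynomial.X + 6, fun i => by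
    simp only [Polynomial.eval_add, Polynomial.eval_mul, Polynomial.eval_X, Polynomial.eval_ofNat]
    exact maps_spell (f i)⟩

theorem reverse {l : ι → List γ} (hl : PT e l) : PT e fun i => (l i).reverse := by
  obtain ⟨L, hL⟩ := hl.sz_le
  have := foldl hl nil (step := fun _ (s : List γ) c => c :: s) (cons var var.weaken) L
    fun i l₁ l₂ h => by
      rw [foldl_cons_eq, List.append_nil, sz_reverse]
      have h₁ := hL i
      have h₂ := sz_append l₁ l₂
      have h₃ := length_le_sz l₂
      rw [← h] at h₂
      omega
  simpa only [foldl_cons_eq, List.append_nil] using this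

theorem append {l l' : ι → List γ} (hl : PT e l) (hl' : PT e l') : PT e fun i => l i ++ l' i := by
  obtain ⟨L, hL⟩ := hl.sz_le
  obtain ⟨L', hL'⟩ := hl'.sz_le
  have := foldl hl.reverse hl' (step := fun _ (s : List γ) c => c :: s) (cons var var.weaken)
    (L + L') fun i l₁ l₂ h => by
      rw [foldl_cons_eq]
      have h₁ := hL i
      have h₂ := sz_append l₁ l₂
      have h₃ := length_le_sz l₂
      have h₄ := sz_append l₁.reverse (l' i)
      have h₅ := hL' i
      rw [← h, sz_reverse] at h₂
      rw [sz_reverse] at h₄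
      rw [Polynomial.eval_add]
      omega
  simpa only [foldl_cons_eq, List.reverse_reverse] using this

theorem flatMap {l : ι → List γ} {g : ι → γ → List β} (hl : PT e l)
    (hg : PT (cx e) fun p : ι × γ => g p.1 p.2) : PT e fun i => (l i).flatMap (g i) := by
  obtain ⟨L, hL⟩ := hl.sz_le
  obtain ⟨G, hG⟩ := hg.sz_le
  have hf : ∀ i (l : List γ) (s : List β),
      l.foldl (fun s c => s ++ g i c) s = s ++ l.flatMap (g i) := by
    intro i l
    induction l with
    | nil => simp
    | cons c l ih => simp [ih]
  have := foldl hl nil (step := fun i (s : List β) c => s ++ g i c) (append var.weaken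
    (PolyMap.comp (PolyMap.cons (PolyMap.comp PolyMap.fst PolyMap.fst) PolyMap.snd)
      (PolyMap.restrict hg fun p : (ι × List β) × γ => (p.1.1, p.2))))
    (L * G.comp (Polynomial.X + L + 1) + 1) fun i l₁ l₂ h => by
      rw [hf, List.nil_append]
      -- The element `c` belongs to the context of `g i c`; its size is at most that of the list,
      -- hence the summand with `L`.
      have h₀ : ∀ c ∈ l i, sz (g i c) ≤ G.eval ((e i).size + L.eval (e i).size + 1) := fun c hc =>
        (hG (i, c)).trans (eval_mono _ (by
          simp only [cx, Tm.size_cons]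
          have := sz_le_of_mem hc
          have := hL i
          unfold sz at *
          omega))
      have h₁ : ∀ l₁ : List γ, (∀ c ∈ l₁, c ∈ l i) → sz (l₁.flatMap (g i)) ≤
          l₁.length * G.eval ((e i).size + L.eval (e i).size + 1) + 1 := by
        intro l₁
        induction l₁ with
        | nil => simp
        | cons c l₁ ih =>
          intro h
          have := ih fun c hc => h c (List.mem_cons_of_mem _ hc)
          have := h₀ c (h c List.mem_cons_self)
          have := sz_append (g i c) (l₁.flatMap (g i))
          simp only [List.flatMap_cons, List.length_cons, Nat.add_mul]
          omega
      refine (h₁ l₁ fun c hc => by simp [h, hc]).trans ?_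
      simp only [Polynomial.eval_add, Polynomial.eval_mul, Polynomial.eval_comp,
        Polynomial.eval_X, Polynomial.eval_one]
      refine Nat.add_le_add_right (Nat.mul_le_mul_right _ ?_) _
      have := length_le_sz (l i)
      have := hL i
      have : l₁.length ≤ (l i).length := by simp [h]
      omega
  simpa only [hf, List.nil_append] using this

theorem map {l : ι → List γ} {g : ι → γ → β} (hl : PT e l)
    (hg : PT (cx e) fun p : ι × γ => g p.1 p.2) : PT e fun i => (l i).map (g i) := by
  have := flatMap hl (g := fun i c => [g i c]) (cons hg nil)
  simpa only [List.map_eq_flatMap] using this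

theorem filter {l : ι → List γ} {b : ι → γ → Bool} (hl : PT e l)
    (hb : PT (cx e) fun p : ι × γ => b p.1 p.2) : PT e fun i => (l i).filter (b i) := by
  have := flatMap hl (g := fun i c => if b i c then [c] else []) (ite hb (cons var nil) nil)
  convert this using 2 with i
  induction l i with
  | nil => rfl
  | cons c l ih => by_cases h : b i c = Bool.true <;> simp [h, ih]

theorem any {l : ι → List γ} {b : ι → γ → Bool} (hl : PT e l)
    (hb : PT (cx e) fun p : ι × γ => b p.1 p.2) : PT e fun i => (l i).any (b i) := by
  convert not (isEmpty (filter hl hb)) using 2 with i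
  rw [Bool.eq_iff_iff]
  simp [List.filter_eq_nil_iff]

/-- One step in the comparison of two words. -/
def compareStep (s : List Bool × Bool) (c : Bool) : List Bool × Bool :=
  (s.1.tail, s.2 && (!s.1.isEmpty && if c then s.1.headD Bool.false else !s.1.headD Bool.false))

/-- The state is what is left of the second word, with a flag that falls at the first disagreement.
The words are equal if the flag survives and nothing is left. -/
theorem foldl_compareStep (u w : List Bool) (b : Bool) :
    ((u.foldl compareStep (w, b)).1.isEmpty && (u.foldl compareStep (w, b)).2) =
      (b && decide (u = w)) := by
  induction u generalizing w b with
  | nil => cases w <;> simp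
  | cons c u ih =>
    rw [List.foldl_cons, compareStep, ih]
    cases w with
    | nil => simp
    | cons d w => cases c <;> cases d <;> cases b <;> simp <;> congr

theorem eqWord {f g : ι → List Bool} (hf : PT e f) (hg : PT e g) :
    PT e fun i => decide (f i = g i) := by
  obtain ⟨G, hG⟩ := hg.sz_le
  have h₀ : ∀ (u w : List Bool) (b : Bool), sz (u.foldl compareStep (w, b)) ≤ sz w + 4 := by
    intro u
    induction u with
    | nil =>
      intro w b
      have := sz_bool_le b
      simp only [List.foldl_nil, sz_pair]
      omega
    | cons c u ih =>
      intro w b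
      refine (ih _ _).trans ?_
      cases w <;> simp
      omega
  have h := foldl hf (pair hg true) (step := fun _ => compareStep) (pair
      (tail (fst (weaken var)))
      (and (snd (weaken var)) (and (not (isEmpty (fst (weaken var))))
        (ite var (headD (fst (weaken var)) false) (not (headD (fst (weaken var)) false))))))
    (G + 4) fun i l₁ l₂ _ => by
      have := hG i
      have := h₀ l₁ (g i) Bool.true
      simp only [Polynomial.eval_add, Polynomial.eval_ofNat]
      omega
  convert and (isEmpty (fst h)) (snd h) using 2 with i
  rw [foldl_compareStep, Bool.true_and]

/-- Representation by trees and the prefix code are both injective, so equality in any represented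
type reduces to equality of words. -/
theorem eq [DecidableEq β] {f g : ι → β} (hf : PT e f) (hg : PT e g) :
    PT e fun i => decide (f i = g i) := by
  have := eqWord (code (f := fun i => enc (f i)) hf) (code (f := fun i => enc (g i)) hg)
  convert this using 2 with i
  rw [decide_eq_decide]
  exact ⟨fun h => by rw [h], fun h => enc_injective (Tm.code_injective h)⟩

theorem contains [DecidableEq β] {l : ι → List β} {f : ι → β} [∀ i, Decidable (f i ∈ l i)]
    (hl : PT e l) (hf : PT e f) : PT e fun i => decide (f i ∈ l i) := by
  convert any hl (b := fun i c => decide (f i = c)) (eq hf.weaken var) using 2 with i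
  rw [Bool.eq_iff_iff]
  simp

end PT

/-! ### The algorithm -/

section Components

variable {α : Type} [DecidableEq α]

/-- Replace `z` according to a sequence of substitutions. -/
def follow (S : List (α × α)) (z : α) : α := S.foldl (fun l p => if l = p.1 then p.2 else l) z

/-- The substitutions that merge the end points of the given pairs, one pair after the other. -/
def merges (E : List (α × α)) : List (α × α) :=
  E.foldl (fun S e => S ++ [(follow S e.1, follow S e.2)]) []

/-- The representative of the component of `z` in the graph with the edges `E`. -/
def rep (E : List (α × α)) (z : α) : α := follow (merges E) z

end Components

/-- A node of a local state graph: a color and an identifier. -/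
abbrev Node := List Bool × Tm

/-- The edges whose end points do not have the color `c`. -/
def avoid (c : List Bool) (E : List (Node × Node)) : List (Node × Node) :=
  E.filter fun e => !decide (e.1.1 = c) && !decide (e.2.1 = c)

/-- A vertex together with its local state graph, whose nodes stand for the states of the part of
the graph that has been absorbed into the vertex. -/
structure Cell where
  touched : Bool
  idx : ℕ
  row : List Bool
  nodes : List Node
  edges : List (Node × Node)
  src : Node
  dst : Node

instance : Enc Cell where
  enc c := enc (c.touched, c.idx, c.row, c.nodes, c.edges, c.src, c.dst)
  enc_injective c d h := by
    have := enc_injective h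
    cases c; cases d
    simpa using this

/-- Whether two vertices are adjacent. -/
def adj (u v : Cell) : Bool := (u.row.drop v.idx).headD false

/-- The nodes that can be reached from the initial one. -/
def core (w : Cell) : List Node :=
  w.nodes.filter fun z => decide (rep w.edges z = rep w.edges w.src)

/-- The node that combines a node `x` with a component, represented by `z`. -/
def join (x z : Node) : Node := (x.1, .cons x.2 (enc z))

/-- The nodes that arise when `w` is absorbed into `v`. -/
def absorbNodes (w v : Cell) : List Node :=
  v.nodes.flatMap fun x => ((core w).filter fun z =>
    !decide (z.1 = x.1) && decide (rep (avoid x.1 w.edges) z = z)).map fun z => join x z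

/-- Whether two nodes that arise when `w` is absorbed into `v` are adjacent. -/
def absorbAdj (w v : Cell) (p q : Node) : Bool :=
  decide (((p.1, p.2.hd), (q.1, q.2.hd)) ∈ v.edges) && (core w).any fun z =>
    (!decide (z.1 = p.1) && !decide (z.1 = q.1)) &&
      (decide (enc (rep (avoid p.1 w.edges) z) = p.2.tl) &&
        decide (enc (rep (avoid q.1 w.edges) z) = q.2.tl))

/-- The pairs of elements of a list. -/
def pairs {α : Type} (l : List α) : List (α × α) := l.flatMap fun x => l.map fun y => (x, y)

/-- Absorb `w` into its neighbor `v`. -/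
def absorb (w v : Cell) : Cell where
  touched := true
  idx := v.idx
  row := v.row
  nodes := absorbNodes w v
  edges := (pairs (absorbNodes w v)).filter fun e => absorbAdj w v e.1 e.2
  src := join v.src (rep (avoid v.src.1 w.edges) w.src)
  dst := join v.dst (rep (avoid v.dst.1 w.edges) w.dst)

/-- Whether `v` has at most one neighbor in `st`. -/
def lowDegree (st : List Cell) (v : Cell) : Bool := (st.filter (adj v)).tail.isEmpty

/-- The cells that remain when `w` is eliminated. -/
def remaining (st : List Cell) (w : Cell) : List Cell :=
  st.filter fun v => !decide (v.idx = w.idx)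

/-- Eliminate `w`: check that its target can be reached, and absorb it into its neighbor. -/
def eliminate (s : Bool × List Cell) (w : Cell) : Bool × List Cell :=
  if decide (rep w.edges w.dst = rep w.edges w.src) then
    (s.1, ((remaining s.2 w).filter (adj w)).map (absorb w) ++
      (remaining s.2 w).filter fun v => !adj w v)
  else (false, [])

/-- The vertices that can be eliminated, the most urgent one first. -/
def candidates (st : List Cell) : List Cell :=
  (st.filter (lowDegree st)).filter (fun v => !v.touched) ++ st.filter (lowDegree st)

/-- Eliminate one vertex. -/
def step (s : Bool × List Cell) : Bool × List Cell :=
  match candidates s.2 with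
  | [] => s
  | w :: _ => eliminate s w

/-- The answer for the instance that is given by a list of cells. -/
def solve (st : List Cell) : Bool := (st.foldl (fun s _ => step s) (true, st)).1

/-- The initial cell of a vertex, from its index and its block. -/
def mkCell (j : ℕ) (b : List (List Bool)) : Cell where
  touched := false
  idx := j
  row := b.headD []
  nodes := b.tail.tail.tail.map fun c => (c, Tm.nil)
  edges := pairs (b.tail.tail.tail.map fun c => (c, Tm.nil))
  src := (b.tail.headD [], Tm.nil)
  dst := (b.tail.tail.headD [], Tm.nil)

/-- Number the blocks. -/
def indexStep {α : Type} (s : List (ℕ × α) × ℕ) (b : α) : List (ℕ × α) × ℕ :=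
  ((s.2, b) :: s.1, s.2 + 1)

/-- The initial cells of an instance. -/
def mkCells (T : List (List (List Bool))) : List Cell :=
  (T.tail.foldl indexStep ([], 0)).1.map fun p => mkCell p.1 p.2

/-- Two bits for every input symbol. -/
def symbolBits : Symbol → Bool × Bool
  | .bit b => (true, b)
  | .endWord => (false, false)
  | .endBlock => (false, true)

/-- Parse one symbol, from right to left. -/
def parseStep (T : List (List (List Bool))) (s : Bool × Bool) : List (List (List Bool)) :=
  if s.1 then ((s.2 :: (T.headD []).headD []) :: (T.headD []).tail) :: T.tail
  else if s.2 then [] :: T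
  else ([] :: T.headD []) :: T.tail

/-- Parse a reversed input. -/
def parse (u : List (Bool × Bool)) : List (List (List Bool)) := u.foldl parseStep []

/-! ### The algorithm takes polynomial time -/

section Sizes

variable {α : Type} [DecidableEq α]

theorem follow_mem (S : List (α × α)) (z : α) : follow S z = z ∨ ∃ p ∈ S, follow S z = p.2 := by
  unfold follow
  induction S generalizing z with
  | nil => exact .inl rfl
  | cons p S ih =>
    rw [List.foldl_cons]
    rcases ih (if z = p.1 then p.2 else z) with h | ⟨q, hq, h⟩
    · rw [h]
      split_ifs with hz
      · exact .inr ⟨p, List.mem_cons_self, rfl⟩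
      · exact .inl rfl
    · exact .inr ⟨q, List.mem_cons_of_mem _ hq, h⟩

variable [Enc α]

/-- Substitution only selects among elements that are already present, so sizes do not build up
while the pairs are merged. -/
theorem mem_merges_bound {B : ℕ} (E : List (α × α)) (hE : ∀ e ∈ E, sz e.1 ≤ B ∧ sz e.2 ≤ B) :
    (merges E).length = E.length ∧ ∀ p ∈ merges E, sz p.1 ≤ B ∧ sz p.2 ≤ B := by
  unfold merges
  induction E using List.reverseRecOn with
  | nil => simp
  | append_singleton E e ih =>
    obtain ⟨ih₁, ih₂⟩ := ih fun e he => hE e (List.mem_append_left _ he)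
    rw [List.foldl_append, List.foldl_cons, List.foldl_nil]
    refine ⟨by simp [ih₁], fun p hp => ?_⟩
    rcases List.mem_append.1 hp with hp | hp
    · exact ih₂ p hp
    · rw [List.mem_singleton] at hp
      subst hp
      have he := hE e (by simp)
      constructor
      · rcases follow_mem (E.foldl (fun S e => S ++ [(follow S e.1, follow S e.2)]) []) e.1 with
          h | ⟨q, hq, h⟩
        · simp only [h]; exact he.1
        · simp only [h]; exact (ih₂ q hq).2
      · rcases follow_mem (E.foldl (fun S e => S ++ [(follow S e.1, follow S e.2)]) []) e.2 with
          h | ⟨q, hq, h⟩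
        · simp only [h]; exact he.2
        · simp only [h]; exact (ih₂ q hq).2

theorem sz_follow_le (S : List (α × α)) (z : α) : sz (follow S z) ≤ sz z + sz S := by
  rcases follow_mem S z with h | ⟨p, hp, h⟩
  · rw [h]; omega
  · rw [h]
    have := sz_le_of_mem hp
    rcases p with ⟨a, b⟩
    simp only [sz_pair] at this ⊢
    omega

theorem sz_merges_le (E : List (α × α)) : sz (merges E) ≤ sz E * (2 * sz E + 2) + 1 := by
  have h := mem_merges_bound (B := sz E) E fun e he => by
    have := sz_le_of_mem he
    rcases e with ⟨a, b⟩
    simp only [sz_pair] at this ⊢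
    omega
  refine (sz_list_le (B := 2 * sz E + 1) fun p hp => ?_).trans ?_
  · have := h.2 p hp
    rcases p with ⟨a, b⟩
    simp only [sz_pair] at this ⊢
    omega
  · rw [h.1]
    have := length_le_sz E
    exact Nat.add_le_add_right (Nat.mul_le_mul (by omega) (by omega)) _

end Sizes

/-! ### The subroutines of the algorithm as polynomial-time functions -/

namespace PT

variable {ι α β γ δ : Type} [Enc α] [Enc β] [Enc γ] [Enc δ] {e : ι → Tm}

theorem follow [DecidableEq α] {S : ι → List (α × α)} {z : ι → α} (hS : PT e S) (hz : PT e z) :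
    PT e fun i => follow (S i) (z i) := by
  obtain ⟨P, hP⟩ := hS.sz_le
  obtain ⟨Q, hQ⟩ := hz.sz_le
  have h := foldl hS hz (step := fun _ (l : α) (p : α × α) =>
    if decide (l = p.1) then p.2 else l)
    (ite (eq var.weaken var.fst) var.snd var.weaken) (Q + P) fun i l₁ l₂ h => by
      have h₁ := sz_follow_le l₁ (z i)
      have h₂ := sz_append l₁ l₂
      have := length_le_sz l₂
      have := hP i
      have := hQ i
      rw [← h] at h₂
      simp only [decide_eq_true_eq, Polynomial.eval_add]
      unfold ListRecoloring.follow at h₁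
      omega
  simp only [decide_eq_true_eq] at h
  exact h

theorem merges [DecidableEq α] {E : ι → List (α × α)} (hE : PT e E) :
    PT e fun i => merges (E i) := by
  obtain ⟨P, hP⟩ := hE.sz_le
  exact foldl hE nil (step := fun _ (S : List (α × α)) p =>
    S ++ [(ListRecoloring.follow S p.1, ListRecoloring.follow S p.2)])
    (append var.weaken (cons (pair (follow var.weaken var.fst) (follow var.weaken var.snd)) nil))
    (P * (2 * P + 2) + 1) fun i l₁ l₂ h => by
      refine (sz_merges_le l₁).trans ?_
      have h₂ := sz_append l₁ l₂
      have := length_le_sz l₂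
      have := hP i
      rw [← h] at h₂
      simp only [Polynomial.eval_add, Polynomial.eval_mul, Polynomial.eval_ofNat,
        Polynomial.eval_one]
      exact Nat.add_le_add_right (Nat.mul_le_mul (by omega) (by omega)) _

theorem rep [DecidableEq α] {E : ι → List (α × α)} {z : ι → α} (hE : PT e E) (hz : PT e z) :
    PT e fun i => rep (E i) (z i) := follow (merges hE) hz

theorem avoid {c : ι → List Bool} {E : ι → List (Node × Node)} (hc : PT e c) (hE : PT e E) :
    PT e fun i => avoid (c i) (E i) :=
  filter hE (and (not (eq var.fst.fst hc.weaken)) (not (eq var.snd.fst hc.weaken)))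

section Cell

variable {c : ι → Cell}

theorem tuple (hc : PT e c) : PT e fun i => ((c i).touched, (c i).idx, (c i).row, (c i).nodes,
    (c i).edges, (c i).src, (c i).dst) := hc

theorem touched (hc : PT e c) : PT e fun i => (c i).touched := hc.tuple.fst
theorem idx (hc : PT e c) : PT e fun i => (c i).idx := hc.tuple.snd.fst
theorem row (hc : PT e c) : PT e fun i => (c i).row := hc.tuple.snd.snd.fst
theorem nodes (hc : PT e c) : PT e fun i => (c i).nodes := hc.tuple.snd.snd.snd.fst
theorem edges (hc : PT e c) : PT e fun i => (c i).edges := hc.tuple.snd.snd.snd.snd.fst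
theorem src (hc : PT e c) : PT e fun i => (c i).src := hc.tuple.snd.snd.snd.snd.snd.fst
theorem dst (hc : PT e c) : PT e fun i => (c i).dst := hc.tuple.snd.snd.snd.snd.snd.snd

theorem cell {touched : ι → Bool} {idx : ι → ℕ} {row : ι → List Bool} {nodes : ι → List Node}
    {edges : ι → List (Node × Node)} {src dst : ι → Node} (h₁ : PT e touched) (h₂ : PT e idx)
    (h₃ : PT e row) (h₄ : PT e nodes) (h₅ : PT e edges) (h₆ : PT e src) (h₇ : PT e dst) :
    PT e fun i => Cell.mk (touched i) (idx i) (row i) (nodes i) (edges i) (src i) (dst i) :=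
  pair h₁ (pair h₂ (pair h₃ (pair h₄ (pair h₅ (pair h₆ h₇)))))

end Cell

theorem drop {l : ι → List α} {n : ι → ℕ} (hl : PT e l) (hn : PT e n) :
    PT e fun i => (l i).drop (n i) := by
  obtain ⟨L, hL⟩ := hl.sz_le
  have hf : ∀ (u : List Unit) (l : List α), u.foldl (fun l _ => l.tail) l = l.drop u.length := by
    intro u
    induction u with
    | nil => simp
    | cons a u ih => intro l; simp [ih]
  have hn' : PT e fun i => List.replicate (n i) () := hn
  have h := foldl hn' hl (step := fun _ (l : List α) _ => l.tail) (tail var.weaken) L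
    fun i l₁ l₂ _ => by
      rw [hf]
      have h₁ := sz_append ((l i).take l₁.length) ((l i).drop l₁.length)
      have h₂ := length_le_sz ((l i).take l₁.length)
      have := hL i
      rw [List.take_append_drop] at h₁
      omega
  simpa only [hf, List.length_replicate] using h

theorem succ {n : ι → ℕ} (hn : PT e n) : PT e fun i => n i + 1 := by
  have hn' : PT e fun i => List.replicate (n i) () := hn
  exact cons unit hn'

theorem zero : PT e fun _ => 0 := PolyMap.nil

variable {u v w : ι → Cell} {st : ι → List Cell}

theorem adj (hu : PT e u) (hv : PT e v) : PT e fun i => adj (u i) (v i) :=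
  headD (drop hu.row hv.idx) false

theorem core (hw : PT e w) : PT e fun i => core (w i) :=
  filter hw.nodes (eq (rep hw.weaken.edges var) (rep hw.weaken.edges hw.weaken.src))

theorem join {x z : ι → Node} (hx : PT e x) (hz : PT e z) : PT e fun i => join (x i) (z i) :=
  pair hx.fst (tmCons hx.snd (g := fun i => enc (z i)) hz)

theorem pairs {l : ι → List α} (hl : PT e l) : PT e fun i => pairs (l i) :=
  flatMap hl (map hl.weaken (pair var.weaken var))

theorem absorbNodes (hw : PT e w) (hv : PT e v) : PT e fun i => absorbNodes (w i) (v i) :=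
  flatMap hv.nodes (map (filter (core hw.weaken) (and (not (eq var.fst var.weaken.fst))
    (eq (rep (avoid var.weaken.fst hw.weaken.weaken.edges) var) var))) (join var.weaken var))

theorem absorbAdj {p q : ι → Node} (hw : PT e w) (hv : PT e v) (hp : PT e p) (hq : PT e q) :
    PT e fun i => absorbAdj (w i) (v i) (p i) (q i) :=
  and (contains hv.edges (pair (pair hp.fst hp.snd.tmHd) (pair hq.fst hq.snd.tmHd)))
    (any (core hw) (and (and (not (eq var.fst hp.weaken.fst)) (not (eq var.fst hq.weaken.fst)))
      (and (eq (f := fun _ => enc (_ : Node)) (rep (avoid hp.weaken.fst hw.weaken.edges) var)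
          hp.weaken.snd.tmTl)
        (eq (f := fun _ => enc (_ : Node)) (rep (avoid hq.weaken.fst hw.weaken.edges) var)
          hq.weaken.snd.tmTl))))

theorem absorb (hw : PT e w) (hv : PT e v) : PT e fun i => absorb (w i) (v i) :=
  cell true hv.idx hv.row (absorbNodes hw hv)
    (filter (pairs (absorbNodes hw hv)) (absorbAdj hw.weaken hv.weaken var.fst var.snd))
    (join hv.src (rep (avoid hv.src.fst hw.edges) hw.src))
    (join hv.dst (rep (avoid hv.dst.fst hw.edges) hw.dst))

theorem lowDegree (hst : PT e st) (hv : PT e v) : PT e fun i => lowDegree (st i) (v i) :=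
  isEmpty (tail (filter hst (adj hv.weaken var)))

theorem remaining (hst : PT e st) (hw : PT e w) : PT e fun i => remaining (st i) (w i) :=
  filter hst (not (eq var.idx hw.weaken.idx))

theorem eliminate {s : ι → Bool × List Cell} (hs : PT e s) (hw : PT e w) :
    PT e fun i => eliminate (s i) (w i) :=
  ite (eq (rep hw.edges hw.dst) (rep hw.edges hw.src))
    (pair hs.fst (append (map (filter (remaining hs.snd hw) (adj hw.weaken var))
      (absorb hw.weaken var)) (filter (remaining hs.snd hw) (not (adj hw.weaken var)))))
    (pair false nil)

theorem candidates (hst : PT e st) : PT e fun i => candidates (st i) :=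
  append (filter (filter hst (lowDegree hst.weaken var)) (not var.touched))
    (filter hst (lowDegree hst.weaken var))

theorem step {s : ι → Bool × List Cell} (hs : PT e s) : PT e fun i => step (s i) := by
  convert casesList (candidates hs.snd) hs (g := fun i w _ => ListRecoloring.eliminate (s i) w)
    (eliminate hs.weaken.weaken var.weaken) using 2 with i
  unfold ListRecoloring.step
  cases ListRecoloring.candidates (s i).2 <;> rfl

theorem mkCell {j : ι → ℕ} {b : ι → List (List Bool)} (hj : PT e j) (hb : PT e b) :
    PT e fun i => mkCell (j i) (b i) :=
  cell false hj (headD hb nil) (map hb.tail.tail.tail (pair var tmNil))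
    (pairs (map hb.tail.tail.tail (pair var tmNil))) (pair (headD hb.tail nil) tmNil)
    (pair (headD hb.tail.tail nil) tmNil)

theorem mkCells {T : ι → List (List (List Bool))} (hT : PT e T) : PT e fun i => mkCells (T i) := by
  obtain ⟨P, hP⟩ := hT.tail.sz_le
  have hf : ∀ u : List (List (List Bool)), ∃ l, u.foldl indexStep ([], 0) = (l, u.length) ∧
      l.length = u.length ∧ ∀ p ∈ l, p.1 ≤ u.length ∧ p.2 ∈ u := by
    intro u
    induction u using List.reverseRecOn with
    | nil => exact ⟨[], rfl, rfl, by simp⟩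
    | append_singleton u b ih =>
      obtain ⟨l, h₁, h₂, h₃⟩ := ih
      refine ⟨(u.length, b) :: l, by simp [h₁, indexStep], by simp [h₂], ?_⟩
      intro p hp
      rcases List.mem_cons.1 hp with rfl | hp
      · simp
      · have := h₃ p hp
        exact ⟨by simp; omega, by simp [this.2]⟩
  have hn : ∀ n : ℕ, sz n = 2 * n + 1 := by
    intro n
    have : ∀ n : ℕ, sz (List.replicate n ()) = 2 * n + 1 := by
      intro n
      induction n with
      | zero => rfl
      | succ n ih =>
        rw [List.replicate_succ, sz_cons, ih, show sz () = 1 from rfl]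
        omega
    exact this n
  refine map (g := fun _ p => ListRecoloring.mkCell p.1 p.2) (fst (foldl hT.tail (pair nil zero)
    (step := fun _ => indexStep)
    (pair (cons (pair var.weaken.snd var) var.weaken.fst) (succ var.weaken.snd))
    (P * (3 * P + 4) + 1 + (2 * P + 1) + 1) fun i l₁ l₂ h => ?_)) (mkCell var.fst var.snd)
  obtain ⟨l, h₁, h₂, h₃⟩ := hf l₁
  have h₄ := sz_append l₁ l₂
  have := length_le_sz l₂
  have := length_le_sz l₁
  have := hP i
  rw [← h] at h₄
  rw [h₁, sz_pair, hn]
  have h₅ := sz_list_le (l := l) (B := 3 * P.eval (e i).size + 3) fun p hp => by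
    have h₆ := h₃ p hp
    have h₇ := sz_le_of_mem h₆.2
    rcases p with ⟨a, b⟩
    rw [sz_pair, hn]
    simp only at h₆ h₇
    omega
  simp only [Polynomial.eval_add, Polynomial.eval_mul, Polynomial.eval_ofNat,
    Polynomial.eval_one]
  have h₈ : l.length * (3 * P.eval (e i).size + 3 + 1) ≤
    P.eval (e i).size * (3 * P.eval (e i).size + 4) := Nat.mul_le_mul (by omega) (by omega)
  omega

theorem parse {u : ι → List (Bool × Bool)} (hu : PT e u) : PT e fun i => parse (u i) := by
  obtain ⟨P, hP⟩ := hu.sz_le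
  refine foldl hu nil (step := fun _ => parseStep) (ite var.fst
    (cons (cons (cons var.snd (headD (headD var.weaken nil) nil)) (tail (headD var.weaken nil)))
      (tail var.weaken))
    (ite var.snd (cons nil var.weaken) (cons (cons nil (headD var.weaken nil)) (tail var.weaken))))
    (10 * P + 1) fun i l₁ l₂ h => ?_
  have hs : ∀ T s, sz (parseStep T s) ≤ sz T + 10 := by
    intro T s
    have := sz_bool_le s.2
    unfold parseStep
    split_ifs
    · rcases T with _ | ⟨_ | ⟨_, _⟩, _⟩ <;> simp <;> omega
    · simp; omega
    · rcases T with _ | ⟨_, _⟩ <;> simp; omega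
  have hf : ∀ l : List (Bool × Bool), sz (l.foldl parseStep []) ≤ 10 * l.length + 1 := by
    intro l
    induction l using List.reverseRecOn with
    | nil => simp
    | append_singleton l s ih =>
      have := hs (l.foldl parseStep []) s
      simp
      omega
  have h₁ := hf l₁
  have h₂ := length_le_sz (u i)
  have h₃ := hP i
  have h₄ : l₁.length ≤ (u i).length := by simp [h]
  simp only [Polynomial.eval_add, Polynomial.eval_mul, Polynomial.eval_ofNat, Polynomial.eval_one]
  omega

end PT

open Relation

/-! ### Components -/

section Components

variable {α : Type}

/-- For the edges that avoid a color this shows that a representative different from the given node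
is an end of such an edge, and hence avoids the color too. -/
theorem eqvGen_cases {r : α → α → Prop} {a b : α} (h : EqvGen r a b) :
    a = b ∨ ((∃ c, r c a ∨ r a c) ∧ ∃ c, r c b ∨ r b c) := by
  induction h with
  | rel a b h => exact .inr ⟨⟨b, .inr h⟩, ⟨a, .inl h⟩⟩
  | refl => exact .inl rfl
  | symm a b _ ih => exact ih.imp Eq.symm And.symm
  | trans a b c _ _ ih₁ ih₂ =>
    rcases ih₁ with rfl | h₁
    · exact ih₂
    · rcases ih₂ with rfl | h₂
      · exact .inr h₁
      · exact .inr ⟨h₁.1, h₂.2⟩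

theorem reflTransGen_of_eqvGen {r : α → α → Prop} (hr : ∀ a b, r a b → r b a) {a b : α}
    (h : EqvGen r a b) : ReflTransGen r a b := by
  induction h with
  | rel a b h => exact .single h
  | refl => exact .refl
  | symm a b _ ih => exact haveI : Std.Symm r := ⟨hr⟩; (ReflTransGen.stdSymm (r := r)).symm _ _ ih
  | trans a b c _ _ ih₁ ih₂ => exact ih₁.trans ih₂

variable [DecidableEq α]

/-- A new edge redirects the class of its first end to the representative of its second end. The
facts on `rep` follow from this recursion. -/
theorem rep_append (E : List (α × α)) (e : α × α) (z : α) :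
    rep (E ++ [e]) z = if rep E z = rep E e.1 then rep E e.2 else rep E z := by
  unfold rep
  have : merges (E ++ [e]) = merges E ++ [(follow (merges E) e.1, follow (merges E) e.2)] := by
    simp [merges]
  rw [this, follow, List.foldl_append]
  rfl

theorem eqvGen_rep (E : List (α × α)) (z : α) : EqvGen (fun a b => (a, b) ∈ E) z (rep E z) := by
  induction E using List.reverseRecOn generalizing z with
  | nil => exact .refl _
  | append_singleton E e ih =>
    have hm : ∀ {a b}, EqvGen (fun a b => (a, b) ∈ E) a b →
        EqvGen (fun a b => (a, b) ∈ E ++ [e]) a b := fun h =>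
      h.mono fun a b hab => List.mem_append_left _ hab
    rw [rep_append]
    split_ifs with h
    · have h₁ := hm (ih z)
      rw [h] at h₁
      exact h₁.trans _ _ _ (((hm (ih e.1)).symm _ _).trans _ _ _
        ((EqvGen.rel _ _ (by simp)).trans _ _ _ (hm (ih e.2))))
    · exact hm (ih z)

theorem rep_eq_of_mem {E : List (α × α)} {a b : α} (h : (a, b) ∈ E) : rep E a = rep E b := by
  induction E using List.reverseRecOn with
  | nil => simp at h
  | append_singleton E e ih =>
    rw [rep_append, rep_append]
    rcases List.mem_append.1 h with h | h
    · rw [ih h]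
    · rw [List.mem_singleton] at h
      subst h
      simp

theorem rep_eq_iff {E : List (α × α)} {a b : α} :
    rep E a = rep E b ↔ EqvGen (fun a b => (a, b) ∈ E) a b := by
  refine ⟨fun h => ?_, fun h => ?_⟩
  · have h₁ := eqvGen_rep E a
    rw [h] at h₁
    exact h₁.trans _ _ _ ((eqvGen_rep E b).symm _ _)
  · induction h with
    | rel a b h => exact rep_eq_of_mem h
    | refl => rfl
    | symm _ _ _ ih => exact ih.symm
    | trans _ _ _ _ _ ih₁ ih₂ => exact ih₁.trans ih₂

theorem rep_rep (E : List (α × α)) (z : α) : rep E (rep E z) = rep E z :=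
  rep_eq_iff.2 ((eqvGen_rep E z).symm _ _)

end Components

/-! ### Generalized instances -/

/-- The invariants of the local state graph of a vertex. -/
structure Cell.Good (v : Cell) : Prop where
  src_mem : v.src ∈ v.nodes
  dst_mem : v.dst ∈ v.nodes
  left_mem : ∀ x y, (x, y) ∈ v.edges → x ∈ v.nodes
  symm : ∀ x y, (x, y) ∈ v.edges → (y, x) ∈ v.edges

/-- The invariants of a list of cells. -/
structure Good (st : List Cell) : Prop where
  cell : ∀ v ∈ st, v.Good
  inj : ∀ u ∈ st, ∀ v ∈ st, u.idx = v.idx → u = v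
  symm : ∀ u ∈ st, ∀ v ∈ st, adj u v = true → adj v u = true
  irrefl : ∀ u ∈ st, adj u u = false
  src_ne : ∀ u ∈ st, ∀ v ∈ st, adj u v = true → u.src.1 ≠ v.src.1
  dst_ne : ∀ u ∈ st, ∀ v ∈ st, adj u v = true → u.dst.1 ≠ v.dst.1

/-- A choice of nodes is valid if the colors of adjacent vertices differ. -/
structure Valid (st : List Cell) (φ : ℕ → Node) : Prop where
  mem : ∀ v ∈ st, φ v.idx ∈ v.nodes
  ne : ∀ u ∈ st, ∀ v ∈ st, adj u v = true → (φ u.idx).1 ≠ (φ v.idx).1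

/-- A move along an edge of one of the local state graphs. -/
def Move (st : List Cell) (φ ψ : ℕ → Node) : Prop :=
  ∃ v ∈ st, ∃ y, (φ v.idx, y) ∈ v.edges ∧ ψ = Function.update φ v.idx y ∧ Valid st ψ

/-- The target can be reached from the start. -/
def Yes (st : List Cell) : Prop :=
  ∃ φ ψ, (∀ v ∈ st, φ v.idx = v.src) ∧ (∀ v ∈ st, ψ v.idx = v.dst) ∧ ReflTransGen (Move st) φ ψ

theorem yes_nil : Yes [] := ⟨fun _ => ([], .nil), _, by simp, by simp, .refl⟩

/-- The cells after the elimination of `w`. -/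
def eliminated (st : List Cell) (w : Cell) : List Cell :=
  ((remaining st w).filter (adj w)).map (absorb w) ++ (remaining st w).filter fun v => !adj w v

/-- The cell of `v` after the elimination of `w`. -/
def upd (w v : Cell) : Cell := if adj w v = true then absorb w v else v

theorem mem_eliminated {st : List Cell} {w v' : Cell} :
    v' ∈ eliminated st w ↔ ∃ v ∈ st, v.idx ≠ w.idx ∧ v' = upd w v := by
  simp only [eliminated, remaining, List.mem_append, List.mem_map, List.mem_filter, upd]
  constructor
  · rintro (⟨v, ⟨⟨hv, h⟩, ha⟩, rfl⟩ | ⟨⟨hv, h⟩, ha⟩)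
    · exact ⟨v, hv, by simpa using h, by simp [ha]⟩
    · exact ⟨v', hv, by simpa using h, by simp_all⟩
  · rintro ⟨v, hv, h, rfl⟩
    by_cases ha : adj w v = true
    · exact .inl ⟨v, ⟨⟨hv, by simpa using h⟩, ha⟩, by simp [ha]⟩
    · exact .inr (by simp_all)

@[simp] theorem upd_idx (w v : Cell) : (upd w v).idx = v.idx := by
  unfold upd; split_ifs <;> rfl

@[simp] theorem adj_upd (w u v : Cell) : adj (upd w u) (upd w v) = adj u v := by
  unfold upd adj; split_ifs <;> rfl

theorem mem_avoid {c : List Bool} {E : List (Node × Node)} {x y : Node} :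
    (x, y) ∈ avoid c E ↔ (x, y) ∈ E ∧ x.1 ≠ c ∧ y.1 ≠ c := by
  simp [avoid]

theorem mem_core {w : Cell} {z : Node} :
    z ∈ core w ↔ z ∈ w.nodes ∧ rep w.edges z = rep w.edges w.src := by
  simp [core]

theorem join_inj {x z x' z' : Node} : join x z = join x' z' ↔ x = x' ∧ z = z' := by
  constructor
  · intro h
    simp only [join, Prod.mk.injEq, Tm.cons.injEq] at h
    exact ⟨Prod.ext h.1 h.2.1, enc_injective h.2.2⟩
  · rintro ⟨rfl, rfl⟩; rfl

theorem mem_absorbNodes {w v : Cell} {p : Node} :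
    p ∈ absorbNodes w v ↔ ∃ x ∈ v.nodes, ∃ z ∈ core w, z.1 ≠ x.1 ∧
      rep (avoid x.1 w.edges) z = z ∧ p = join x z := by
  simp only [absorbNodes, List.mem_flatMap, List.mem_map, List.mem_filter, Bool.and_eq_true,
    Bool.not_eq_true', decide_eq_false_iff_not, decide_eq_true_eq]
  constructor
  · rintro ⟨x, hx, z, ⟨hz, h₁, h₂⟩, rfl⟩
    exact ⟨x, hx, z, hz, h₁, h₂, rfl⟩
  · rintro ⟨x, hx, z, hz, h₁, h₂, rfl⟩
    exact ⟨x, hx, z, ⟨hz, h₁, h₂⟩, rfl⟩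

theorem mem_pairs {α : Type} {l : List α} {x y : α} : (x, y) ∈ pairs l ↔ x ∈ l ∧ y ∈ l := by
  simp [pairs]

theorem mem_absorb_edges {w v : Cell} {x a y b : Node} :
    (join x a, join y b) ∈ (absorb w v).edges ↔
      join x a ∈ absorbNodes w v ∧ join y b ∈ absorbNodes w v ∧ (x, y) ∈ v.edges ∧
      ∃ z ∈ core w, z.1 ≠ x.1 ∧ z.1 ≠ y.1 ∧ rep (avoid x.1 w.edges) z = a ∧
        rep (avoid y.1 w.edges) z = b := by
  simp only [absorb, List.mem_filter, mem_pairs, absorbAdj, join, Tm.hd, Tm.tl, List.any_eq_true,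
    Bool.and_eq_true, Bool.not_eq_true', decide_eq_false_iff_not, decide_eq_true_eq,
    enc_injective.eq_iff, Prod.mk.eta, and_assoc, ne_eq]

/-! ### Elimination of a vertex preserves the answer -/

section Elimination

variable {st : List Cell} {w : Cell}

/-- Removing a color refines the components, so the representative stays in the component of the
source. If it differs from `z`, it is an end of an edge that avoids `c`. -/
theorem rep_avoid_mem (hw : w.Good) {z : Node} {c : List Bool} (hz : z ∈ core w) (hc : z.1 ≠ c) :
    rep (avoid c w.edges) z ∈ core w ∧ (rep (avoid c w.edges) z).1 ≠ c := by
  have h := eqvGen_rep (avoid c w.edges) z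
  rcases eqvGen_cases h with h₁ | ⟨-, x, h₂⟩
  · rw [← h₁]
    exact ⟨hz, hc⟩
  · have h₃ : rep w.edges (rep (avoid c w.edges) z) = rep w.edges z :=
      rep_eq_iff.2 ((h.mono fun a b hab => (mem_avoid.1 hab).1).symm _ _)
    have h₄ : rep (avoid c w.edges) z ∈ w.nodes ∧ (rep (avoid c w.edges) z).1 ≠ c := by
      rcases h₂ with h₂ | h₂
      · have := mem_avoid.1 h₂
        exact ⟨hw.left_mem _ _ (hw.symm _ _ this.1), this.2.2⟩
      · have := mem_avoid.1 h₂
        exact ⟨hw.left_mem _ _ this.1, this.2.1⟩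
    exact ⟨mem_core.2 ⟨h₄.1, h₃.trans (mem_core.1 hz).2⟩, h₄.2⟩

theorem join_rep_mem (hw : w.Good) {v : Cell} {x z : Node} (hx : x ∈ v.nodes) (hz : z ∈ core w)
    (hc : z.1 ≠ x.1) : join x (rep (avoid x.1 w.edges) z) ∈ absorbNodes w v :=
  mem_absorbNodes.2 ⟨x, hx, _, (rep_avoid_mem hw hz hc).1, (rep_avoid_mem hw hz hc).2,
    rep_rep _ _, rfl⟩

theorem lowDegree_unique (hdeg : lowDegree st w = true) {u v : Cell} (hu : u ∈ st) (hv : v ∈ st)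
    (hau : adj w u = true) (hav : adj w v = true) : u = v := by
  unfold lowDegree at hdeg
  have hu' : u ∈ st.filter (adj w) := List.mem_filter.2 ⟨hu, hau⟩
  have hv' : v ∈ st.filter (adj w) := List.mem_filter.2 ⟨hv, hav⟩
  rcases h : st.filter (adj w) with _ | ⟨a, _ | ⟨b, l⟩⟩
  · simp [h] at hu'
  · rw [h, List.mem_singleton] at hu' hv'
    rw [hu', hv']
  · simp [h] at hdeg

theorem src_mem_core (hw : w.Good) : w.src ∈ core w := mem_core.2 ⟨hw.src_mem, rfl⟩

/-- The hypothesis `hd` puts the target of `w` into `core w`; without it the target of the neighbor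
need not be one of the new nodes. -/
theorem Good.eliminated (hst : Good st) (hw : w ∈ st)
    (hd : rep w.edges w.dst = rep w.edges w.src) : Good (eliminated st w) := by
  have hgw := hst.cell w hw
  refine ⟨?_, ?_, ?_, ?_, ?_, ?_⟩
  · intro v' hv'
    obtain ⟨v, hv, -, rfl⟩ := mem_eliminated.1 hv'
    have hgv := hst.cell v hv
    unfold upd
    split_ifs with ha
    · refine ⟨?_, ?_, ?_, ?_⟩
      · exact join_rep_mem hgw hgv.src_mem (src_mem_core hgw) (hst.src_ne w hw v hv ha)
      · exact join_rep_mem hgw hgv.dst_mem (mem_core.2 ⟨hgw.dst_mem, hd⟩)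
          (hst.dst_ne w hw v hv ha)
      · intro x y h
        exact (mem_pairs.1 (List.mem_filter.1 h).1).1
      · intro p q h
        have h₁ := mem_pairs.1 (List.mem_filter.1 h).1
        obtain ⟨x, -, a, -, -, -, rfl⟩ := mem_absorbNodes.1 h₁.1
        obtain ⟨y, -, b, -, -, -, rfl⟩ := mem_absorbNodes.1 h₁.2
        obtain ⟨h₂, h₃, h₄, z, hz, h₅, h₆, h₇, h₈⟩ := mem_absorb_edges.1 h
        exact mem_absorb_edges.2 ⟨h₃, h₂, hgv.symm _ _ h₄, z, hz, h₆, h₅, h₈, h₇⟩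
    · exact hgv
  · intro u' hu' v' hv' h
    obtain ⟨u, hu, -, rfl⟩ := mem_eliminated.1 hu'
    obtain ⟨v, hv, -, rfl⟩ := mem_eliminated.1 hv'
    rw [hst.inj u hu v hv (by simpa using h)]
  · intro u' hu' v' hv' h
    obtain ⟨u, hu, -, rfl⟩ := mem_eliminated.1 hu'
    obtain ⟨v, hv, -, rfl⟩ := mem_eliminated.1 hv'
    rw [adj_upd] at h ⊢
    exact hst.symm u hu v hv h
  · intro u' hu'
    obtain ⟨u, hu, -, rfl⟩ := mem_eliminated.1 hu'
    rw [adj_upd]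
    exact hst.irrefl u hu
  · intro u' hu' v' hv' h
    obtain ⟨u, hu, -, rfl⟩ := mem_eliminated.1 hu'
    obtain ⟨v, hv, -, rfl⟩ := mem_eliminated.1 hv'
    rw [adj_upd] at h
    have : ∀ v, (upd w v).src.1 = v.src.1 := fun v => by unfold upd; split_ifs <;> rfl
    rw [this, this]
    exact hst.src_ne u hu v hv h
  · intro u' hu' v' hv' h
    obtain ⟨u, hu, -, rfl⟩ := mem_eliminated.1 hu'
    obtain ⟨v, hv, -, rfl⟩ := mem_eliminated.1 hv'
    rw [adj_upd] at h
    have : ∀ v, (upd w v).dst.1 = v.dst.1 := fun v => by unfold upd; split_ifs <;> rfl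
    rw [this, this]
    exact hst.dst_ne u hu v hv h

open Classical in
/-- The choice of nodes after the elimination of `w`. -/
noncomputable def project (st : List Cell) (w : Cell) (φ : ℕ → Node) (i : ℕ) : Node :=
  if i = w.idx then ([], .nil)
  else if ∃ v ∈ st, adj w v = true ∧ v.idx = i then
    join (φ i) (rep (avoid (φ i).1 w.edges) (φ w.idx))
  else φ i

theorem project_apply (hst : Good st) {v : Cell} (hv : v ∈ st) (hvw : v.idx ≠ w.idx)
    (φ : ℕ → Node) : project st w φ v.idx = if adj w v = true then
      join (φ v.idx) (rep (avoid (φ v.idx).1 w.edges) (φ w.idx)) else φ v.idx := by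
  have : (∃ u ∈ st, adj w u = true ∧ u.idx = v.idx) ↔ adj w v = true := by
    refine ⟨?_, fun h => ⟨v, hv, h, rfl⟩⟩
    rintro ⟨u, hu, ha, h⟩
    rwa [← hst.inj u hu v hv h]
  simp only [project, hvw, if_false, this]

/-- `Φ` arises from `φ` by the elimination of `w`. -/
def Match (st : List Cell) (w : Cell) (Φ φ : ℕ → Node) : Prop :=
  ∀ v ∈ st, v.idx ≠ w.idx → Φ v.idx = if adj w v = true then
    join (φ v.idx) (rep (avoid (φ v.idx).1 w.edges) (φ w.idx)) else φ v.idx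

theorem Match.color {Φ φ : ℕ → Node} (h : Match st w Φ φ) {v : Cell} (hv : v ∈ st)
    (hvw : v.idx ≠ w.idx) : (Φ v.idx).1 = (φ v.idx).1 := by
  rw [h v hv hvw]; split_ifs <;> rfl

theorem Match.valid {Φ φ : ℕ → Node} (hst : Good st) (hw : w ∈ st) (h : Match st w Φ φ)
    (hφ : Valid st φ) (hc : φ w.idx ∈ core w) : Valid (ListRecoloring.eliminated st w) Φ := by
  refine ⟨?_, ?_⟩
  · intro v' hv'
    obtain ⟨v, hv, hvw, rfl⟩ := mem_eliminated.1 hv'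
    rw [upd_idx, h v hv hvw, upd]
    split_ifs with ha
    · exact join_rep_mem (hst.cell w hw) (hφ.mem v hv) hc (hφ.ne w hw v hv ha)
    · exact hφ.mem v hv
  · intro u' hu' v' hv' ha
    obtain ⟨u, hu, huw, rfl⟩ := mem_eliminated.1 hu'
    obtain ⟨v, hv, hvw, rfl⟩ := mem_eliminated.1 hv'
    rw [upd_idx, upd_idx, h.color hu huw, h.color hv hvw]
    exact hφ.ne u hu v hv (by simpa using ha)

/-- Validity of `Φ` takes care of all cells except `w`, because matching choices have the same
colors there; `hc` and `hne` supply what concerns `w`. -/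
theorem Match.valid_of {Φ φ : ℕ → Node} (hst : Good st) (hw : w ∈ st) (h : Match st w Φ φ)
    (hΦ : Valid (ListRecoloring.eliminated st w) Φ) (hc : φ w.idx ∈ core w)
    (hne : ∀ v ∈ st, adj w v = true → (φ w.idx).1 ≠ (φ v.idx).1) : Valid st φ := by
  have heq : ∀ v ∈ st, v.idx = w.idx → v = w := fun v hv => hst.inj v hv w hw
  refine ⟨?_, ?_⟩
  · intro v hv
    by_cases hvw : v.idx = w.idx
    · rw [heq v hv hvw]
      exact (mem_core.1 hc).1
    · have h₁ := hΦ.mem _ (mem_eliminated.2 ⟨v, hv, hvw, rfl⟩)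
      rw [upd_idx, h v hv hvw, upd] at h₁
      split_ifs at h₁ with ha
      · obtain ⟨x, hx, z, -, -, -, h₂⟩ := mem_absorbNodes.1 h₁
        rw [(join_inj.1 h₂).1]
        exact hx
      · exact h₁
  · intro u hu v hv ha
    by_cases huw : u.idx = w.idx
    · rw [heq u hu huw] at ha ⊢
      exact hne v hv ha
    · by_cases hvw : v.idx = w.idx
      · rw [heq v hv hvw] at ha ⊢
        exact (hne u hu (hst.symm u hu w hw ha)).symm
      · have h₁ := hΦ.ne _ (mem_eliminated.2 ⟨u, hu, huw, rfl⟩) _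
          (mem_eliminated.2 ⟨v, hv, hvw, rfl⟩) (by simpa using ha)
        rwa [upd_idx, upd_idx, h.color hu huw, h.color hv hvw] at h₁

theorem project_match (hst : Good st) (φ : ℕ → Node) : Match st w (project st w φ) φ :=
  fun _ hv hvw => project_apply hst hv hvw φ

/-- A move of `w` avoids the colors of its neighbors before and after, so it stays in one component
and becomes invisible. During a move of another vertex `w` rests, and its node lies in both
components, which is the witness required for a new edge. -/
theorem move_project (hst : Good st) (hw : w ∈ st) {φ ψ : ℕ → Node} (hφ : Valid st φ)
    (hc : φ w.idx ∈ core w) (hm : Move st φ ψ) :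
    ψ w.idx ∈ core w ∧ (project st w φ = project st w ψ ∨
      Move (eliminated st w) (project st w φ) (project st w ψ)) := by
  obtain ⟨v, hv, y, hy, rfl, hψ⟩ := hm
  by_cases hvw : v.idx = w.idx
  · obtain rfl := hst.inj v hv w hw hvw
    have hy' := mem_core.2 ⟨(hst.cell v hv).left_mem _ _ ((hst.cell v hv).symm _ _ hy),
      (rep_eq_of_mem hy).symm.trans (mem_core.1 hc).2⟩
    -- The equality holds at the index of `w` too, because the projection has a fixed default value
    -- there.
    refine ⟨by simpa using hy', .inl ?_⟩
    funext i
    by_cases hi : i = v.idx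
    · simp [project, hi]
    · simp only [project, hi, if_false, Function.update_of_ne hi, Function.update_self]
      split_ifs with h
      · obtain ⟨u, hu, ha, rfl⟩ := h
        rw [rep_eq_of_mem (mem_avoid.2 ⟨hy, hφ.ne v hv u hu ha, ?_⟩)]
        have := hψ.ne v hv u hu ha
        rwa [Function.update_self, Function.update_of_ne hi] at this
      · rfl
  · have hψw : Function.update φ v.idx y w.idx = φ w.idx := Function.update_of_ne (Ne.symm hvw) _ _
    refine ⟨by rwa [hψw], .inr ⟨upd w v, mem_eliminated.2 ⟨v, hv, hvw, rfl⟩,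
      project st w (Function.update φ v.idx y) v.idx, ?_, ?_,
      (project_match hst _).valid hst hw hψ (by rwa [hψw])⟩⟩
    · rw [upd_idx, project_apply hst hv hvw, project_apply hst hv hvw, hψw, Function.update_self,
        upd]
      split_ifs with ha
      · have h₁ := hφ.ne w hw v hv ha
        have h₂ := hψ.ne w hw v hv ha
        rw [hψw, Function.update_self] at h₂
        have h₃ := hψ.mem v hv
        rw [Function.update_self] at h₃
        exact mem_absorb_edges.2 ⟨join_rep_mem (hst.cell w hw) (hφ.mem v hv) hc h₁,
          join_rep_mem (hst.cell w hw) h₃ hc h₂, hy, _, hc, h₁, h₂, rfl, rfl⟩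
      · exact hy
    · funext i
      rw [upd_idx]
      by_cases hi : i = v.idx
      · subst hi; simp
      · rw [Function.update_of_ne hi]
        simp only [project, Function.update_of_ne hi, hψw]

theorem reach_project (hst : Good st) (hw : w ∈ st) {φ ψ : ℕ → Node} (hφ : Valid st φ)
    (hc : φ w.idx ∈ core w) (h : ReflTransGen (Move st) φ ψ) :
    Valid st ψ ∧ ψ w.idx ∈ core w ∧
      ReflTransGen (Move (eliminated st w)) (project st w φ) (project st w ψ) := by
  induction h with
  | refl => exact ⟨hφ, hc, .refl⟩
  | tail _ hm ih =>
    obtain ⟨h₁, h₂, h₃⟩ := ih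
    obtain ⟨h₄, h₅⟩ := move_project hst hw h₁ h₂ hm
    refine ⟨by obtain ⟨_, _, _, _, _, h⟩ := hm; exact h, h₄, ?_⟩
    rcases h₅ with h₅ | h₅
    · rwa [← h₅]
    · exact h₃.tail h₅

/-- The eliminated vertex can move within a component. -/
theorem reach_update (hst : Good st) (hw : w ∈ st) {φ : ℕ → Node} (hφ : Valid st φ) {z : Node}
    (h : EqvGen (fun a b => (a, b) ∈ w.edges ∧ ∀ v ∈ st, adj w v = true →
      a.1 ≠ (φ v.idx).1 ∧ b.1 ≠ (φ v.idx).1) (φ w.idx) z) :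
    ReflTransGen (Move st) φ (Function.update φ w.idx z) ∧
      Valid st (Function.update φ w.idx z) := by
  have h' := reflTransGen_of_eqvGen (fun a b hab => ⟨(hst.cell w hw).symm _ _ hab.1,
    fun v hv ha => (hab.2 v hv ha).symm⟩) h
  clear h
  have hne : ∀ v ∈ st, v ≠ w → v.idx ≠ w.idx := fun v hv hvw h => hvw (hst.inj v hv w hw h)
  induction h' with
  | refl => rw [Function.update_eq_self]; exact ⟨.refl, hφ⟩
  | @tail b c _ hbc ih =>
    have hval : Valid st (Function.update φ w.idx c) := by
      refine ⟨fun v hv => ?_, fun u hu v hv ha => ?_⟩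
      · by_cases hvw : v = w
        · rw [hvw, Function.update_self]
          exact (hst.cell w hw).left_mem _ _ ((hst.cell w hw).symm _ _ hbc.1)
        · rw [Function.update_of_ne (hne v hv hvw)]
          exact hφ.mem v hv
      · by_cases huw : u = w
        · by_cases hvw : v = w
          · rw [huw, hvw, hst.irrefl w hw] at ha
            simp at ha
          · rw [huw, Function.update_self, Function.update_of_ne (hne v hv hvw)]
            exact (hbc.2 v hv (huw ▸ ha)).2
        · by_cases hvw : v = w
          · rw [hvw, Function.update_self, Function.update_of_ne (hne u hu huw)]
            exact (hbc.2 u hu (hvw ▸ hst.symm u hu v hv ha)).2.symm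
          · rw [Function.update_of_ne (hne u hu huw), Function.update_of_ne (hne v hv hvw)]
            exact hφ.ne u hu v hv ha
    refine ⟨ih.1.tail ⟨w, hw, c, ?_, ?_, hval⟩, hval⟩
    · rw [Function.update_self]
      exact hbc.1
    · rw [Function.update_idem]

/-- An edge between two new nodes comes with a node `z` common to both components. First `w` walks
to `z` within the present component, then `v` moves while `w` waits. Since `v` is the only neighbor
of `w`, no other color can block the walk of `w`. -/
theorem lift_move (hst : Good st) (hw : w ∈ st) (hdeg : lowDegree st w = true)
    {Φ Ψ φ : ℕ → Node} (hφ : Valid st φ) (hc : φ w.idx ∈ core w) (hm : Match st w Φ φ)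
    (hmove : Move (eliminated st w) Φ Ψ) :
    ∃ ψ, ReflTransGen (Move st) φ ψ ∧ Valid st ψ ∧ ψ w.idx ∈ core w ∧ Match st w Ψ ψ := by
  obtain ⟨v', hv', y, hy, rfl, hΨ⟩ := hmove
  obtain ⟨v, hv, hvw, rfl⟩ := mem_eliminated.1 hv'
  rw [upd_idx] at hy hΨ ⊢
  rw [hm v hv hvw, upd] at hy
  split_ifs at hy with ha
  · have hy' := (mem_pairs.1 (List.mem_filter.1 hy).1).2
    obtain ⟨x, hx, b, hb, hbx, hb', rfl⟩ := mem_absorbNodes.1 hy'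
    obtain ⟨-, -, h₁, z, hz, h₂, h₃, h₄, h₅⟩ := mem_absorb_edges.1 hy
    have hr := reach_update hst hw hφ (z := z) (by
      refine (rep_eq_iff.1 h₄.symm).mono fun a b hab => ?_
      have := mem_avoid.1 hab
      refine ⟨this.1, fun u hu hau => ?_⟩
      rw [lowDegree_unique hdeg hu hv hau ha]
      exact this.2)
    have hv₁ : Function.update φ w.idx z v.idx = φ v.idx := Function.update_of_ne hvw _ _
    have hw₁ : Function.update (Function.update φ w.idx z) v.idx x w.idx = z := by
      rw [Function.update_of_ne (Ne.symm hvw), Function.update_self]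
    have hmatch : Match st w (Function.update Φ v.idx (join x b))
        (Function.update (Function.update φ w.idx z) v.idx x) := by
      intro u hu huw
      rw [hw₁]
      by_cases huv : u.idx = v.idx
      · obtain rfl := hst.inj u hu v hv huv
        simp [ha, h₅]
      · rw [Function.update_of_ne huv, Function.update_of_ne huv, Function.update_of_ne huw,
          hm u hu huw]
        have hau : ¬ adj w u = true := fun h => huv (by rw [lowDegree_unique hdeg hu hv h ha])
        simp [hau]
    have hval := hmatch.valid_of hst hw hΨ (by rwa [hw₁]) (fun u hu hau => by
      obtain rfl := lowDegree_unique hdeg hu hv hau ha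
      rw [hw₁, Function.update_self]
      exact h₃)
    exact ⟨_, hr.1.tail ⟨v, hv, x, by rwa [hv₁], rfl, hval⟩, hval, by rwa [hw₁], hmatch⟩
  · have hw₁ : Function.update φ v.idx y w.idx = φ w.idx := Function.update_of_ne (Ne.symm hvw) _ _
    have hmatch : Match st w (Function.update Φ v.idx y) (Function.update φ v.idx y) := by
      intro u hu huw
      rw [hw₁]
      by_cases huv : u.idx = v.idx
      · obtain rfl := hst.inj u hu v hv huv
        simp [ha]
      · rw [Function.update_of_ne huv, Function.update_of_ne huv, hm u hu huw]
    have hval := hmatch.valid_of hst hw hΨ (by rwa [hw₁]) (fun u hu hau => by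
      rw [hw₁, Function.update_of_ne]
      · exact hφ.ne w hw u hu hau
      · intro h
        obtain rfl := hst.inj u hu v hv h
        exact ha hau)
    exact ⟨_, .single ⟨v, hv, y, hy, rfl, hval⟩, hval, by rwa [hw₁], hmatch⟩

theorem lift_reach (hst : Good st) (hw : w ∈ st) (hdeg : lowDegree st w = true)
    {Φ Ψ φ : ℕ → Node} (hφ : Valid st φ) (hc : φ w.idx ∈ core w) (hm : Match st w Φ φ)
    (h : ReflTransGen (Move (eliminated st w)) Φ Ψ) :
    ∃ ψ, ReflTransGen (Move st) φ ψ ∧ Valid st ψ ∧ ψ w.idx ∈ core w ∧ Match st w Ψ ψ := by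
  induction h with
  | refl => exact ⟨φ, .refl, hφ, hc, hm⟩
  | tail _ hmove ih =>
    obtain ⟨ψ, h₁, h₂, h₃, h₄⟩ := ih
    obtain ⟨χ, h₅, h₆⟩ := lift_move hst hw hdeg h₂ h₃ h₄ hmove
    exact ⟨χ, h₁.trans h₅, h₆⟩

theorem exists_choice (hst : Good st) (g : Cell → Node) :
    ∃ φ : ℕ → Node, ∀ v ∈ st, φ v.idx = g v := by
  classical
  refine ⟨fun i => if h : ∃ v ∈ st, v.idx = i then g h.choose else ([], .nil), fun v hv => ?_⟩
  have h : ∃ u ∈ st, u.idx = v.idx := ⟨v, hv, rfl⟩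
  simp only [h, dif_pos]
  rw [hst.inj _ h.choose_spec.1 v hv h.choose_spec.2]

theorem Good.valid_src (hst : Good st) {φ : ℕ → Node} (h : ∀ v ∈ st, φ v.idx = v.src) :
    Valid st φ :=
  ⟨fun v hv => by rw [h v hv]; exact (hst.cell v hv).src_mem,
    fun u hu v hv ha => by rw [h u hu, h v hv]; exact hst.src_ne u hu v hv ha⟩

/-- The elimination of a vertex with at most one neighbor does not change the answer. -/
theorem yes_iff_eliminated (hst : Good st) (hw : w ∈ st) (hdeg : lowDegree st w = true) :
    Yes st ↔ rep w.edges w.dst = rep w.edges w.src ∧ Yes (eliminated st w) := by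
  constructor
  · rintro ⟨φ, ψ, hφ, hψ, h⟩
    obtain ⟨-, h₂, h₃⟩ := reach_project hst hw (hst.valid_src hφ)
      (by rw [hφ w hw]; exact src_mem_core (hst.cell w hw)) h
    rw [hψ w hw] at h₂
    refine ⟨(mem_core.1 h₂).2, _, _, ?_, ?_, h₃⟩
    · intro v' hv'
      obtain ⟨v, hv, hvw, rfl⟩ := mem_eliminated.1 hv'
      rw [upd_idx, project_apply hst hv hvw, hφ v hv, hφ w hw, upd]
      split_ifs <;> rfl
    · intro v' hv'
      obtain ⟨v, hv, hvw, rfl⟩ := mem_eliminated.1 hv'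
      rw [upd_idx, project_apply hst hv hvw, hψ v hv, hψ w hw, upd]
      split_ifs <;> rfl
  · rintro ⟨hd, Φ, Ψ, hΦ, hΨ, h⟩
    obtain ⟨φ, hφ⟩ := exists_choice hst Cell.src
    obtain ⟨ψ, h₁, h₂, h₃, h₄⟩ := lift_reach hst hw hdeg (hst.valid_src hφ)
      (by rw [hφ w hw]; exact src_mem_core (hst.cell w hw)) (fun v hv hvw => by
        have := hΦ _ (mem_eliminated.2 ⟨v, hv, hvw, rfl⟩)
        rw [upd_idx] at this
        rw [this, hφ v hv, hφ w hw, upd]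
        split_ifs <;> rfl) h
    have h₅ : ∀ v ∈ st, v.idx ≠ w.idx → ψ v.idx = v.dst ∧ (adj w v = true →
        rep (avoid v.dst.1 w.edges) (ψ w.idx) = rep (avoid v.dst.1 w.edges) w.dst) := by
      intro v hv hvw
      have h₅ := hΨ _ (mem_eliminated.2 ⟨v, hv, hvw, rfl⟩)
      rw [upd_idx, h₄ v hv hvw, upd] at h₅
      split_ifs at h₅ with ha
      · obtain ⟨h₆, h₇⟩ := join_inj.1 h₅
        rw [h₆] at h₇
        exact ⟨h₆, fun _ => h₇⟩
      · exact ⟨h₅, fun h => absurd h ha⟩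
    have hne : ∀ v ∈ st, adj w v = true → v.idx ≠ w.idx := by
      intro v hv ha h
      rw [hst.inj v hv w hw h, hst.irrefl w hw] at ha
      simp at ha
    -- After the lifted walk all other vertices are at their targets, and `w` is in the component of
    -- its own target, so one more walk of `w` completes the path.
    refine ⟨φ, Function.update ψ w.idx w.dst, hφ, ?_, h₁.trans
      (reach_update hst hw h₂ ?_).1⟩
    · intro v hv
      by_cases hvw : v.idx = w.idx
      · rw [hst.inj v hv w hw hvw, Function.update_self]
      · rw [Function.update_of_ne hvw, (h₅ v hv hvw).1]
    · by_cases hex : ∃ v ∈ st, adj w v = true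
      · obtain ⟨v, hv, ha⟩ := hex
        refine (rep_eq_iff.1 ((h₅ v hv (hne v hv ha)).2 ha)).mono fun a b hab => ?_
        have := mem_avoid.1 hab
        refine ⟨this.1, fun u hu hau => ?_⟩
        rw [lowDegree_unique hdeg hu hv hau ha, (h₅ v hv (hne v hv ha)).1]
        exact this.2
      -- Without a neighbor no color is forbidden, and `w` can walk through the whole component of
      -- its source.
      · refine (rep_eq_iff.1 ((mem_core.1 h₃).2.trans hd.symm)).mono fun a b hab => ?_
        exact ⟨hab, fun u hu hau => absurd ⟨u, hu, hau⟩ hex⟩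

end Elimination

/-! ### The number of nodes -/

/-- In the set of elements reachable from `s`, every element other than `s` has a predecessor
that is closer to `s`. -/
theorem exists_rank {α : Type} (r : α → α → Prop) (s : α) :
    ∃ d : α → ℕ, ∀ y, ReflTransGen r s y → y ≠ s → ∃ u, ReflTransGen r s u ∧ r u y ∧ d u < d y := by
  -- `L n y` means that a walk of length `n` leads from `s` to `y`; the rank will be the distance
  -- from `s`.
  let L : ℕ → α → Prop := fun n => Nat.rec (fun y => y = s) (fun _ P y => ∃ u, P u ∧ r u y) n
  have hL : ∀ n y, L n y → ReflTransGen r s y := by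
    intro n
    induction n with
    | zero => intro y hy; rw [show y = s from hy]
    | succ n ih => rintro y ⟨u, hu, h⟩; exact (ih u hu).tail h
  have hL' : ∀ y, ReflTransGen r s y → ∃ n, L n y := by
    intro y h
    induction h with
    | refl => exact ⟨0, rfl⟩
    | tail _ h ih => obtain ⟨n, hn⟩ := ih; exact ⟨n + 1, _, hn, h⟩
  refine ⟨fun y => sInf {n | L n y}, fun y hy hne => ?_⟩
  have hm : L (sInf {n | L n y}) y := Nat.sInf_mem (hL' y hy)
  rcases hn : sInf {n | L n y} with _ | m
  · rw [hn] at hm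
    exact absurd hm hne
  · rw [hn] at hm
    obtain ⟨u, hu, h⟩ := hm
    exact ⟨u, hL m u hu, h, by
      change sInf {n | L n u} < sInf {n | L n y}
      rw [hn]
      exact Nat.lt_succ_of_le (Nat.sInf_le hu)⟩

/-- The nodes of a cell have different colors. -/
def ColorInj (v : Cell) : Prop := ∀ x ∈ v.nodes, ∀ y ∈ v.nodes, x.1 = y.1 → x = y

/-- All pairs of nodes of a cell are adjacent. -/
def Complete (v : Cell) : Prop := ∀ x ∈ v.nodes, ∀ y ∈ v.nodes, (x, y) ∈ v.edges

theorem nodup_absorbNodes {w v : Cell} (hw : w.nodes.Nodup) (hv : v.nodes.Nodup) :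
    (absorbNodes w v).Nodup := by
  refine List.nodup_flatMap.2 ⟨fun x _ => ?_, ?_⟩
  · exact ((hw.filter _).filter _).map fun a b h => (join_inj.1 h).2
  · refine List.Pairwise.imp ?_ hv
    intro x y hxy
    simp only [Function.onFun, List.disjoint_left, List.mem_map, List.mem_filter]
    rintro _ ⟨z, -, rfl⟩ ⟨z', -, h⟩
    exact hxy (join_inj.1 h).1.symm

theorem rep_eq_of_complete {w : Cell} (hc : Complete w) {c : List Bool} {z z' : Node}
    (hz : z ∈ core w) (hz' : z' ∈ core w) (h : z.1 ≠ c) (h' : z'.1 ≠ c) :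
    rep (avoid c w.edges) z = rep (avoid c w.edges) z' :=
  rep_eq_of_mem (mem_avoid.2 ⟨hc z (mem_core.1 hz).1 z' (mem_core.1 hz').1, h, h'⟩)

/-- A complete graph stays connected when a color is removed. So every node of `v` is paired with at
most one component, and it is determined by its color. -/
theorem colorInj_absorb {w v : Cell} (hc : Complete w) (hv : ColorInj v) :
    ColorInj (absorb w v) := by
  intro p hp q hq h
  obtain ⟨x, hx, z, hz, h₁, h₂, rfl⟩ := mem_absorbNodes.1 hp
  obtain ⟨y, hy, z', hz', h₃, h₄, rfl⟩ := mem_absorbNodes.1 hq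
  obtain rfl := hv x hx y hy h
  rw [join_inj]
  exact ⟨rfl, by rw [← h₂, ← h₄]; exact rep_eq_of_complete hc hz hz' h₁ h₃⟩

/-- When a vertex is absorbed into one whose nodes have different colors, the numbers of nodes add
up: a component is determined by its node that is closest to the initial one, because the
predecessor of this node has the color that is avoided. -/
theorem length_absorb_of_colorInj {w v : Cell} (hgw : w.Good) (hw : w.nodes.Nodup)
    (hv : v.nodes.Nodup) (hc : ColorInj v) :
    (absorb w v).nodes.length ≤ v.nodes.length + w.nodes.length := by
  classical
  obtain ⟨d, hd⟩ := exists_rank (fun a b => (a, b) ∈ w.edges) w.src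
  have hreach : ∀ y ∈ core w, ReflTransGen (fun a b => (a, b) ∈ w.edges) w.src y := fun y hy =>
    reflTransGen_of_eqvGen hgw.symm (rep_eq_iff.1 (mem_core.1 hy).2.symm)
  -- The pair of `x` and a component is charged to a node `y` of the component nearest to the source
  -- of `w`, or to `x` if `y` is the source itself. The sum type keeps the two kinds of charge
  -- apart.
  have hmin : ∀ p : Node, p ∈ absorbNodes w v → ∃ q : Node ⊕ Node,
      (∃ x ∈ v.nodes, q = .inl x ∧ w.src.1 ≠ x.1 ∧
        p = join x (rep (avoid x.1 w.edges) w.src)) ∨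
      (∃ y ∈ core w, q = .inr y ∧ ∃ x ∈ v.nodes, p = join x (rep (avoid x.1 w.edges) y) ∧
        ∃ u, (u, y) ∈ w.edges ∧ d u < d y ∧ u.1 = x.1 ∧
          ∀ u', (u', y) ∈ w.edges → d u' < d y → u'.1 = x.1) := by
    intro p hp
    obtain ⟨x, hx, z, hz, hzx, hrz, rfl⟩ := mem_absorbNodes.1 hp
    let S : Set Node := {y | y ∈ core w ∧ y.1 ≠ x.1 ∧ rep (avoid x.1 w.edges) y = z}
    have hS : S.Nonempty := ⟨z, hz, hzx, hrz⟩
    obtain ⟨y, ⟨hy, hyx, hry⟩, hmin⟩ : ∃ y ∈ S, ∀ u ∈ S, d y ≤ d u := by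
      obtain ⟨y, hy, h⟩ := WellFounded.has_min (InvImage.wf d Nat.lt_wfRel.wf) S hS
      exact ⟨y, hy, fun u hu => not_lt.1 (h u hu)⟩
    by_cases hys : y = w.src
    · subst hys
      exact ⟨.inl x, .inl ⟨x, hx, rfl, hyx, by rw [hry]⟩⟩
    -- A nearer neighbor of another color would lie in the same component, against the choice of
    -- `y`.
    · have hcol : ∀ u', (u', y) ∈ w.edges → d u' < d y → u'.1 = x.1 := by
        intro u hu hlt
        by_contra hux
        refine absurd (hmin u ⟨mem_core.2 ⟨hgw.left_mem _ _ hu, ?_⟩, hux, ?_⟩) (not_le.2 hlt)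
        · rw [rep_eq_of_mem hu, (mem_core.1 hy).2]
        · rw [rep_eq_of_mem (mem_avoid.2 ⟨hu, hux, hyx⟩), hry]
      obtain ⟨u, -, hu, hlt⟩ := hd y (hreach y hy) hys
      exact ⟨.inr y, .inr ⟨y, hy, rfl, x, hx, by rw [hry], u, hu, hlt, hcol u hu hlt, hcol⟩⟩
  choose! f hf using hmin
  have hcard : (absorbNodes w v).toFinset.card ≤
      (v.nodes.toFinset.disjSum w.nodes.toFinset).card := by
    refine Finset.card_le_card_of_injOn f ?_ ?_
    · intro p hp
      rcases hf p (by simpa using hp) with ⟨x, hx, h, -⟩ | ⟨y, hy, h, -⟩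
      · rw [h]; simpa using hx
      · rw [h]; simpa using (mem_core.1 hy).1
    · intro p hp q hq hpq
      rcases hf p (by simpa using hp) with
        ⟨x, hx, h, hsx, h₁⟩ | ⟨y, hy, h, x, hx, h₁, u, hu, hlt, hux, -⟩ <;>
      rcases hf q (by simpa using hq) with
        ⟨x', hx', h', hsx', h₁'⟩ | ⟨y', hy', h', x', hx', h₁', -, -, -, -, hall⟩
      · rw [h, h'] at hpq
        obtain rfl := Sum.inl.inj hpq
        rw [h₁, h₁']
      · rw [h, h'] at hpq; simp at hpq
      · rw [h, h'] at hpq; simp at hpq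
      · rw [h, h'] at hpq
        obtain rfl := Sum.inr.inj hpq
        -- The predecessor `u` of the common node `y` has the color of `x` as well as that of `x'`.
        have hxx : x = x' := hc x hx x' hx' (hux.symm.trans (hall u hu hlt))
        rw [h₁, h₁', hxx]
  rwa [Finset.card_disjSum, List.toFinset_card_of_nodup (nodup_absorbNodes hw hv),
    List.toFinset_card_of_nodup hv, List.toFinset_card_of_nodup hw] at hcard

/-- The maximal size of a node. -/
def nodeSize (v : Cell) : ℕ := v.nodes.toFinset.sup sz

theorem sz_le_nodeSize {v : Cell} {x : Node} (h : x ∈ v.nodes) : sz x ≤ nodeSize v :=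
  Finset.le_sup (f := sz) (by simpa using h)

theorem sz_join (x z : Node) : sz (join x z) = sz x + sz z + 1 := by
  rcases x with ⟨c, i⟩
  have h : sz (Tm.cons i (enc z)) = sz i + sz z + 1 := Tm.size_cons _ _
  simp only [join, sz_pair, h]
  omega

/-- Joining two nodes costs one extra symbol; adding 1 to every node size makes the quantity
subadditive. -/
theorem nodeSize_absorb (w v : Cell) :
    nodeSize (absorb w v) + 1 ≤ (nodeSize v + 1) + (nodeSize w + 1) := by
  have : nodeSize (absorb w v) ≤ nodeSize v + nodeSize w + 1 := by
    refine Finset.sup_le fun p hp => ?_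
    obtain ⟨x, hx, z, hz, -, -, rfl⟩ := mem_absorbNodes.1 (List.mem_toFinset.1 hp)
    rw [sz_join]
    have := sz_le_nodeSize hx
    have := sz_le_nodeSize (mem_core.1 hz).1
    omega
  omega

/-- A quantity that is subadditive under absorption does not grow. -/
theorem sum_eliminated_le (f : Cell → ℕ) {st : List Cell} {w : Cell} (hw : w ∈ st)
    (hdeg : lowDegree st w = true) (hf : ∀ v ∈ st, adj w v = true → f (absorb w v) ≤ f v + f w) :
    ((eliminated st w).map f).sum ≤ (st.map f).sum := by
  have h₁ : ((remaining st w).map f).sum + f w ≤ (st.map f).sum := by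
    clear hdeg hf
    unfold remaining
    induction st with
    | nil => simp at hw
    | cons a st ih =>
      rw [List.filter_cons]
      rcases List.mem_cons.1 hw with rfl | hw
      · have : ((st.filter fun v => !decide (v.idx = w.idx)).map f).sum ≤ (st.map f).sum :=
          (List.filter_sublist.map f).sum_le_sum (by simp)
        simp only [decide_true, Bool.not_true, Bool.false_eq_true, if_false, List.map_cons,
          List.sum_cons]
        omega
      · have := ih hw
        split_ifs <;> simp only [List.map_cons, List.sum_cons] <;> omega
  have hlen : ((remaining st w).filter (adj w)).length ≤ 1 := by
    have h₂ : ((remaining st w).filter (adj w)).length ≤ (st.filter (adj w)).length :=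
      (List.filter_sublist.filter _).length_le
    unfold lowDegree at hdeg
    rcases h : st.filter (adj w) with _ | ⟨a, _ | ⟨b, l⟩⟩
    · rw [h] at h₂; exact h₂.trans (by simp)
    · simpa [h] using h₂
    · simp [h] at hdeg
  have h₃ : ((remaining st w).map f).sum = (((remaining st w).filter (adj w)).map f).sum +
      (((remaining st w).filter fun v => !adj w v).map f).sum := by
    rw [← List.sum_append, ← List.map_append]
    exact ((List.filter_append_perm (adj w) _).map f).sum_eq.symm
  have h₄ : ((((remaining st w).filter (adj w)).map (absorb w)).map f).sum ≤
      (((remaining st w).filter (adj w)).map f).sum + f w := by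
    rcases h : (remaining st w).filter (adj w) with _ | ⟨v, _ | ⟨b, l⟩⟩
    · simp
    · have hv : v ∈ (remaining st w).filter (adj w) := by simp [h]
      have hv' := List.mem_filter.1 hv
      simpa using hf v (List.mem_filter.1 hv'.1).1 hv'.2
    · simp [h] at hlen
  rw [eliminated, List.map_append, List.sum_append]
  omega

/-! ### The invariants of the algorithm on caterpillars -/

/-- The properties of graphs of pathwidth at most one that bound the running time. -/
structure Caterpillar (G : SimpleGraph ℕ) : Prop where
  exists_leaf : ∀ U : Finset ℕ, U.Nonempty →
    ∃ v ∈ U, ∀ a ∈ U, ∀ b ∈ U, G.Adj v a → G.Adj v b → a = b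
  exists_pendant : ∀ v a b c, G.Adj v a → G.Adj v b → G.Adj v c → a ≠ b → a ≠ c → b ≠ c →
    ∃ x, (x = a ∨ x = b ∨ x = c) ∧ ∀ y, G.Adj x y → y = v

/-- All local state graphs have nodes of different colors, or only the first one does not, and
it is the next one to be eliminated. -/
def Phase (st : List Cell) : Prop :=
  (∀ v ∈ st, ColorInj v) ∨ ∃ v l, st = v :: l ∧ lowDegree st v = true ∧ (∀ u ∈ l, ColorInj u) ∧
    ∀ u ∈ st, u.touched = false → lowDegree st u = false

/-- The invariants of the algorithm. -/
structure Inv (G : SimpleGraph ℕ) (st : List Cell) : Prop where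
  good : Good st
  idx_nodup : (st.map Cell.idx).Nodup
  adj_iff : ∀ u ∈ st, ∀ v ∈ st, adj u v = true ↔ G.Adj u.idx v.idx
  nodes_nodup : ∀ v ∈ st, v.nodes.Nodup
  complete : ∀ v ∈ st, v.touched = false → Complete v
  untouched : ∀ v ∈ st, v.touched = false → ∀ j, G.Adj v.idx j → ∃ u ∈ st, u.idx = j
  touched : ∀ v ∈ st, v.touched = true → ∃ j, G.Adj v.idx j ∧ ∀ u ∈ st, u.idx ≠ j
  phase : Phase st

theorem Inv.nil (G : SimpleGraph ℕ) : Inv G [] := by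
  refine ⟨⟨?_, ?_, ?_, ?_, ?_, ?_⟩, ?_, ?_, ?_, ?_, ?_, ?_, .inl ?_⟩ <;> simp

theorem idx_nodup_eliminated {st : List Cell} {w : Cell} (h : (st.map Cell.idx).Nodup) :
    ((eliminated st w).map Cell.idx).Nodup := by
  have h₁ : (eliminated st w).map Cell.idx = ((remaining st w).filter (adj w) ++
      (remaining st w).filter fun v => !adj w v).map Cell.idx := by
    simp only [eliminated, List.map_append, List.map_map]
    rfl
  rw [h₁, ((List.filter_append_perm (adj w) _).map Cell.idx).nodup_iff]
  exact h.sublist (List.filter_sublist.map _)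

theorem length_eliminated_lt {st : List Cell} {w : Cell} (hw : w ∈ st) :
    (eliminated st w).length < st.length := by
  have h₁ : (eliminated st w).length = (remaining st w).length := by
    rw [eliminated, List.length_append, List.length_map, ← List.length_append]
    exact (List.filter_append_perm (adj w) _).length_eq
  rw [h₁]
  exact List.length_filter_lt_length_iff_exists.2 ⟨w, hw, by simp⟩

theorem lowDegree_iff {st : List Cell} {v : Cell} (h : (st.map Cell.idx).Nodup) :
    lowDegree st v = true ↔ ∀ a ∈ st, ∀ b ∈ st, adj v a = true → adj v b = true → a = b := by
  refine ⟨fun hd a ha b hb => lowDegree_unique hd ha hb, fun hu => ?_⟩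
  unfold lowDegree
  have hnd : (st.filter (adj v)).Nodup := (h.of_map _).filter _
  rcases hl : st.filter (adj v) with _ | ⟨a, _ | ⟨b, l⟩⟩
  · simp
  · simp
  · have ha : a ∈ st.filter (adj v) := by simp [hl]
    have hb : b ∈ st.filter (adj v) := by simp [hl]
    rw [List.mem_filter] at ha hb
    have := hu a ha.1 b hb.1 ha.2 hb.2
    rw [hl, this] at hnd
    simp at hnd

/-! ### One step of the algorithm on a caterpillar -/

section Step

variable {G : SimpleGraph ℕ} {st : List Cell} {w : Cell} {l : List Cell}

theorem candidates_ne_nil (hG : Caterpillar G) (h : Inv G st) (hst : st ≠ []) :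
    candidates st ≠ [] := by
  obtain ⟨i, hi, hi'⟩ := hG.exists_leaf (st.map Cell.idx).toFinset (by
    obtain ⟨v, hv⟩ := List.exists_mem_of_ne_nil st hst
    exact ⟨v.idx, by simpa using ⟨v, hv, rfl⟩⟩)
  simp only [List.mem_toFinset, List.mem_map] at hi hi'
  obtain ⟨v, hv, rfl⟩ := hi
  have hlow : lowDegree st v = true := (lowDegree_iff h.idx_nodup).2 fun a ha b hb haa hab =>
    h.good.inj a ha b hb (hi' _ ⟨a, ha, rfl⟩ _ ⟨b, hb, rfl⟩ ((h.adj_iff v hv a ha).1 haa)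
      ((h.adj_iff v hv b hb).1 hab))
  have hmem : v ∈ candidates st := by
    simp [candidates, hv, hlow]
  exact List.ne_nil_of_mem hmem

theorem candidates_cons (hc : candidates st = w :: l) :
    w ∈ st ∧ lowDegree st w = true ∧ (w.touched = false ∨
      ((∀ u ∈ st, u.touched = false → lowDegree st u = false) ∧
        ∃ l', st.filter (lowDegree st) = w :: l')) := by
  have hw : w ∈ candidates st := by simp [hc]
  have hw' : w ∈ st ∧ lowDegree st w = true := by
    simp only [candidates, List.mem_append, List.mem_filter] at hw
    rcases hw with hw | hw
    · exact hw.1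
    · exact hw
  refine ⟨hw'.1, hw'.2, ?_⟩
  unfold candidates at hc
  rcases hu : (st.filter (lowDegree st)).filter (fun v => !v.touched) with _ | ⟨a, l'⟩
  · right
    rw [hu, List.nil_append] at hc
    refine ⟨fun u hu' ht => ?_, l, hc⟩
    by_contra hlow
    have : u ∈ (st.filter (lowDegree st)).filter (fun v => !v.touched) := by
      simp [List.mem_filter, hu', ht]
      simpa using hlow
    simp [hu] at this
  · left
    rw [hu, List.cons_append, List.cons.injEq] at hc
    have : a ∈ (st.filter (lowDegree st)).filter (fun v => !v.touched) := by simp [hu]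
    rw [← hc.1]
    simpa using (List.mem_filter.1 this).2

/-- Except for the vertex that is eliminated next, the colors of the nodes are different, unless
that vertex still has a complete local state graph. -/
theorem Inv.colorInj_of_ne (h : Inv G st) (hc : candidates st = w :: l) {v : Cell} (hv : v ∈ st)
    (hvw : v ≠ w) : ColorInj v := by
  rcases h.phase with hp | ⟨v₀, l₀, rfl, hlow, hp, ht⟩
  · exact hp v hv
  · obtain ⟨hw, hlw, hw' | ⟨-, l', hl'⟩⟩ := candidates_cons hc
    · rw [ht w hw hw'] at hlw
      simp at hlw
    · rw [List.filter_cons, if_pos hlow, List.cons.injEq] at hl'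
      rcases List.mem_cons.1 hv with rfl | hv
      · exact absurd hl'.1 hvw
      · exact hp v hv

theorem Inv.length_absorb (h : Inv G st) (hc : candidates st = w :: l) {v : Cell} (hv : v ∈ st)
    (ha : adj w v = true) :
    (absorb w v).nodes.length ≤ v.nodes.length + w.nodes.length := by
  have hw := (candidates_cons hc).1
  refine length_absorb_of_colorInj (h.good.cell w hw) (h.nodes_nodup w hw) (h.nodes_nodup v hv)
    (h.colorInj_of_ne hc hv ?_)
  rintro rfl
  rw [h.good.irrefl v hv] at ha
  simp at ha

/-- Absorbing an untouched leaf preserves distinct colors, its state graph being complete. A touched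
`w` is chosen only if no untouched leaf is left; its neighbor `v` may then lose distinct colors, but
it is put in front and has at most one neighbor left. Indeed, two neighbors besides `w` would make
one of the three pendant at `v`. -/
theorem Inv.phase_eliminated (hG : Caterpillar G) (h : Inv G st) (hc : candidates st = w :: l) :
    Phase (eliminated st w) := by
  obtain ⟨hw, hlw, hw'⟩ := candidates_cons hc
  have hne : ∀ v ∈ st, v.idx ≠ w.idx → ColorInj v := fun v hv hvw =>
    h.colorInj_of_ne hc hv fun h => hvw (by rw [h])
  rcases hw' with hw' | ⟨hall, -⟩
  · left
    intro v' hv'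
    obtain ⟨v, hv, hvw, rfl⟩ := mem_eliminated.1 hv'
    unfold upd
    split_ifs
    · exact colorInj_absorb (h.complete w hw hw') (hne v hv hvw)
    · exact hne v hv hvw
  · have hrest : ∀ u ∈ (remaining st w).filter fun v => !adj w v, ColorInj u := by
      intro u hu
      have hu := List.mem_filter.1 (List.mem_filter.1 hu).1
      exact hne u hu.1 (by simpa using hu.2)
    rcases hf : (remaining st w).filter (adj w) with _ | ⟨v, l'⟩
    · left
      rw [eliminated, hf]
      simpa using hrest
    · have hv : v ∈ (remaining st w).filter (adj w) := by simp [hf]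
      have hav := (List.mem_filter.1 hv).2
      have hv := List.mem_filter.1 (List.mem_filter.1 hv).1
      have hvw : v.idx ≠ w.idx := by simpa using hv.2
      have hv := hv.1
      have hl' : l' = [] := by
        rcases l' with _ | ⟨v', l'⟩
        · rfl
        · have hnd : ((remaining st w).filter (adj w)).Nodup :=
            ((h.idx_nodup.of_map _).filter _).filter _
          have hv' : v' ∈ (remaining st w).filter (adj w) := by simp [hf]
          have := lowDegree_unique hlw hv (List.mem_filter.1 (List.mem_filter.1 hv').1).1 hav
            (List.mem_filter.1 hv').2
          rw [hf, this] at hnd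
          simp at hnd
      subst hl'
      have hnd := idx_nodup_eliminated (w := w) h.idx_nodup
      have hupd : absorb w v = upd w v := by simp [upd, hav]
      right
      refine ⟨absorb w v, (remaining st w).filter fun v => !adj w v, by simp [eliminated, hf], ?_,
        hrest, ?_⟩
      · rw [lowDegree_iff hnd]
        intro a' ha' b' hb' haa hab
        obtain ⟨a, ha, haw, rfl⟩ := mem_eliminated.1 ha'
        obtain ⟨b, hb, hbw, rfl⟩ := mem_eliminated.1 hb'
        rw [hupd, adj_upd] at haa hab
        by_contra hne'
        have hab' : a.idx ≠ b.idx := fun h' => hne' (by rw [h.good.inj a ha b hb h'])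
        -- No present neighbor of `v` is pendant in `G`: an untouched one would be a leaf now, and a
        -- touched one has an eliminated neighbor, which is not `v`.
        have key : ∀ x ∈ st, adj v x = true → ¬ ∀ y, G.Adj x.idx y → y = v.idx := by
          intro x hx hvx hxy
          rcases htx : x.touched with _ | _
          · have h₁ := hall x hx htx
            rw [← Bool.not_eq_true, lowDegree_iff h.idx_nodup] at h₁
            refine h₁ fun c hc d hd hxc hxd => h.good.inj c hc d hd ?_
            rw [hxy _ ((h.adj_iff x hx c hc).1 hxc), hxy _ ((h.adj_iff x hx d hd).1 hxd)]
          · obtain ⟨j, hj, hj'⟩ := h.touched x hx htx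
            exact hj' v hv (hxy j hj).symm
        have hvw' := h.good.symm w hw v hv hav
        obtain ⟨x, hx, hx'⟩ := hG.exists_pendant v.idx a.idx b.idx w.idx
          ((h.adj_iff v hv a ha).1 haa) ((h.adj_iff v hv b hb).1 hab)
          ((h.adj_iff v hv w hw).1 hvw') hab' haw hbw
        rcases hx with rfl | rfl | rfl
        · exact key a ha haa hx'
        · exact key b hb hab hx'
        · exact key w hw hvw' hx'
      -- A cell that is still untouched is not adjacent to `w`. It keeps all its neighbors, so no
      -- new untouched leaf arises.
      · intro u' hu' htu
        obtain ⟨u, hu, huw, rfl⟩ := mem_eliminated.1 hu'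
        have hwu : ¬ adj w u = true := by
          intro hwu
          simp [upd, hwu, absorb] at htu
        have htu' : u.touched = false := by simpa [upd, hwu] using htu
        have h₁ := hall u hu htu'
        rw [← Bool.not_eq_true, lowDegree_iff h.idx_nodup] at h₁
        rw [← Bool.not_eq_true, lowDegree_iff (idx_nodup_eliminated h.idx_nodup)]
        intro h₂
        refine h₁ fun a ha b hb haa hab => ?_
        have hw₁ : ∀ a ∈ st, adj u a = true → a.idx ≠ w.idx := by
          intro a ha haa hidx
          rw [h.good.inj a ha w hw hidx] at haa
          exact hwu (h.good.symm u hu w hw haa)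
        have := h₂ (upd w a) (mem_eliminated.2 ⟨a, ha, hw₁ a ha haa, rfl⟩) (upd w b)
          (mem_eliminated.2 ⟨b, hb, hw₁ b hb hab, rfl⟩) (by simpa using haa) (by simpa using hab)
        refine h.good.inj a ha b hb ?_
        simpa using congrArg Cell.idx this

theorem Inv.eliminated (hG : Caterpillar G) (h : Inv G st) (hc : candidates st = w :: l)
    (hd : rep w.edges w.dst = rep w.edges w.src) : Inv G (eliminated st w) := by
  obtain ⟨hw, hlw, -⟩ := candidates_cons hc
  refine ⟨h.good.eliminated hw hd, idx_nodup_eliminated h.idx_nodup, ?_, ?_, ?_, ?_, ?_,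
    h.phase_eliminated hG hc⟩
  · intro u' hu' v' hv'
    obtain ⟨u, hu, -, rfl⟩ := mem_eliminated.1 hu'
    obtain ⟨v, hv, -, rfl⟩ := mem_eliminated.1 hv'
    rw [adj_upd, upd_idx, upd_idx]
    exact h.adj_iff u hu v hv
  · intro v' hv'
    obtain ⟨v, hv, -, rfl⟩ := mem_eliminated.1 hv'
    unfold upd
    split_ifs
    · exact nodup_absorbNodes (h.nodes_nodup w hw) (h.nodes_nodup v hv)
    · exact h.nodes_nodup v hv
  · intro v' hv' ht
    obtain ⟨v, hv, -, rfl⟩ := mem_eliminated.1 hv'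
    unfold upd at ht ⊢
    split_ifs at ht ⊢ with ha
    · simp [absorb] at ht
    · exact h.complete v hv ht
  · intro v' hv' ht j hj
    obtain ⟨v, hv, hvw, rfl⟩ := mem_eliminated.1 hv'
    have ha : ¬ adj w v = true := by
      intro ha
      simp [upd, ha, absorb] at ht
    have ht' : v.touched = false := by simpa [upd, ha] using ht
    rw [upd_idx] at hj
    obtain ⟨u, hu, rfl⟩ := h.untouched v hv ht' j hj
    refine ⟨upd w u, mem_eliminated.2 ⟨u, hu, fun huw => ha ?_, rfl⟩, upd_idx _ _⟩
    rw [h.adj_iff w hw v hv, ← huw]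
    exact hj.symm
  · intro v' hv' ht
    obtain ⟨v, hv, hvw, rfl⟩ := mem_eliminated.1 hv'
    rw [upd_idx]
    by_cases ha : adj w v = true
    · refine ⟨w.idx, ((h.adj_iff w hw v hv).1 ha).symm, fun u' hu' => ?_⟩
      obtain ⟨u, -, huw, rfl⟩ := mem_eliminated.1 hu'
      rwa [upd_idx]
    · obtain ⟨j, hj, hj'⟩ := h.touched v hv (by simpa [upd, ha] using ht)
      refine ⟨j, hj, fun u' hu' => ?_⟩
      obtain ⟨u, hu, -, rfl⟩ := mem_eliminated.1 hu'
      rw [upd_idx]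
      exact hj' u hu

end Step

/-- The bounds on the sizes of the cells. -/
structure Bounds (B : ℕ) (st : List Cell) : Prop where
  length : st.length ≤ B
  nodes : (st.map fun v => v.nodes.length).sum ≤ B
  size : (st.map fun v => nodeSize v + 1).sum ≤ B
  idx : ∀ v ∈ st, sz v.idx ≤ B
  row : ∀ v ∈ st, sz v.row ≤ B
  edges : ∀ v ∈ st, v.edges.length ≤ v.nodes.length * v.nodes.length

theorem Bounds.nil (B : ℕ) : Bounds B [] := by
  refine ⟨?_, ?_, ?_, ?_, ?_, ?_⟩ <;> simp

theorem length_pairs {α : Type} (l : List α) : (pairs l).length = l.length * l.length := by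
  simp [pairs, List.length_flatMap]

/-- Node counts and node sizes are bounded as sums over all cells. Since both are subadditive under
the absorptions that occur, the same `B` serves for the whole run. -/
theorem Bounds.eliminated {B : ℕ} {G : SimpleGraph ℕ} {st : List Cell} {w : Cell} {l : List Cell}
    (h : Inv G st) (hc : candidates st = w :: l) (hB : Bounds B st) :
    Bounds B (eliminated st w) := by
  obtain ⟨hw, hlw, -⟩ := candidates_cons hc
  refine ⟨(length_eliminated_lt hw).le.trans hB.length,
    (sum_eliminated_le _ hw hlw fun v hv ha => h.length_absorb hc hv ha).trans hB.nodes,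
    (sum_eliminated_le _ hw hlw fun v hv ha => nodeSize_absorb w v).trans hB.size, ?_, ?_, ?_⟩
  · intro v' hv'
    obtain ⟨v, hv, -, rfl⟩ := mem_eliminated.1 hv'
    rw [upd_idx]
    exact hB.idx v hv
  · intro v' hv'
    obtain ⟨v, hv, -, rfl⟩ := mem_eliminated.1 hv'
    unfold upd
    split_ifs <;> exact hB.row v hv
  · intro v' hv'
    obtain ⟨v, hv, -, rfl⟩ := mem_eliminated.1 hv'
    unfold upd
    split_ifs
    · exact (List.length_filter_le _ _).trans (length_pairs _).le
    · exact hB.edges v hv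

theorem Bounds.sz_le {B : ℕ} {st : List Cell} (hB : Bounds B st) (hst : Good st) (b : Bool) :
    sz (b, st) ≤ 3 + (B * ((3 + B + B + (B * (B + 1) + 1) + (B * B * (2 * B + 2) + 1) + B + B + 6)
      + 1) + 1) + 1 := by
  have hcell : ∀ v ∈ st, sz v ≤ 3 + B + B + (B * (B + 1) + 1) + (B * B * (2 * B + 2) + 1) + B +
      B + 6 := by
    intro v hv
    have h₁ : v.nodes.length ≤ B := (List.single_le_sum (by simp) _
      (List.mem_map_of_mem (f := fun v : Cell => v.nodes.length) hv)).trans hB.nodes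
    have h₂ : nodeSize v + 1 ≤ B := (List.single_le_sum (by simp) _
      (List.mem_map_of_mem (f := fun v : Cell => nodeSize v + 1) hv)).trans hB.size
    have hx : ∀ x ∈ v.nodes, sz x ≤ B := fun x hx => by
      have := sz_le_nodeSize hx
      omega
    have hg := hst.cell v hv
    have h₃ : sz v.nodes ≤ B * (B + 1) + 1 :=
      (sz_list_le hx).trans (Nat.add_le_add_right (Nat.mul_le_mul_right _ h₁) _)
    have h₄ : sz v.edges ≤ B * B * (2 * B + 2) + 1 := by
      refine (sz_list_le (B := 2 * B + 1) fun e he => ?_).trans (Nat.add_le_add_right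
        (Nat.mul_le_mul_right _ ((hB.edges v hv).trans (Nat.mul_le_mul h₁ h₁))) _)
      rcases e with ⟨x, y⟩
      have := hx x (hg.left_mem _ _ he)
      have := hx y (hg.left_mem _ _ (hg.symm _ _ he))
      rw [sz_pair]
      omega
    have h₅ : sz v = sz v.touched + (sz v.idx + (sz v.row + (sz v.nodes + (sz v.edges +
        (sz v.src + sz v.dst + 1) + 1) + 1) + 1) + 1) + 1 := by
      change sz (v.touched, v.idx, v.row, v.nodes, v.edges, v.src, v.dst) = _
      simp only [sz_pair]
    have := sz_bool_le v.touched
    have := hB.idx v hv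
    have := hB.row v hv
    have := hx _ hg.src_mem
    have := hx _ hg.dst_mem
    omega
  have h := sz_list_le hcell
  have := sz_bool_le b
  rw [sz_pair]
  have := Nat.mul_le_mul_right (3 + B + B + (B * (B + 1) + 1) + (B * B * (2 * B + 2) + 1) + B +
      B + 6 + 1) hB.length
  omega

/-- The main loop keeps the invariants and decides the instance. -/
theorem loop_spec {G : SimpleGraph ℕ} (hG : Caterpillar G) {st₀ : List Cell} (h₀ : Inv G st₀)
    {B : ℕ} (hB : Bounds B st₀) (l : List Cell) :
    ∃ b st, l.foldl (fun s _ => step s) (true, st₀) = (b, st) ∧ Inv G st ∧ Bounds B st ∧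
      ((b = true ∧ Yes st) ↔ Yes st₀) ∧ st.length ≤ st₀.length - l.length := by
  induction l using List.reverseRecOn with
  | nil => exact ⟨true, st₀, rfl, h₀, hB, by simp, by simp⟩
  | append_singleton l a ih =>
    obtain ⟨b, st, h₁, h₂, h₃, h₄, h₅⟩ := ih
    rw [List.foldl_append, h₁, List.foldl_cons, List.foldl_nil]
    rcases hc : candidates st with _ | ⟨w, l'⟩
    · have hst : st = [] := by
        by_contra h
        exact candidates_ne_nil hG h₂ h hc
      subst hst
      exact ⟨b, [], by simp [step, hc], h₂, h₃, h₄, by simp⟩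
    · obtain ⟨hw, hlw, -⟩ := candidates_cons hc
      have hlt := length_eliminated_lt hw
      have hyes := yes_iff_eliminated h₂.good hw hlw
      by_cases hd : rep w.edges w.dst = rep w.edges w.src
      · refine ⟨b, eliminated st w, by simp [step, hc, eliminate, hd, eliminated],
          h₂.eliminated hG hc hd, h₃.eliminated h₂ hc, ?_, ?_⟩
        · rw [← h₄, hyes]
          simp [hd]
        · simp only [List.length_append, List.length_cons, List.length_nil]
          omega
      · refine ⟨false, [], by simp [step, hc, eliminate, hd], .nil G, .nil B, ?_, by simp⟩
        rw [← h₄, hyes]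
        simp [hd]

/-- There are as many passes as cells and each pass removes a cell while any is left, so the run
ends with the empty list, for which only the flag matters. -/
theorem solve_eq {G : SimpleGraph ℕ} (hG : Caterpillar G) {st : List Cell} (h : Inv G st)
    {B : ℕ} (hB : Bounds B st) : solve st = true ↔ Yes st := by
  obtain ⟨b, st', h₁, -, -, h₄, h₅⟩ := loop_spec hG h hB st
  have : st' = [] := List.length_eq_zero_iff.1 (by omega)
  subst this
  rw [solve, h₁, ← h₄]
  simp [yes_nil]

theorem bounds_self {st : List Cell}
    (hedges : ∀ v ∈ st, v.edges.length ≤ v.nodes.length * v.nodes.length) :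
    Bounds (sz st) st := by
  have hcell : ∀ v : Cell, sz v = sz v.touched + (sz v.idx + (sz v.row + (sz v.nodes + (sz v.edges +
      (sz v.src + sz v.dst + 1) + 1) + 1) + 1) + 1) + 1 := by
    intro v
    change sz (v.touched, v.idx, v.row, v.nodes, v.edges, v.src, v.dst) = _
    simp only [sz_pair]
  have hsum : ∀ f : Cell → ℕ, (∀ v, f v ≤ sz v) → (st.map f).sum ≤ sz st := by
    intro f hf
    clear hedges
    induction st with
    | nil => simp
    | cons v st ih =>
      have := hf v
      simp only [List.map_cons, List.sum_cons, sz_cons]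
      omega
  refine ⟨(length_le_sz st).trans' (by omega), hsum _ fun v => ?_, hsum _ fun v => ?_, ?_, ?_,
    hedges⟩
  · have := length_le_sz v.nodes
    have := hcell v
    omega
  · have h₁ : nodeSize v ≤ sz v.nodes := Finset.sup_le fun x hx => sz_le_of_mem (by simpa using hx)
    have := hcell v
    omega
  · intro v hv
    have := sz_le_of_mem hv
    have := hcell v
    omega
  · intro v hv
    have := sz_le_of_mem hv
    have := hcell v
    omega

/-- The main loop takes polynomial time on caterpillars. -/
theorem PT.solve {ι : Type} {e : ι → Tm} {st : ι → List Cell} (hst : PT e st)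
    (hinv : ∀ i, ∃ G, Caterpillar G ∧ Inv G (st i))
    (hedges : ∀ i, ∀ v ∈ st i, v.edges.length ≤ v.nodes.length * v.nodes.length) :
    PT e fun i => solve (st i) := by
  obtain ⟨B, hB⟩ := hst.sz_le
  refine PT.fst (PT.foldl hst (PT.pair PT.true hst) (step := fun _ s _ => ListRecoloring.step s)
    (PT.step PT.var.weaken)
    (3 + (B * ((3 + B + B + (B * (B + 1) + 1) + (B * B * (2 * B + 2) + 1) + B + B + 6)
      + 1) + 1) + 1) fun i l₁ l₂ h => ?_)
  obtain ⟨G, hG, hi⟩ := hinv i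
  -- The list only counts the passes, so the specification of the loop applies to every prefix and
  -- bounds all intermediate results.
  obtain ⟨b, st', h₁, h₂, h₃, -⟩ := loop_spec hG hi (bounds_self (hedges i)) l₁
  rw [h₁]
  refine (h₃.sz_le h₂.good b).trans ?_
  simp only [Polynomial.eval_add, Polynomial.eval_mul, Polynomial.eval_ofNat, Polynomial.eval_one]
  have := hB i
  gcongr

/-! ### Graphs of pathwidth at most one -/

/-- A single bag with all vertices is a decomposition, so the infimum is over a nonempty set and is
attained. -/
theorem exists_pathDecomposition_of_pathwidth_le {n t : ℕ} {G : SimpleGraph (Fin n)}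
    (h : pathwidth G ≤ t) : ∃ P : PathDecomposition G, ∀ i, (P.bag i).card ≤ t + 1 := by
  let P₀ : PathDecomposition G :=
    { length := 1
      bag := fun _ => Finset.univ
      cover := fun _ => ⟨0, Finset.mem_univ _⟩
      edge := fun _ _ _ => ⟨0, Finset.mem_univ _, Finset.mem_univ _⟩
      interpolate := fun _ _ _ _ _ _ _ _ => Finset.mem_univ _ }
  obtain ⟨P, hP⟩ := Nat.sInf_mem (s := {t | ∃ P : PathDecomposition G, P.width = t}) ⟨_, P₀, rfl⟩
  refine ⟨P, fun i => ?_⟩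
  have h₁ : P.width ≤ t := by rw [hP]; exact h
  have h₂ := Finset.le_sup (f := fun i => (P.bag i).card) (Finset.mem_univ i)
  unfold PathDecomposition.width at h₁
  omega

section Pathwidth

variable {n : ℕ} {G : SimpleGraph (Fin n)}

theorem PathDecomposition.exists_last (P : PathDecomposition G) (v : Fin n) :
    ∃ i, v ∈ P.bag i ∧ ∀ j, v ∈ P.bag j → j ≤ i := by
  obtain ⟨i, hi⟩ := P.cover v
  obtain ⟨m, hm, h⟩ := (Finset.univ.filter fun i => v ∈ P.bag i).exists_max_image id
    ⟨i, by simpa using hi⟩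
  exact ⟨m, by simpa using hm, fun j hj => h j (by simpa using hj)⟩

theorem PathDecomposition.exists_first (P : PathDecomposition G) (v : Fin n) :
    ∃ i, v ∈ P.bag i ∧ ∀ j, v ∈ P.bag j → i ≤ j := by
  obtain ⟨i, hi⟩ := P.cover v
  obtain ⟨m, hm, h⟩ := (Finset.univ.filter fun i => v ∈ P.bag i).exists_min_image id
    ⟨i, by simpa using hi⟩
  exact ⟨m, by simpa using hm, fun j hj => h j (by simpa using hj)⟩

theorem eq_of_mem_of_card_le_two {α : Type*} {s : Finset α} (hs : s.card ≤ 2) {v a b : α}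
    (hv : v ∈ s) (ha : a ∈ s) (hb : b ∈ s) (hva : v ≠ a) (hvb : v ≠ b) : a = b := by
  classical
  by_contra hab
  have h₁ : ({v, a, b} : Finset α).card = 3 := Finset.card_eq_three.2 ⟨v, a, b, hva, hvb, hab, rfl⟩
  have h₂ : ({v, a, b} : Finset α) ⊆ s := by simp [Finset.insert_subset_iff, hv, ha, hb]
  have := Finset.card_le_card h₂
  omega

/-- Let `v` be a vertex of `U` whose last bag comes earliest. A neighbor in `U` shares a bag with
`v` and lasts at least as long, so it lies in the last bag of `v`, where there is room for only one
further vertex. -/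
theorem exists_leaf_of_pathwidth_le_one (h : pathwidth G ≤ 1) {U : Finset (Fin n)}
    (hU : U.Nonempty) : ∃ v ∈ U, ∀ a ∈ U, ∀ b ∈ U, G.Adj v a → G.Adj v b → a = b := by
  obtain ⟨P, hP⟩ := exists_pathDecomposition_of_pathwidth_le h
  choose r hr hr' using P.exists_last
  obtain ⟨v, hv, hmin⟩ := U.exists_min_image r hU
  have key : ∀ a ∈ U, G.Adj v a → a ∈ P.bag (r v) := by
    intro a ha hva
    obtain ⟨i, hvi, hai⟩ := P.edge v a hva
    exact P.interpolate i (r v) (r a) (hr' v i hvi) (hmin a ha) a hai (hr a)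
  exact ⟨v, hv, fun a ha b hb hva hvb => eq_of_mem_of_card_le_two (hP _) (hr v)
    (key a ha hva) (key b hb hvb) hva.ne hvb.ne⟩

/-- Suppose a neighbor `x` of `v` has another neighbor `y`. A bag with `x` and `y` has no room for
`v`, so it lies outside the interval of bags of `v`, and `x` must belong to the first or the last
bag of that interval. Each of these has room for one such `x`, so there are at most two. -/
theorem exists_pendant_of_pathwidth_le_one (h : pathwidth G ≤ 1) {v a b c : Fin n}
    (hva : G.Adj v a) (hvb : G.Adj v b) (hvc : G.Adj v c) (hab : a ≠ b) (hac : a ≠ c)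
    (hbc : b ≠ c) : ∃ x, (x = a ∨ x = b ∨ x = c) ∧ ∀ y, G.Adj x y → y = v := by
  obtain ⟨P, hP⟩ := exists_pathDecomposition_of_pathwidth_le h
  obtain ⟨r, hr, hr'⟩ := P.exists_last v
  obtain ⟨l, hl, hl'⟩ := P.exists_first v
  have key : ∀ x, G.Adj v x → (∃ y, G.Adj x y ∧ y ≠ v) → x ∈ P.bag l ∨ x ∈ P.bag r := by
    rintro x hvx ⟨y, hxy, hyv⟩
    obtain ⟨i, hvi, hxi⟩ := P.edge v x hvx
    obtain ⟨j, hxj, hyj⟩ := P.edge x y hxy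
    rcases lt_or_ge j l with hj | hj
    · exact .inl (P.interpolate j l i hj.le (hl' i hvi) x hxj hxi)
    · rcases lt_or_ge r j with hj' | hj'
      · exact .inr (P.interpolate i r j (hr' i hvi) hj'.le x hxi hxj)
      · have hvj := P.interpolate l j r hj hj' v hl hr
        exact absurd (eq_of_mem_of_card_le_two (hP j) hxj hyj hvj hxy.ne hvx.ne') hyv
  by_contra! hcon
  have ha := key a hva (hcon a (.inl rfl))
  have hb := key b hvb (hcon b (.inr (.inl rfl)))
  have hc := key c hvc (hcon c (.inr (.inr rfl)))
  have hL : ∀ {x y}, x ∈ P.bag l → y ∈ P.bag l → G.Adj v x → G.Adj v y → x = y :=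
    fun hx hy hvx hvy => eq_of_mem_of_card_le_two (hP l) hl hx hy hvx.ne hvy.ne
  have hR : ∀ {x y}, x ∈ P.bag r → y ∈ P.bag r → G.Adj v x → G.Adj v y → x = y :=
    fun hx hy hvx hvy => eq_of_mem_of_card_le_two (hP r) hr hx hy hvx.ne hvy.ne
  rcases ha with ha | ha <;> rcases hb with hb | hb <;> rcases hc with hc | hc
  · exact hab (hL ha hb hva hvb)
  · exact hab (hL ha hb hva hvb)
  · exact hac (hL ha hc hva hvc)
  · exact hbc (hR hb hc hvb hvc)
  · exact hbc (hL hb hc hvb hvc)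
  · exact hac (hR ha hc hva hvc)
  · exact hab (hR ha hb hva hvb)
  · exact hab (hR ha hb hva hvb)

theorem map_valEmbedding_adj {i : Fin n} {j : ℕ} : (G.map Fin.valEmbedding).Adj i j ↔
    ∃ j' : Fin n, j = j' ∧ G.Adj i j' := by
  rw [SimpleGraph.map_adj]
  constructor
  · rintro ⟨u, v, huv, hu, rfl⟩
    obtain rfl : u = i := Fin.ext hu
    exact ⟨v, rfl, huv⟩
  · rintro ⟨j', rfl, h⟩
    exact ⟨i, j', h, rfl, rfl⟩

theorem exists_eq_val_of_adj {i j : ℕ} (h : (G.map Fin.valEmbedding).Adj i j) :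
    ∃ i' : Fin n, i = i' := by
  obtain ⟨u, v, -, rfl, -⟩ := SimpleGraph.map_adj .. |>.1 h
  exact ⟨u, rfl⟩

/-- Cells carry natural numbers as indices, so the graph is moved to `ℕ`, where the numbers from `n`
on are isolated. -/
theorem caterpillar_of_pathwidth_le_one (h : pathwidth G ≤ 1) :
    Caterpillar (G.map Fin.valEmbedding) where
  exists_leaf U hU := by
    -- If `U` contains no vertex of the original graph, all its elements are isolated and any of
    -- them will do.
    rcases (Finset.univ.filter fun i : Fin n => (i : ℕ) ∈ U).eq_empty_or_nonempty with h₀ | h₀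
    · obtain ⟨v, hv⟩ := hU
      refine ⟨v, hv, fun a ha b hb hva => ?_⟩
      obtain ⟨i, rfl⟩ := exists_eq_val_of_adj hva
      exact absurd hv (by simpa using Finset.filter_eq_empty_iff.1 h₀ (Finset.mem_univ i))
    · obtain ⟨v, hv, hv'⟩ := exists_leaf_of_pathwidth_le_one h h₀
      simp only [Finset.mem_filter, Finset.mem_univ, true_and] at hv hv'
      refine ⟨v, hv, fun a ha b hb hva hvb => ?_⟩
      obtain ⟨a, rfl, hva'⟩ := map_valEmbedding_adj.1 hva
      obtain ⟨b, rfl, hvb'⟩ := map_valEmbedding_adj.1 hvb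
      rw [hv' a ha b hb hva' hvb']
  exists_pendant v a b c hva hvb hvc hab hac hbc := by
    obtain ⟨v, rfl⟩ := exists_eq_val_of_adj hva
    obtain ⟨a, rfl, hva'⟩ := map_valEmbedding_adj.1 hva
    obtain ⟨b, rfl, hvb'⟩ := map_valEmbedding_adj.1 hvb
    obtain ⟨c, rfl, hvc'⟩ := map_valEmbedding_adj.1 hvc
    obtain ⟨x, hx, hx'⟩ := exists_pendant_of_pathwidth_le_one h hva' hvb' hvc'
      (fun h => hab (by rw [h])) (fun h => hac (by rw [h])) (fun h => hbc (by rw [h]))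
    refine ⟨x, ?_, fun y hy => ?_⟩
    · rcases hx with rfl | rfl | rfl <;> simp
    · obtain ⟨y, rfl, hy'⟩ := map_valEmbedding_adj.1 hy
      rw [hx' y hy']

end Pathwidth

/-! ### Parsing the input -/

/-- Read from right to left, an end mark announces the block or word that it closes. So marks open
empty blocks and words, and bits are prepended to the current word. -/
theorem parse_encodeBlocks (T : List (List (List Bool))) :
    parse ((encodeBlocks T).map symbolBits).reverse = T := by
  have hfold : ∀ s : List Symbol, parse (s.map symbolBits).reverse =
      s.foldr (fun a T => parseStep T (symbolBits a)) [] := by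
    intro s
    rw [parse, List.foldl_reverse, List.foldr_map]
  rw [hfold]
  have hword : ∀ (w : List Bool) (x : List Bool) (B T),
      (w.map Symbol.bit).foldr (fun a T => parseStep T (symbolBits a)) ((x :: B) :: T) =
        ((w ++ x) :: B) :: T := by
    intro w x B T
    induction w with
    | nil => rfl
    | cons b w ih =>
      rw [List.map_cons, List.foldr_cons, ih]
      rfl
  have hblock : ∀ (B B' : List (List Bool)) (T),
      (B.flatMap fun w => w.map Symbol.bit ++ [Symbol.endWord]).foldr
        (fun a T => parseStep T (symbolBits a)) (B' :: T) = (B ++ B') :: T := by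
    intro B B' T
    induction B with
    | nil => rfl
    | cons w B ih =>
      rw [List.flatMap_cons, List.foldr_append, ih, List.foldr_append]
      have : [Symbol.endWord].foldr (fun a T => parseStep T (symbolBits a)) ((B ++ B') :: T) =
          ([] :: (B ++ B')) :: T := by simp [parseStep, symbolBits]
      rw [this, hword]
      simp
  induction T with
  | nil => rfl
  | cons B T ih =>
    have : encodeBlocks (B :: T) = ((B.flatMap fun w => w.map Symbol.bit ++ [Symbol.endWord]) ++
        [Symbol.endBlock]) ++ encodeBlocks T := by simp [encodeBlocks]
    rw [this, List.foldr_append, ih, List.foldr_append]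
    have : [Symbol.endBlock].foldr (fun a T => parseStep T (symbolBits a)) T = [] :: T := by
      simp [parseStep, symbolBits]
    rw [this, hblock]
    simp

/-! ### The initial cells of an instance -/

/-- The node for a color. -/
def colorNode {k : ℕ} (c : Fin k) : Node := (Computability.encodeNat c, Tm.nil)

theorem colorNode_fst_injective {k : ℕ} : Function.Injective fun c : Fin k => (colorNode c).1 := by
  intro c d h
  have := congrArg Computability.decodeNat h
  simp only [colorNode, Computability.decode_encodeNat] at this
  exact Fin.ext this

theorem colorNode_injective {k : ℕ} : Function.Injective (colorNode (k := k)) :=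
  fun _ _ h => colorNode_fst_injective (congrArg Prod.fst h)

/-- The initial cell of a vertex. -/
noncomputable def Instance.cell (I : Instance) (v : Fin I.n) : Cell := mkCell v (I.vertexBlock v)

/-- The initial cells of an instance. -/
noncomputable def Instance.cells (I : Instance) : List Cell :=
  mkCells ([Computability.encodeNat I.k] :: (List.finRange I.n).map I.vertexBlock)

variable (I : Instance)

theorem foldl_indexStep {α : Type} (u : List α) :
    u.foldl indexStep ([], 0) = ((u.zipIdx.map Prod.swap).reverse, u.length) := by
  induction u using List.reverseRecOn with
  | nil => rfl
  | append_singleton u b ih =>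
    rw [List.foldl_append, ih]
    simp [indexStep, List.zipIdx_append]

theorem Instance.cells_eq : I.cells = ((List.finRange I.n).map I.cell).reverse := by
  have h : ((List.finRange I.n).map I.vertexBlock).zipIdx =
      (List.finRange I.n).map fun v => (I.vertexBlock v, (v : ℕ)) :=
    List.ext_getElem (by simp) (by simp)
  rw [Instance.cells, mkCells, List.tail_cons, foldl_indexStep, h]
  simp only [List.map_reverse, List.map_map]
  rfl

theorem Instance.mem_cells {c : Cell} : c ∈ I.cells ↔ ∃ v, c = I.cell v := by
  simp [I.cells_eq, eq_comm]

theorem Instance.forall_cells {p : Cell → Prop} : (∀ c ∈ I.cells, p c) ↔ ∀ v, p (I.cell v) := by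
  simp [I.cells_eq]

theorem Instance.adj_cell (u v : Fin I.n) :
    adj (I.cell u) (I.cell v) = true ↔ I.graph.Adj u v := by
  change (((List.finRange I.n).map fun w => _).drop v).headD false = true ↔ _
  rw [List.headD_eq_head?_getD, List.head?_drop]
  simp

theorem Instance.nodes_cell (v : Fin I.n) : (I.cell v).nodes = (I.list v).sort.map colorNode := by
  change (((I.list v).sort.map fun c : Fin I.k => Computability.encodeNat c).map _) = _
  rw [List.map_map]
  rfl

theorem Instance.mem_nodes_cell {v : Fin I.n} {x : Node} :
    x ∈ (I.cell v).nodes ↔ ∃ c ∈ I.list v, x = colorNode c := by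
  simp [I.nodes_cell, eq_comm]

theorem Instance.edges_cell (v : Fin I.n) : (I.cell v).edges = pairs (I.cell v).nodes := rfl

theorem Instance.src_cell (v : Fin I.n) : (I.cell v).src = colorNode (I.start.1 v) := rfl

theorem Instance.dst_cell (v : Fin I.n) : (I.cell v).dst = colorNode (I.target.1 v) := rfl

@[simp] theorem Instance.idx_cell (v : Fin I.n) : (I.cell v).idx = v := rfl

@[simp] theorem Instance.touched_cell (v : Fin I.n) : (I.cell v).touched = false := rfl

theorem Instance.length_edges_le :
    ∀ c ∈ I.cells, c.edges.length ≤ c.nodes.length * c.nodes.length :=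
  I.forall_cells.2 fun v => by rw [I.edges_cell, length_pairs]

theorem Instance.good_cells : Good I.cells where
  cell := I.forall_cells.2 fun v => by
    refine ⟨I.mem_nodes_cell.2 ⟨_, I.start.2 v, I.src_cell v⟩,
      I.mem_nodes_cell.2 ⟨_, I.target.2 v, I.dst_cell v⟩, fun x y h => ?_, fun x y h => ?_⟩
    · rw [I.edges_cell, mem_pairs] at h
      exact h.1
    · rw [I.edges_cell, mem_pairs] at h ⊢
      exact h.symm
  inj := I.forall_cells.2 fun u => I.forall_cells.2 fun v h => by rw [Fin.ext h]
  symm := I.forall_cells.2 fun u => I.forall_cells.2 fun v => by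
    rw [I.adj_cell, I.adj_cell]
    exact fun h => h.symm
  irrefl := I.forall_cells.2 fun u => by
    rw [← Bool.not_eq_true, I.adj_cell]
    exact I.graph.irrefl
  src_ne := I.forall_cells.2 fun u => I.forall_cells.2 fun v h => by
    rw [I.adj_cell] at h
    exact fun h' => I.start.1.valid h (colorNode_fst_injective h')
  dst_ne := I.forall_cells.2 fun u => I.forall_cells.2 fun v h => by
    rw [I.adj_cell] at h
    exact fun h' => I.target.1.valid h (colorNode_fst_injective h')

theorem Instance.inv_cells : Inv (I.graph.map Fin.valEmbedding) I.cells where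
  good := I.good_cells
  idx_nodup := by
    rw [I.cells_eq, List.map_reverse, List.nodup_reverse, List.map_map]
    exact (List.nodup_finRange _).map Fin.val_injective
  adj_iff := I.forall_cells.2 fun u => I.forall_cells.2 fun v => by
    rw [I.adj_cell, I.idx_cell, I.idx_cell, map_valEmbedding_adj]
    refine ⟨fun h => ⟨v, rfl, h⟩, ?_⟩
    rintro ⟨v', h, h'⟩
    rwa [Fin.ext h]
  nodes_nodup := I.forall_cells.2 fun v => by
    rw [I.nodes_cell]
    exact (Finset.sort_nodup _ _).map colorNode_injective
  complete := I.forall_cells.2 fun v _ x hx y hy => by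
    rw [I.edges_cell, mem_pairs]
    exact ⟨hx, hy⟩
  untouched := I.forall_cells.2 fun v _ j hj => by
    obtain ⟨u, rfl, -⟩ := map_valEmbedding_adj.1 hj
    exact ⟨I.cell u, I.mem_cells.2 ⟨u, rfl⟩, rfl⟩
  touched := I.forall_cells.2 fun v h => by simp at h
  phase := .inl <| I.forall_cells.2 fun v x hx y hy h => by
    obtain ⟨c, -, rfl⟩ := I.mem_nodes_cell.1 hx
    obtain ⟨d, -, rfl⟩ := I.mem_nodes_cell.1 hy
    rw [colorNode_fst_injective h]

/-- The choice of nodes for a coloring. -/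
def Instance.choice (f : ListColoring I.graph I.list) (j : ℕ) : Node :=
  if h : j < I.n then colorNode (f.1 ⟨j, h⟩) else ([], .nil)

@[simp] theorem Instance.choice_val (f : ListColoring I.graph I.list) (v : Fin I.n) :
    I.choice f v = colorNode (f.1 v) := by
  simp [Instance.choice]

theorem Instance.valid_choice (f : ListColoring I.graph I.list) : Valid I.cells (I.choice f) where
  mem := I.forall_cells.2 fun v => I.mem_nodes_cell.2 ⟨f.1 v, f.2 v, by simp⟩
  ne := I.forall_cells.2 fun u => I.forall_cells.2 fun v h => by
    rw [I.adj_cell] at h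
    rw [I.idx_cell, I.idx_cell, I.choice_val, I.choice_val]
    exact fun h' => f.1.valid h (colorNode_fst_injective h')

theorem Instance.exists_coloring_of_valid {φ : ℕ → Node} (h : Valid I.cells φ) :
    ∃ f : ListColoring I.graph I.list, ∀ v : Fin I.n, φ v = colorNode (f.1 v) := by
  have h₁ : ∀ v : Fin I.n, ∃ c ∈ I.list v, φ v = colorNode c := fun v =>
    I.mem_nodes_cell.1 (h.mem _ (I.mem_cells.2 ⟨v, rfl⟩))
  choose f hf hφ using h₁
  refine ⟨⟨SimpleGraph.Coloring.mk f fun {u v} huv he => ?_, hf⟩, hφ⟩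
  refine h.ne _ (I.mem_cells.2 ⟨u, rfl⟩) _ (I.mem_cells.2 ⟨v, rfl⟩) ((I.adj_cell u v).2 huv) ?_
  rw [I.idx_cell, I.idx_cell, hφ, hφ, he]

theorem Instance.move_choice {f g : ListColoring I.graph I.list}
    (h : (reconfigurationGraph I.graph I.list).Adj f g) :
    Move I.cells (I.choice f) (I.choice g) := by
  obtain ⟨v, hv⟩ := Set.ncard_eq_one.1 h
  refine ⟨I.cell v, I.mem_cells.2 ⟨v, rfl⟩, colorNode (g.1 v), ?_, ?_, I.valid_choice g⟩
  · rw [I.edges_cell, mem_pairs]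
    exact ⟨I.mem_nodes_cell.2 ⟨f.1 v, f.2 v, by simp⟩, I.mem_nodes_cell.2 ⟨g.1 v, g.2 v, rfl⟩⟩
  · funext j
    rw [I.idx_cell, Function.update_apply]
    split_ifs with hj
    · rw [hj, I.choice_val]
    · unfold Instance.choice
      split_ifs with hn
      · congr 1
        by_contra hne
        have : (⟨j, hn⟩ : Fin I.n) ∈ ({v} : Set (Fin I.n)) := by
          rw [← hv]
          exact fun he => hne he.symm
        exact hj (congrArg Fin.val (Set.mem_singleton_iff.1 this))
      · rfl

theorem Instance.yes_cells_iff : Yes I.cells ↔ I.IsYes := by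
  unfold Instance.IsYes Yes
  constructor
  · rintro ⟨φ, ψ, hφ, hψ, h⟩
    have key : ∃ f : ListColoring I.graph I.list, (∀ v : Fin I.n, ψ v = colorNode (f.1 v)) ∧
        (reconfigurationGraph I.graph I.list).Reachable I.start f := by
      clear hψ
      induction h with
      | refl => exact ⟨I.start, fun v => hφ _ (I.mem_cells.2 ⟨v, rfl⟩), .refl _⟩
      | @tail χ ψ _ hm ih =>
        obtain ⟨f, hf, hr⟩ := ih
        obtain ⟨c, hc, y, -, hu, hval⟩ := hm
        obtain ⟨w, rfl⟩ := I.mem_cells.1 hc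
        obtain ⟨g, hg⟩ := I.exists_coloring_of_valid hval
        have hne : ∀ v, f.1 v ≠ g.1 v → v = w := by
          intro v hv
          by_contra hvw
          refine hv (colorNode_injective ?_)
          rw [← hf, ← hg, hu, I.idx_cell, Function.update_of_ne]
          exact fun h => hvw (Fin.ext h)
        refine ⟨g, hg, ?_⟩
        -- The initial state graphs contain loops, so a move may leave the coloring unchanged.
        by_cases hw : f.1 w = g.1 w
        · have : f = g := by
            refine Subtype.ext (DFunLike.ext _ _ fun v => ?_)
            by_contra hv
            exact hv (hne v hv ▸ hw)
          rwa [← this]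
        · refine hr.trans (SimpleGraph.Adj.reachable (Set.ncard_eq_one.2 ⟨w, ?_⟩))
          ext v
          exact ⟨fun h => hne v h, fun h => by rw [Set.mem_singleton_iff.1 h]; exact hw⟩
    obtain ⟨f, hf, hr⟩ := key
    have : f = I.target := by
      refine Subtype.ext (DFunLike.ext _ _ fun v => colorNode_injective ?_)
      rw [← hf, ← I.dst_cell]
      exact hψ _ (I.mem_cells.2 ⟨v, rfl⟩)
    rwa [← this]
  · intro h
    refine ⟨I.choice I.start, I.choice I.target, I.forall_cells.2 fun v => ?_,
      I.forall_cells.2 fun v => ?_, ?_⟩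
    · rw [I.idx_cell, I.choice_val, I.src_cell]
    · rw [I.idx_cell, I.choice_val, I.dst_cell]
    · exact (SimpleGraph.reachable_iff_reflTransGen _ _ |>.1 h).lift I.choice fun _ _ h => I.move_choice h

theorem Instance.solve_cells_iff (h : pathwidth I.graph ≤ 1) :
    solve I.cells = true ↔ I.IsYes :=
  (solve_eq (caterpillar_of_pathwidth_le_one h) I.inv_cells (bounds_self I.length_edges_le)).trans
    I.yes_cells_iff

/-- The input as a list of pairs of bits, in reverse order. -/
noncomputable def Instance.bits : List (Bool × Bool) := (I.encode.map symbolBits).reverse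

theorem Instance.parse_bits : mkCells (parse I.bits) = I.cells := by
  rw [Instance.bits, Instance.encode, parse_encodeBlocks, Instance.cells]

/-- The problem is solved in polynomial time by a program on trees. -/
theorem PT.solve_bits : PT (fun I : {I : Instance // pathwidth I.graph ≤ 1} => enc I.1.bits)
    fun I => ListRecoloring.solve I.1.cells := by
  have h : PT (fun I : {I : Instance // pathwidth I.graph ≤ 1} => enc I.1.bits)
      fun I => I.1.cells := by
    simp only [← Instance.parse_bits]
    exact PT.mkCells (PT.parse PolyMap.id)
  exact PT.solve h (fun I => ⟨_, caterpillar_of_pathwidth_le_one I.2, I.1.inv_cells⟩)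
    fun I => I.1.length_edges_le

/-! ### The Turing machine -/

/-- Push the tree of a bit that depends on the register. -/
def loadBit (g : Option Symbol → Bool) : SProg :=
  .ite g (.seq (pushC .main false) (.seq (pushC .main false) (pushC .main true)))
    (pushC .main false)

theorem wrun_pushC_main (b : Bool) (v a) :
    WRun (pushC .main b) v (onMain a) v (onMain (b :: a)) 1 := by
  simpa only [works, update_works_main] using wrun_pushC (w := .main) (b := b) (v := v)
    (W := onMain a)

theorem wrun_popR_main (v a) :
    WRun (popR .main) v (onMain a) (reg a.head?) (onMain a.tail) 1 := by
  simpa only [works, update_works_main] using wrun_popR (w := .main) (v := v) (W := onMain a)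

theorem wrun_loadBit (g : Option Symbol → Bool) (v a) :
    ∃ t ≤ 4, WRun (loadBit g) v (onMain a) v (onMain ((enc (g v)).code ++ a)) t := by
  cases hg : g v
  · exact ⟨_, by norm_num, .ite_false hg (wrun_pushC_main _ _ _)⟩
  · exact ⟨_, by norm_num, .ite_true hg ((wrun_pushC_main _ _ _).seq
      ((wrun_pushC_main _ _ _).seq (wrun_pushC_main _ _ _)))⟩

/-- The two bits of the symbol in the register. -/
def registerBits (v : Option Symbol) : Bool × Bool := v.elim (false, false) symbolBits

/-- Prepend the symbol in the register to the list on the main stack. -/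
def loadSymbol : SProg :=
  .seq (loadBit fun v => (registerBits v).2) <| .seq (loadBit fun v => (registerBits v).1) <|
    .seq (pushC .main true) (pushC .main true)

theorem wrun_loadSymbol (s : Symbol) (l : List (Bool × Bool)) :
    ∃ t ≤ 10, WRun loadSymbol (some s) (onMain (enc l).code) (some s)
      (onMain (enc (symbolBits s :: l)).code) t := by
  obtain ⟨t₁, ht₁, h₁⟩ := wrun_loadBit (fun v => (registerBits v).2) (some s) (enc l).code
  obtain ⟨t₂, ht₂, h₂⟩ := wrun_loadBit (fun v => (registerBits v).1) (some s)
    ((enc (symbolBits s).2).code ++ (enc l).code)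
  have h := h₁.seq (h₂.seq ((wrun_pushC_main true _ _).seq (wrun_pushC_main true _ _)))
  refine ⟨t₁ + (t₂ + (1 + 1)), by omega, ?_⟩
  have he : (enc (symbolBits s :: l)).code = true :: true :: ((enc (symbolBits s).1).code ++
      ((enc (symbolBits s).2).code ++ (enc l).code)) := by
    change true :: ((true :: (_ ++ _)) ++ _) = _
    rw [List.cons_append, List.append_assoc]
    rfl
  rw [he]
  exact h

/-- Read a symbol of the input into the register. -/
def popInp : SProg := .pop .inp fun _ o => o

theorem run_popInp (v i o W) : Run popInp v (stks i o W) i.head? (stks i.tail o W) 1 := by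
  have h := Run.pop (k := Stk.inp) (f := fun _ o => o) (v := v) (S := stks i o W)
  rwa [update_stks_inp] at h

/-- Turn the input into a tree on the main stack. -/
def load : SProg :=
  .seq (pushC .main false) <| .seq popInp <| .loop Option.isSome <| .seq loadSymbol popInp

theorem run_load (v i o) : ∃ t ≤ 12 * i.length + 3, Run load v (stks i o (onMain [])) none
    (stks [] o (onMain (enc (i.map symbolBits).reverse).code)) t := by
  have key : ∀ (i : List Symbol) (l : List (Bool × Bool)), ∃ t ≤ 12 * i.length + 1,
      Run (.loop Option.isSome (.seq loadSymbol popInp)) i.head?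
        (stks i.tail o (onMain (enc l).code)) none
        (stks [] o (onMain (enc ((i.map symbolBits).reverse ++ l)).code)) t := by
    intro i
    induction i with
    | nil => exact fun l => ⟨1, by simp, .loop_false rfl⟩
    | cons s i ih =>
      intro l
      obtain ⟨t, ht, h⟩ := ih (symbolBits s :: l)
      obtain ⟨t', ht', h'⟩ := wrun_loadSymbol s l
      refine ⟨t' + 1 + t + 1, ?_, ?_⟩
      · simp only [List.length_cons]
        omega
      · have h'' := Run.loop_true (b := Option.isSome) rfl
          ((h' i o).seq (run_popInp (some s) i o _)) h
        simpa using h''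
  obtain ⟨t, ht, h⟩ := key i []
  rw [List.append_nil] at h
  exact ⟨_, by omega, (wrun_pushC_main false v [] i o).seq ((run_popInp v i o _).seq h)⟩

/-- Move a bit from the main stack to the output, and leave the other stacks empty. -/
def unload : SProg :=
  .seq (popR .main) <| .seq (.push .out isOne) <|
    .ite isOne (.seq (popR .main) (.seq (popR .main) (popR .main))) (popR .main)

/-- The last pop finds the stack empty and thereby resets the register to `none`, the initial value
that the halting configuration must show. -/
theorem run_unload (v i) (b : Bool) : ∃ t ≤ 6, Run unload v (stks i [] (onMain (enc b).code)) none
    (stks i [b] (onMain [])) t := by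
  have h₁ := wrun_popR_main v (enc b).code i []
  have h₂ : Run (.push .out isOne) (reg (enc b).code.head?)
      (stks i [] (onMain (enc b).code.tail)) (reg (enc b).code.head?)
      (stks i [b] (onMain (enc b).code.tail)) 1 := by
    have h := Run.push (k := Stk.out) (f := isOne) (v := reg (enc b).code.head?)
      (S := stks i [] (onMain (enc b).code.tail))
    rw [update_stks_out] at h
    cases b <;> exact h
  cases b
  · exact ⟨_, by norm_num, h₁.seq (h₂.seq (.ite_false rfl (wrun_popR_main _ _ _ _)))⟩
  · exact ⟨_, by norm_num, h₁.seq (h₂.seq (.ite_true rfl ((wrun_popR_main _ _ _ _).seq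
      ((wrun_popR_main _ _ _ _).seq (wrun_popR_main _ _ _ _)))))⟩

/-- A problem that is solved in polynomial time by a program on trees is solved in polynomial time
by a Turing machine. -/
theorem PT.exists_machine {ι : Type} {s : ι → List Symbol} {f : ι → Bool}
    (h : PT (fun i => enc ((s i).map symbolBits).reverse) f) :
    Nonempty (TM2ComputableInPolyTime s Computability.encodeBool f) := by
  obtain ⟨p, P, hp⟩ := h
  -- Loading takes at most `12 n + 3` steps, unloading 6 and halting 1, where `n` is the length of
  -- the input.
  have hrun : ∀ i, ∃ t ≤ (12 * Polynomial.X + 10 + P.comp (8 * Polynomial.X + 1)).eval (s i).length,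
      (flip bind (Prog.machine (.seq load (.seq p unload)) Stk.inp Stk.out none).step)^[t]
        (some (initList _ (s i))) = some (haltList _ [f i]) := by
    intro i
    obtain ⟨t₁, ht₁, h₁⟩ := run_load none (s i) []
    obtain ⟨v, t₂, ht₂, h₂⟩ := hp i [] none
    obtain ⟨t₃, ht₃, h₃⟩ := run_unload v [] (f i)
    rw [List.append_nil, List.append_nil] at h₂
    have hrun := Run.evals Stk.inp Stk.out (h₁.seq ((h₂ [] []).seq h₃))
    refine ⟨t₁ + (t₂ + t₃) + 1, ?_, ?_⟩
    rotate_left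
    · have hi : initList (Prog.machine (.seq load (.seq p unload)) Stk.inp Stk.out none) (s i) =
          ⟨some (some (Prog.seq load (.seq p unload)).entry), none, stks (s i) [] (onMain [])⟩ := by
        unfold initList
        congr 1
        funext k
        rcases k with _ | _ | w
        · rfl
        · rfl
        · cases w <;> rfl
      have ho : haltList (Prog.machine (.seq load (.seq p unload)) Stk.inp Stk.out none) [f i] =
          ⟨none, none, stks [] [f i] (onMain [])⟩ := by
        unfold haltList
        congr 1
        funext k
        rcases k with _ | _ | w
        · rfl
        · rfl
        · cases w <;> rfl
      rw [hi, ho]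
      exact hrun
    -- A bit has size at most 3, hence a pair of bits at most 7, and each list entry adds one inner
    -- node.
    · have hsz : (enc ((s i).map symbolBits).reverse).size ≤ 8 * (s i).length + 1 := by
        have := sz_list_le (l := ((s i).map symbolBits).reverse) (B := 7) fun x _ => by
          have := sz_bool_le x.1
          have := sz_bool_le x.2
          change sz (x.1, x.2) ≤ 7
          rw [sz_pair]
          omega
        simp only [List.length_reverse, List.length_map] at this
        change sz _ ≤ _
        omega
      have := ht₂.trans (eval_mono P hsz)
      simp only [Polynomial.eval_add, Polynomial.eval_mul, Polynomial.eval_comp,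
        Polynomial.eval_ofNat, Polynomial.eval_X, Polynomial.eval_one]
      omega
  choose t ht hev using hrun
  exact ⟨{
    tm := Prog.machine (.seq load (.seq p unload)) Stk.inp Stk.out none
    inputAlphabet := Equiv.refl Symbol
    outputAlphabet := Equiv.refl Bool
    time := 12 * Polynomial.X + 10 + P.comp (8 * Polynomial.X + 1)
    outputsFun := fun i => {
      steps := t i
      evals_in_steps := by
        have h := hev i
        have h₁ : List.map (Equiv.refl Symbol).invFun (s i) = s i := List.map_id _
        exact (congrArg (fun l => (flip bind (Prog.machine (.seq load (.seq p unload)) Stk.inp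
          Stk.out none).step)^[t i] (some (initList _ l))) h₁).trans h
      steps_le_m := ht i } }⟩

theorem solvableInPolyTimeOn_pathwidth_le_one :
    SolvableInPolyTimeOn fun _ G => pathwidth G ≤ 1 := by
  have h : PT (fun I : {I : Instance // pathwidth I.graph ≤ 1} =>
      enc (I.1.encode.map symbolBits).reverse) fun I => solve I.1.cells := PT.solve_bits
  unfold SolvableInPolyTimeOn
  convert h.exists_machine using 3
  rename_i I
  exact Bool.eq_iff_iff.2 (by simpa using (I.1.solve_cells_iff I.2).symm)

end ListRecoloring

theorem theorem3 :
    ListRecoloring.SolvableInPolyTimeOn (fun _ G => ListRecoloring.pathwidth G ≤ 1) := by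
  exact ListRecoloring.solvableInPolyTimeOn_pathwidth_le_one
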